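/- **Model.** Algorithms are fixed finite programs (independent of all inputs) for a randomized real RAM: memory cells hold natural numbers or real numbers; each arithmetic operation (including $\sqrt{\cdot}$), comparison, memory access and procedure call costs one unit of time, and so does drawing a standard Gaussian or a uniform element of $\{0,\dots,k-1\}$. Space is the number of memory cells occupied by the data structure $\mathcal D$ that preprocessing hands to the query algorithm. $\|\cdot\|$ is the Euclidean norm on $\mathbb R^d$. **Theorem.** There are a preprocessing program, a query program and absolute constants such that for all $0<\varepsilon<1$, $0<\delta<1$, $n\ge 1$, $d\ge 1$ there are $m=\Theta(1/\varepsilon^2)$, $l=\Theta(d+\log(1/\delta))$ and $r=\Theta(1+\log(n/\delta))$ with the following properties. 1. *(Data structure.)* On input $\varepsilon,\delta$ and any points $x_1,\dots,x_n\in\mathbb R^d$, preprocessing produces a data structure $\mathcal D$ which contains $\Pi_j$ and $\Pi_jx_i$ for $j\in[l]$, $i\in[n]$. Here $\Pi_1,\dots,\Pi_l\in\mathbb R^{m\times d}$ are independent random matrices with i.i.d. $N(0,1/m)$ entries, and they do not depend on the points. Preprocessing always takes time $O(\varepsilon^{-2}nd(d+\log(1/\delta)))$, and $\mathcal D$ occupies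 space $O(\varepsilon^{-2}(n+d)(d+\log(1/\delta)))$. 2. *(Query.)* Given only $\mathcal D$ and $q\in\mathbb R^d$, the query program, using fresh randomness, samples $j_1,\dots,j_r$ i.i.d. uniformly from $[l]$ and returns $\tilde d_1,\dots,\tilde d_n$, where $\tilde d_i$ is a median of $\|\Pi_{j_1}(q-x_i)\|,\dots,\|\Pi_{j_r}(q-x_i)\|$. It leaves $\mathcal D$ unchanged and always takes time $O(\varepsilon^{-2}(n+d)(1+\log(n/\delta)))$ (that is, $O(\varepsilon^{-2}(n+d)\log(n/\delta))$ if $n\ge2$). 3. *(Representativeness.)* With probability at least $1-\delta/2$ the matrices are $\varepsilon$-representative: for all unit vectors $v$ simultaneously, at least $0.9\,l$ of the indices $j\in[l]$ satisfy $1-\varepsilon\le\|\Pi_jv\|\le1+\varepsilon$. For every outcome of the preprocessing for which this holds, and for every $q\in\mathbb R^d$, the answer to $q$ is correct, i.e. $(1-\varepsilon)\|q-x_i\|\le\tilde d_i\le(1+\varepsilon)\|q-x_i\|$ for all $i\in[n]$, with probability at least $1-\delta/2$ over the randomness of the query. 4. *(Adaptive queries.)* For every (possibly randomized) adversary who chooses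 each query $q_t$ as a measurable function of the answers to $q_1,\dots,q_{t-1}$ and of his own randomness, and for every $t$, the answer to $q_t$ is correct with probability at least $1-\delta$. -/

import Mathlib

open MeasureTheory ProbabilityTheory
open scoped Matrix NNReal ENNReal

namespace ADE

/-! ### A randomized real RAM

The memory is a heap with two arrays, one of natural numbers (used for addresses and counters) and
one of real numbers. Programs are finite, do not depend on the input, and consist of (possibly
recursive) procedures with local natural-number variables. Natural numbers support `+`, truncated
`-`, `*` and comparison; real numbers support `+`, `-`, `*`, `/`, `√`, comparison and the cast from
the naturals. There is no rounding of reals and there are no bit operations. A random instruction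
draws a standard Gaussian real, or a uniform index below a given bound, in unit time.
Every operation, memory access, test and call costs one unit of time. -/

/-- The source of randomness of one run: an infinite sequence of standard Gaussians, and for
every draw number `p.1` and every `p.2` a uniform element of `{0, …, p.2}`. -/
abbrev Tape : Type := (ℕ → ℝ) × ((p : ℕ × ℕ) → Fin (p.2 + 1))

/-- All entries of a tape are independent. -/
noncomputable def tapeMeasure : Measure Tape :=
  (Measure.infinitePi fun _ : ℕ => gaussianReal 0 1).prod
    (Measure.infinitePi fun p : ℕ × ℕ => uniformOn (Set.univ : Set (Fin (p.2 + 1))))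

structure Heap where
  nat : ℕ → ℕ
  real : ℕ → ℝ

/-- All cells contain zero. -/
def Heap.zero : Heap := ⟨fun _ => 0, fun _ => 0⟩

/-- The two heaps coincide on the first `S` natural-number cells and the first `S` real cells. -/
def Heap.AgreeBelow (S : ℕ) (h h' : Heap) : Prop :=
  ∀ a < S, h.nat a = h'.nat a ∧ h.real a = h'.real a

structure State where
  /-- the local variables of the active procedure -/
  loc : ℕ → ℕ
  heap : Heap
  /-- the number of Gaussians drawn so far -/
  gpos : ℕ
  /-- the number of uniform indices drawn so far -/
  upos : ℕ

inductive NExp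
  | lit (k : ℕ)
  | var (i : ℕ)
  | load (a : NExp)
  | add (e f : NExp)
  | sub (e f : NExp)
  | mul (e f : NExp)

def NExp.eval (s : State) : NExp → ℕ
  | .lit k => k
  | .var i => s.loc i
  | .load a => s.heap.nat (a.eval s)
  | .add e f => e.eval s + f.eval s
  | .sub e f => e.eval s - f.eval s
  | .mul e f => e.eval s * f.eval s

def NExp.cost : NExp → ℕ
  | .lit _ => 1
  | .var _ => 1
  | .load a => a.cost + 1
  | .add e f => e.cost + f.cost + 1
  | .sub e f => e.cost + f.cost + 1
  | .mul e f => e.cost + f.cost + 1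

inductive RExp
  | ofNat (e : NExp)
  | load (a : NExp)
  /-- read a cell of the read-only input array -/
  | input (a : NExp)
  | add (e f : RExp)
  | sub (e f : RExp)
  | mul (e f : RExp)
  | div (e f : RExp)
  | sqrt (e : RExp)

noncomputable def RExp.eval (inp : ℕ → ℝ) (s : State) : RExp → ℝ
  | .ofNat e => (e.eval s : ℝ)
  | .load a => s.heap.real (a.eval s)
  | .input a => inp (a.eval s)
  | .add e f => e.eval inp s + f.eval inp s
  | .sub e f => e.eval inp s - f.eval inp s
  | .mul e f => e.eval inp s * f.eval inp s
  | .div e f => e.eval inp s / f.eval inp s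
  | .sqrt e => Real.sqrt (e.eval inp s)

def RExp.cost : RExp → ℕ
  | .ofNat e => e.cost + 1
  | .load a => a.cost + 1
  | .input a => a.cost + 1
  | .add e f => e.cost + f.cost + 1
  | .sub e f => e.cost + f.cost + 1
  | .mul e f => e.cost + f.cost + 1
  | .div e f => e.cost + f.cost + 1
  | .sqrt e => e.cost + 1

inductive Test
  | natLT (e f : NExp)
  | realLT (e f : RExp)

def Test.Holds (inp : ℕ → ℝ) (s : State) : Test → Prop
  | .natLT e f => e.eval s < f.eval s
  | .realLT e f => e.eval inp s < f.eval inp s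

def Test.cost : Test → ℕ
  | .natLT e f => e.cost + f.cost + 1
  | .realLT e f => e.cost + f.cost + 1

inductive Cmd
  | skip
  /-- set a local variable -/
  | setVar (i : ℕ) (e : NExp)
  | storeNat (a e : NExp)
  | storeReal (a : NExp) (e : RExp)
  /-- store a fresh standard Gaussian in a real cell -/
  | gauss (a : NExp)
  /-- set a local variable to a fresh uniform element of `{0, …, bound - 1}` -/
  | unif (i : ℕ) (bound : NExp)
  | seq (c c' : Cmd)
  | ite (b : Test) (c c' : Cmd)
  | loop (b : Test) (c : Cmd)
  /-- call a procedure; its arguments become its first local variables -/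
  | call (p : ℕ) (args : List NExp)

/-- A program is a finite list of procedures; it starts with procedure `0`. -/
abbrev Program : Type := List Cmd

/-- `Exec P inp ω c s t s'`: in program `P`, with input array `inp` and randomness `ω`, the command
`c` started in state `s` halts after exactly `t` units of time in state `s'`. -/
inductive Exec (P : Program) (inp : ℕ → ℝ) (ω : Tape) : Cmd → State → ℕ → State → Prop
  | skip (s : State) : Exec P inp ω .skip s 1 s
  | setVar (i : ℕ) (e : NExp) (s : State) :
      Exec P inp ω (.setVar i e) s (e.cost + 1)
        { s with loc := Function.update s.loc i (e.eval s) }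
  | storeNat (a e : NExp) (s : State) :
      Exec P inp ω (.storeNat a e) s (a.cost + e.cost + 1)
        { s with heap := ⟨Function.update s.heap.nat (a.eval s) (e.eval s), s.heap.real⟩ }
  | storeReal (a : NExp) (e : RExp) (s : State) :
      Exec P inp ω (.storeReal a e) s (a.cost + e.cost + 1)
        { s with heap := ⟨s.heap.nat, Function.update s.heap.real (a.eval s) (e.eval inp s)⟩ }
  | gauss (a : NExp) (s : State) :
      Exec P inp ω (.gauss a) s (a.cost + 1)
        { s with
          heap := ⟨s.heap.nat, Function.update s.heap.real (a.eval s) (ω.1 s.gpos)⟩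
          gpos := s.gpos + 1 }
  | unif (i : ℕ) (e : NExp) (s : State) :
      Exec P inp ω (.unif i e) s (e.cost + 1)
        { s with
          loc := Function.update s.loc i (ω.2 (s.upos, e.eval s - 1) : ℕ)
          upos := s.upos + 1 }
  | seq {c c' : Cmd} {s s₁ s₂ : State} {t t' : ℕ} :
      Exec P inp ω c s t s₁ → Exec P inp ω c' s₁ t' s₂ →
      Exec P inp ω (.seq c c') s (t + t') s₂
  | iteTrue {b : Test} {c c' : Cmd} {s s' : State} {t : ℕ} :
      b.Holds inp s → Exec P inp ω c s t s' →
      Exec P inp ω (.ite b c c') s (b.cost + t) s'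
  | iteFalse {b : Test} {c c' : Cmd} {s s' : State} {t : ℕ} :
      ¬ b.Holds inp s → Exec P inp ω c' s t s' →
      Exec P inp ω (.ite b c c') s (b.cost + t) s'
  | loopDone {b : Test} {c : Cmd} {s : State} :
      ¬ b.Holds inp s → Exec P inp ω (.loop b c) s b.cost s
  | loopStep {b : Test} {c : Cmd} {s s₁ s₂ : State} {t t' : ℕ} :
      b.Holds inp s → Exec P inp ω c s t s₁ → Exec P inp ω (.loop b c) s₁ t' s₂ →
      Exec P inp ω (.loop b c) s (b.cost + t + t') s₂
  | call {p : ℕ} {args : List NExp} {body : Cmd} {s s' : State} {t : ℕ} :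
      P[p]? = some body →
      Exec P inp ω body
        { s with loc := fun i => (args.map (NExp.eval s)).getD i 0 } t s' →
      Exec P inp ω (.call p args) s ((args.map NExp.cost).sum + 1 + t)
        { s' with loc := s.loc }

/-- `P.Runs inp ω args h t h'`: started on the heap `h` with the given arguments, `P` halts after
exactly `t` units of time and leaves the heap `h'`. -/
def Program.Runs (P : Program) (inp : ℕ → ℝ) (ω : Tape) (args : List ℕ)
    (h : Heap) (t : ℕ) (h' : Heap) : Prop :=
  ∃ s' : State, s'.heap = h' ∧
    Exec P inp ω (.call 0 (args.map NExp.lit)) ⟨fun _ => 0, h, 0, 0⟩ t s'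

/-- The input array of the preprocessing holds `ε`, `δ` and the points, one after the other. -/
def IsDataInput {n d : ℕ} (ε δ : ℝ) (x : Fin n → EuclideanSpace ℝ (Fin d)) (inp : ℕ → ℝ) : Prop :=
  inp 0 = ε ∧ inp 1 = δ ∧ ∀ (i : Fin n) (b : Fin d), inp (2 + (i : ℕ) * d + b) = x i b

/-- The input array of a query holds the coordinates of the query point. -/
def IsQueryInput {d : ℕ} (q : EuclideanSpace ℝ (Fin d)) (inp : ℕ → ℝ) : Prop :=
  ∀ b : Fin d, inp b = q b

/-! ### Sketches, medians and adaptive queries -/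

/-- The Euclidean norm of `M v`. -/
noncomputable def sketchNorm {m d : ℕ} (M : Matrix (Fin m) (Fin d) ℝ)
    (v : EuclideanSpace ℝ (Fin d)) : ℝ :=
  ‖WithLp.toLp 2 (M *ᵥ v.ofLp)‖

open Classical in
/-- The matrices are `ε`-representative: for every unit vector at least `0.9 l` of them preserve
its length up to a factor `1 ± ε`. -/
def IsRepresentative {l m d : ℕ} (ε : ℝ) (M : Fin l → Matrix (Fin m) (Fin d) ℝ) : Prop :=
  ∀ v : EuclideanSpace ℝ (Fin d), ‖v‖ = 1 →
    (9 / 10 : ℝ) * l ≤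
      ((Finset.univ.filter fun j : Fin l =>
        1 - ε ≤ sketchNorm (M j) v ∧ sketchNorm (M j) v ≤ 1 + ε).card : ℝ)

open Classical in
/-- `z` is a median of the list `y`. -/
def IsMedian {r : ℕ} (y : Fin r → ℝ) (z : ℝ) : Prop :=
  r ≤ 2 * (Finset.univ.filter fun k : Fin r => y k ≤ z).card ∧
    r ≤ 2 * (Finset.univ.filter fun k : Fin r => z ≤ y k).card

/-- `a` is a correct list of distance estimates for the query `q`. -/
def IsAccurate {n d : ℕ} (ε : ℝ) (x : Fin n → EuclideanSpace ℝ (Fin d))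
    (q : EuclideanSpace ℝ (Fin d)) (a : Fin n → ℝ) : Prop :=
  ∀ i, (1 - ε) * ‖q - x i‖ ≤ a i ∧ a i ≤ (1 + ε) * ‖q - x i‖

/-- The law of `l` independent `m × d` matrices with independent `N(0, 1/m)` entries. -/
noncomputable def gaussianSketchLaw (l m d : ℕ) : Measure (Fin l → Fin m → Fin d → ℝ) :=
  Measure.pi fun _ => Measure.pi fun _ => Measure.pi fun _ => gaussianReal 0 (1 / (m : ℝ≥0))

/-- The law of `r` independent uniform elements of `[l]`. -/
noncomputable def sampleLaw (l r : ℕ) : Measure (Fin r → Fin l) :=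
  Measure.pi fun _ => uniformOn (Set.univ : Set (Fin l))

/-- The answer in round `t`, if round `s` answers a query `q` by `respond s q` and the query of
round `t` is chosen by `adv` from all previous answers. -/
def adaptiveAnswer {Q A : Type*} (respond : ℕ → Q → A) (adv : (t : ℕ) → (Fin t → A) → Q)
    (t : ℕ) : A :=
  respond t (adv t fun s : Fin t => adaptiveAnswer respond adv s)
termination_by t
decreasing_by exact s.2

/-- The query of round `t` in the same interaction. -/
def adaptiveQuery {Q A : Type*} (respond : ℕ → Q → A) (adv : (t : ℕ) → (Fin t → A) → Q)
    (t : ℕ) : Q :=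
  adv t fun s : Fin t => adaptiveAnswer respond adv s

end ADE

/-!
The proof has a deterministic half, the verification of the two programs, and a probabilistic half.

**Parameters.** Up to rounding, the preprocessing takes `m = sketchConst / ε²` rows per matrix,
`l = d + log₂ (1 / δ)` matrices and `r = 2 log₂ (n / δ) + 3` samples per query. The machine has no
logarithm, so the parameters are found as least solutions of `sketchConst ≤ m ε²`, `1 ≤ 2 ^ k₁ δ`
and `n ≤ 2 ^ k₂ δ` by counting and doubling, within the time bound (`preProgram_runs`). Procedures
are named by their position in the program; the procedures `1` and `2` are common to both programs.

**Running time.** The predicate `Wp` expresses total correctness together with the running time; the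
rule `wp_loop` multiplies the number of rounds by the time of a round. As the time of a query is
bounded for every outcome of the random draws, the medians are computed by the deterministic linear
time algorithm with the median of the medians of groups of five as the pivot (`median_of_medians`,
`selects_selectProc`). An element of rank `k` is characterized by counting (`IsOrderStat`); as it is
unique (`IsOrderStat.unique`), the output of a query is a function of the data structure, the query
and the tape (`queryProgram_runs_dataHeap`).

**Representativeness.** For a fixed vector, Chebyshev's inequality with the fourth moment of a
Gaussian bounds the probability that one matrix distorts its length (`sketchLaw_deviation_le`), and
the probability that more than `l / 30` of the matrices do so is exponentially small in `l`, with a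
rate as large as desired. The passage to all unit vectors simultaneously needs no net. By Fubini's
theorem and Markov's inequality, with probability `1 - δ / 2` the set `T` of vectors in the ball of
radius `2` distorted by more than `l / 30` matrices has less than a third of the volume of the unit
ball. Hence for every unit vector `v` there is a `w` in the unit ball such that none of `v + w`,
`v - w`, `w` lies in `T`. The difference `‖M u‖² - ‖u‖²` is a quadratic form in `u`, and by the
parallelogram law a matrix which is good for these three vectors is good for `v`; at least
`l - 3 l / 30` matrices are (`isRepresentative_of_volume_lt`,
`gaussianSketchLaw_not_isRepresentative_le`).

**Queries.** If the matrices are representative, at most a tenth of them are bad for `q - x i`, and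
the median is wrong only if more than half of the samples are bad. A union bound over the sets of
samples and over the points gives the failure probability `δ / 2` (`sampleLaw_not_isAccurate_le`).

**Adaptivity.** Representativeness does not refer to the queries, and for a fixed outcome of the
preprocessing the query of round `t` is a function of the tapes of the earlier rounds and of the
randomness of the adversary. It is therefore independent of the tape that serves to answer it, and
the bound for fixed queries applies (`adaptive_failure_le`).
-/

/-! ### Total correctness and running time on the real RAM -/

namespace ADE

/-- Total correctness with running time: `c`, started in `s`, halts after some time `t` in some
state `s'` such that `Q t s'`. -/
def Wp (P : Program) (inp : ℕ → ℝ) (ω : Tape) (c : Cmd) (s : State) (Q : ℕ → State → Prop) : Prop :=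
  ∃ t s', Exec P inp ω c s t s' ∧ Q t s'

section
variable {P : Program} {inp : ℕ → ℝ} {ω : Tape}

theorem Wp.mono {c : Cmd} {s : State} {Q Q' : ℕ → State → Prop} (h : Wp P inp ω c s Q)
    (hQ : ∀ t s', Q t s' → Q' t s') : Wp P inp ω c s Q' := by
  obtain ⟨t, s', he, hq⟩ := h
  exact ⟨t, s', he, hQ _ _ hq⟩

theorem wp_skip {s : State} {Q : ℕ → State → Prop} (h : Q 1 s) : Wp P inp ω .skip s Q :=
  ⟨_, _, .skip s, h⟩

theorem wp_setVar {i : ℕ} {e : NExp} {s : State} {Q : ℕ → State → Prop}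
    (h : Q (e.cost + 1) { s with loc := Function.update s.loc i (e.eval s) }) :
    Wp P inp ω (.setVar i e) s Q := ⟨_, _, .setVar i e s, h⟩

theorem wp_storeNat {a e : NExp} {s : State} {Q : ℕ → State → Prop}
    (h : Q (a.cost + e.cost + 1)
      { s with heap := ⟨Function.update s.heap.nat (a.eval s) (e.eval s), s.heap.real⟩ }) :
    Wp P inp ω (.storeNat a e) s Q := ⟨_, _, .storeNat a e s, h⟩

theorem wp_storeReal {a : NExp} {e : RExp} {s : State} {Q : ℕ → State → Prop}
    (h : Q (a.cost + e.cost + 1)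
      { s with heap := ⟨s.heap.nat, Function.update s.heap.real (a.eval s) (e.eval inp s)⟩ }) :
    Wp P inp ω (.storeReal a e) s Q := ⟨_, _, .storeReal a e s, h⟩

theorem wp_gauss {a : NExp} {s : State} {Q : ℕ → State → Prop}
    (h : Q (a.cost + 1)
      { s with
        heap := ⟨s.heap.nat, Function.update s.heap.real (a.eval s) (ω.1 s.gpos)⟩
        gpos := s.gpos + 1 }) :
    Wp P inp ω (.gauss a) s Q := ⟨_, _, .gauss a s, h⟩

theorem wp_unif {i : ℕ} {e : NExp} {s : State} {Q : ℕ → State → Prop}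
    (h : Q (e.cost + 1)
      { s with
        loc := Function.update s.loc i (ω.2 (s.upos, e.eval s - 1) : ℕ)
        upos := s.upos + 1 }) :
    Wp P inp ω (.unif i e) s Q := ⟨_, _, .unif i e s, h⟩

theorem wp_seq {c c' : Cmd} {s : State} {Q : ℕ → State → Prop}
    (h : Wp P inp ω c s fun t s₁ => Wp P inp ω c' s₁ fun t' s₂ => Q (t + t') s₂) :
    Wp P inp ω (.seq c c') s Q := by
  obtain ⟨t, s₁, h₁, t', s₂, h₂, hq⟩ := h
  exact ⟨_, _, .seq h₁ h₂, hq⟩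

theorem wp_ite {b : Test} {c c' : Cmd} {s : State} {Q : ℕ → State → Prop}
    (h₁ : b.Holds inp s → Wp P inp ω c s fun t s' => Q (b.cost + t) s')
    (h₂ : ¬ b.Holds inp s → Wp P inp ω c' s fun t s' => Q (b.cost + t) s') :
    Wp P inp ω (.ite b c c') s Q := by
  by_cases hb : b.Holds inp s
  · obtain ⟨t, s', he, hq⟩ := h₁ hb
    exact ⟨_, _, .iteTrue hb he, hq⟩
  · obtain ⟨t, s', he, hq⟩ := h₂ hb
    exact ⟨_, _, .iteFalse hb he, hq⟩

theorem wp_call {p : ℕ} {args : List NExp} {body : Cmd} {s : State} {Q : ℕ → State → Prop}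
    (hP : P[p]? = some body)
    (h : Wp P inp ω body { s with loc := fun i => (args.map (NExp.eval s)).getD i 0 }
      fun t s' => Q ((args.map NExp.cost).sum + 1 + t) { s' with loc := s.loc }) :
    Wp P inp ω (.call p args) s Q := by
  obtain ⟨t, s', he, hq⟩ := h
  exact ⟨_, _, .call hP he, hq⟩

/-- A loop with an invariant `I k`, indexed by the number `k` of completed rounds, of which there
are exactly `N`. -/
theorem wp_loop {b : Test} {c : Cmd} {I : ℕ → State → Prop} {N T : ℕ}
    (hb : ∀ k s, k < N → I k s →
      b.Holds inp s ∧ Wp P inp ω c s fun t s' => t ≤ T ∧ I (k + 1) s')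
    (hN : ∀ s, I N s → ¬ b.Holds inp s) {s : State} (h₀ : I 0 s) :
    Wp P inp ω (.loop b c) s fun t s' => t ≤ N * (b.cost + T) + b.cost ∧ I N s' := by
  have main : ∀ j k s, k + j = N → I k s → Wp P inp ω (.loop b c) s
      fun t s' => t ≤ j * (b.cost + T) + b.cost ∧ I N s' := by
    intro j
    induction j with
    | zero =>
      intro k s hk hI
      obtain rfl : k = N := by omega
      exact ⟨_, _, .loopDone (hN s hI), by simp, hI⟩
    | succ j ih =>
      intro k s hk hI
      obtain ⟨hB, t, s₁, he, ht, hI'⟩ := hb k s (by omega) hI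
      obtain ⟨t', s₂, he', ht', hI''⟩ := ih (k + 1) s₁ (by omega) hI'
      refine ⟨_, _, .loopStep hB he he', ?_, hI''⟩
      rw [Nat.succ_mul]
      omega
  exact main N 0 s (by omega) h₀

/-- `for i = 0, …, N - 1 do c`, where `i` is a local variable and `N` is evaluated anew before every
round. -/
def forC (i : ℕ) (N : NExp) (c : Cmd) : Cmd :=
  .seq (.setVar i (.lit 0))
    (.loop (.natLT (.var i) N) (.seq c (.setVar i (.add (.var i) (.lit 1)))))

/-- A counting loop. The body must not change the counter. -/
theorem wp_forC {i : ℕ} {N : NExp} {c : Cmd} (I : ℕ → State → Prop) (n T : ℕ) {s : State}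
    (hN : ∀ k s', s'.loc i = k → I k s' → N.eval s' = n)
    (h₀ : I 0 { s with loc := Function.update s.loc i 0 })
    (hc : ∀ k s', k < n → s'.loc i = k → I k s' →
      Wp P inp ω c s' fun t s'' => t ≤ T ∧ s''.loc i = k ∧
        I (k + 1) { s'' with loc := Function.update s''.loc i (k + 1) }) :
    Wp P inp ω (forC i N c) s fun t s' => t ≤ n * (N.cost + 6 + T) + N.cost + 4 ∧ I n s' := by
  refine wp_seq (wp_setVar ?_)
  refine (wp_loop (I := fun k s' => s'.loc i = k ∧ I k s') (N := n)
    (T := T + 4) ?_ ?_ ⟨by simp, h₀⟩).mono ?_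
  · rintro k s' hk ⟨hl, hI⟩
    refine ⟨?_, wp_seq ((hc k s' hk hl hI).mono ?_)⟩
    · simp [Test.Holds, NExp.eval, hN k s' hl hI, hl, hk]
    · rintro t s'' ⟨ht, hl', hI'⟩
      refine wp_setVar ⟨?_, ?_, ?_⟩
      · simp only [NExp.cost]; omega
      · simp [hl', NExp.eval]
      · simpa [hl', NExp.eval] using hI'
  · rintro s' ⟨hl, hI⟩
    simp [Test.Holds, NExp.eval, hN n s' hl hI, hl]
  · rintro t s' ⟨ht, hl, hI⟩
    refine ⟨?_, hI⟩
    simp only [Test.cost, NExp.cost] at ht ⊢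
    have : 1 + N.cost + 1 + (T + 4) = N.cost + 6 + T := by ring
    rw [this] at ht
    omega

/-- A counting loop whose body restores the local variables: the invariant only concerns the
heap and the number of random draws. -/
theorem wp_forC_frame {i : ℕ} {N : NExp} {c : Cmd} (I : ℕ → Heap → ℕ → ℕ → Prop) (n T : ℕ)
    {s : State} (hN : ∀ k h g u, N.eval ⟨Function.update s.loc i k, h, g, u⟩ = n)
    (h₀ : I 0 s.heap s.gpos s.upos)
    (hc : ∀ k h g u, k < n → I k h g u →
      Wp P inp ω c ⟨Function.update s.loc i k, h, g, u⟩ fun t s'' => t ≤ T ∧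
        s''.loc = Function.update s.loc i k ∧ I (k + 1) s''.heap s''.gpos s''.upos) :
    Wp P inp ω (forC i N c) s fun t s' => t ≤ n * (N.cost + 6 + T) + N.cost + 4 ∧
      s'.loc = Function.update s.loc i n ∧ I n s'.heap s'.gpos s'.upos := by
  refine wp_forC (fun k s' => s'.loc = Function.update s.loc i k ∧ I k s'.heap s'.gpos s'.upos)
    n T ?_ ⟨rfl, h₀⟩ ?_
  · rintro k ⟨l, h, g, u⟩ - ⟨hl, -⟩
    obtain rfl : l = _ := hl
    exact hN k h g u
  · rintro k ⟨l, h, g, u⟩ hk - ⟨hl, hI⟩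
    obtain rfl : l = _ := hl
    refine (hc k h g u hk hI).mono ?_
    rintro t s'' ⟨ht, hl', hI'⟩
    exact ⟨ht, by simp [hl'], by simp [hl'], hI'⟩

end

end ADE

/-! ### Counting and order statistics -/

namespace ADE

open Classical in
/-- The number of `i < n` with `p i`. -/
noncomputable def cnt (p : ℕ → Prop) (n : ℕ) : ℕ := Nat.count p n

@[simp] theorem cnt_zero (p : ℕ → Prop) : cnt p 0 = 0 := by simp [cnt]

theorem cnt_succ_of {p : ℕ → Prop} {n : ℕ} (h : p n) : cnt p (n + 1) = cnt p n + 1 := by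
  classical simp [cnt, Nat.count_succ, h]

theorem cnt_succ_of_not {p : ℕ → Prop} {n : ℕ} (h : ¬ p n) : cnt p (n + 1) = cnt p n := by
  classical simp [cnt, Nat.count_succ, h]

theorem cnt_le (p : ℕ → Prop) (n : ℕ) : cnt p n ≤ n := by
  classical exact Nat.count_le _

theorem cnt_add (p : ℕ → Prop) (m n : ℕ) :
    cnt p (m + n) = cnt p m + cnt (fun i => p (m + i)) n := by
  classical
  simp only [cnt, Nat.count_add]

theorem cnt_mono {p q : ℕ → Prop} {n : ℕ} (h : ∀ i < n, p i → q i) : cnt p n ≤ cnt q n := by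
  induction n with
  | zero => simp
  | succ n ih =>
    have ih := ih fun i hi => h i (by omega)
    by_cases hp : p n
    · rw [cnt_succ_of hp, cnt_succ_of (h n (by omega) hp)]; omega
    · rw [cnt_succ_of_not hp]
      by_cases hq : q n
      · rw [cnt_succ_of hq]; omega
      · rw [cnt_succ_of_not hq]; exact ih

theorem cnt_congr {p q : ℕ → Prop} {n : ℕ} (h : ∀ i < n, p i ↔ q i) : cnt p n = cnt q n :=
  le_antisymm (cnt_mono fun i hi => (h i hi).1) (cnt_mono fun i hi => (h i hi).2)

/-- Splitting a count by a second predicate. -/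
theorem cnt_and_add_cnt_and_not (p q : ℕ → Prop) (n : ℕ) :
    cnt (fun i => q i ∧ p i) n + cnt (fun i => ¬ q i ∧ p i) n = cnt p n := by
  induction n with
  | zero => simp
  | succ n ih =>
    by_cases hp : p n <;> by_cases hq : q n <;>
      simp only [cnt_succ_of, cnt_succ_of_not, hp, hq, not_true_eq_false, not_false_eq_true,
        and_self, and_true, and_false] <;> omega

theorem cnt_add_cnt_not (p : ℕ → Prop) (n : ℕ) : cnt p n + cnt (fun i => ¬ p i) n = n := by
  induction n with
  | zero => simp
  | succ n ih =>
    by_cases hp : p n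
    · rw [cnt_succ_of hp, cnt_succ_of_not (by simpa using hp)]; omega
    · rw [cnt_succ_of_not hp, cnt_succ_of (by simpa using hp)]; omega

theorem exists_of_cnt_pos {p : ℕ → Prop} {n : ℕ} (h : 0 < cnt p n) : ∃ i < n, p i := by
  by_contra! hc
  have : cnt p n ≤ cnt (fun _ => False) n := cnt_mono fun i hi hp => hc i hi hp
  have h0 : ∀ n, cnt (fun _ => False) n = 0 := fun n => by
    induction n with
    | zero => simp
    | succ n ih => rw [cnt_succ_of_not (by simp), ih]
  have := h0 n
  omega

theorem cnt_eq_card_fin (p : ℕ → Prop) (n : ℕ) [DecidablePred fun i : Fin n => p i] :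
    cnt p n = (Finset.univ.filter fun i : Fin n => p i).card := by
  classical
  rw [cnt, Nat.count_eq_card_filter_range, Finset.card_filter, Finset.card_filter,
    Finset.sum_range]
  congr!

/-- `z` is the element of rank `k` (counted from zero) among `y 0, …, y (len - 1)`. -/
def IsOrderStat (y : ℕ → ℝ) (len k : ℕ) (z : ℝ) : Prop :=
  cnt (fun i => y i < z) len ≤ k ∧ k < cnt (fun i => y i ≤ z) len

theorem IsOrderStat.congr {y y' : ℕ → ℝ} {len k : ℕ} {z : ℝ} (h : IsOrderStat y len k z)
    (hy : ∀ i < len, y i = y' i) : IsOrderStat y' len k z := by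
  refine ⟨?_, ?_⟩
  · rw [← cnt_congr (p := fun i => y i < z) fun i hi => by rw [hy i hi]]; exact h.1
  · rw [← cnt_congr (p := fun i => y i ≤ z) fun i hi => by rw [hy i hi]]; exact h.2

/-- Since `z ≤ c` just says that more than `k` of the values are at most `c`, the element of rank
`k` is unique, and measurable in the values. -/
theorem IsOrderStat.le_iff {y : ℕ → ℝ} {len k : ℕ} {z : ℝ} (h : IsOrderStat y len k z) (c : ℝ) :
    z ≤ c ↔ k < cnt (fun i => y i ≤ c) len := by
  constructor
  · intro hc
    exact h.2.trans_le (cnt_mono fun i _ hi => hi.trans hc)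
  · intro hk
    by_contra! hc
    have := cnt_mono (n := len) (p := fun i => y i ≤ c) (q := fun i => y i < z)
      fun i _ hi => lt_of_le_of_lt hi hc
    have := h.1
    omega

theorem IsOrderStat.unique {y : ℕ → ℝ} {len k : ℕ} {z z' : ℝ} (h : IsOrderStat y len k z)
    (h' : IsOrderStat y len k z') : z = z' :=
  le_antisymm ((h.le_iff z').2 h'.2) ((h'.le_iff z).2 h.2)

theorem exists_isOrderStat (y : ℕ → ℝ) {len k : ℕ} (hk : k < len) :
    ∃ i < len, IsOrderStat y len k (y i) := by
  classical
  set A := (Finset.range len).filter fun j => k < cnt (fun i => y i ≤ y j) len with hA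
  have hne : A.Nonempty := by
    obtain ⟨j, hj, hmax⟩ := Finset.exists_max_image (Finset.range len) y ⟨k, by simpa using hk⟩
    refine ⟨j, Finset.mem_filter.2 ⟨hj, ?_⟩⟩
    have h1 : cnt (fun i => y i ≤ y j) len = cnt (fun _ => True) len :=
      cnt_congr fun i hi => by simpa using hmax i (by simpa using hi)
    have h2 := cnt_add_cnt_not (fun _ => True) len
    have h3 : ¬ 0 < cnt (fun _ => ¬ True) len := fun h => by
      obtain ⟨i, -, hi⟩ := exists_of_cnt_pos h
      exact hi trivial
    omega
  obtain ⟨j, hj, hmin⟩ := Finset.exists_min_image A y hne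
  obtain ⟨hj1, hj2⟩ := Finset.mem_filter.1 hj
  refine ⟨j, by simpa using hj1, ?_, hj2⟩
  by_contra! hlt
  obtain ⟨i₀, hi₀, hi₀'⟩ := exists_of_cnt_pos (by omega : 0 < cnt (fun i => y i < y j) len)
  obtain ⟨i, hi, hmax⟩ := Finset.exists_max_image
    ((Finset.range len).filter fun i => y i < y j) y ⟨i₀, by simp [hi₀, hi₀']⟩
  obtain ⟨hi1, hi2⟩ := Finset.mem_filter.1 hi
  have hi3 : i ∈ A := Finset.mem_filter.2 ⟨hi1, hlt.trans_le
    (cnt_mono fun i' h1 h2 => hmax i' (by simp [h1, h2]))⟩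
  exact absurd (hmin i hi3) (not_le.2 hi2)

/-- Selection among the elements below a pivot. -/
theorem IsOrderStat.of_lt {y w : ℕ → ℝ} {len L k : ℕ} {p z : ℝ}
    (hw : ∀ q : ℝ → Prop, cnt (fun i => q (w i)) L = cnt (fun i => y i < p ∧ q (y i)) len)
    (h : IsOrderStat w L k z) : IsOrderStat y len k z := by
  obtain ⟨h1, h2⟩ := h
  rw [hw (· < z)] at h1
  rw [hw (· ≤ z)] at h2
  have hz : z ≤ p := by
    by_contra! hz
    refine absurd (h2.trans_le (cnt_mono (q := fun i => y i < p ∧ y i < z) ?_)) (by omega)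
    exact fun i _ hi => ⟨hi.1, hi.1.trans hz⟩
  refine ⟨(cnt_mono fun i _ hi => ⟨hi.trans_le hz, hi⟩).trans h1,
    h2.trans_le (cnt_mono fun i _ hi => hi.2)⟩

/-- Selection among the elements above a pivot. -/
theorem IsOrderStat.of_gt {y w : ℕ → ℝ} {len G k : ℕ} {p z : ℝ}
    (hw : ∀ q : ℝ → Prop, cnt (fun i => q (w i)) G = cnt (fun i => p < y i ∧ q (y i)) len)
    (hG : G = cnt (fun i => p < y i) len) (hk : len - G ≤ k)
    (h : IsOrderStat w G (k - (len - G)) z) : IsOrderStat y len k z := by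
  obtain ⟨h1, h2⟩ := h
  rw [hw (· < z)] at h1
  rw [hw (· ≤ z)] at h2
  obtain ⟨i, -, hi1, hi2⟩ := exists_of_cnt_pos ((Nat.zero_le _).trans_lt h2)
  have hz : p < z := hi1.trans_le hi2
  have e := cnt_add_cnt_not (fun i => p < y i) len
  have e1 := cnt_and_add_cnt_and_not (fun i => y i < z) (fun i => p < y i) len
  have e2 := cnt_and_add_cnt_and_not (fun i => y i ≤ z) (fun i => p < y i) len
  have e3 : cnt (fun i => ¬ p < y i ∧ y i < z) len ≤ cnt (fun i => ¬ p < y i) len :=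
    cnt_mono fun i _ hi => hi.1
  have e4 : cnt (fun i => ¬ p < y i ∧ y i ≤ z) len = cnt (fun i => ¬ p < y i) len :=
    cnt_congr fun i _ => ⟨fun hi => hi.1, fun hi => ⟨hi, (not_lt.1 hi).trans hz.le⟩⟩
  constructor <;> omega

/-- The pivot itself has rank `k`. -/
theorem isOrderStat_pivot {y : ℕ → ℝ} {len k : ℕ} {p : ℝ}
    (h1 : ¬ k < cnt (fun i => y i < p) len) (h2 : k < len - cnt (fun i => p < y i) len) :
    IsOrderStat y len k p := by
  have e := cnt_add_cnt_not (fun i => p < y i) len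
  simp only [not_lt] at e
  exact ⟨by omega, by omega⟩

/-- If each of the groups with `r` contains three elements with `q`, then `q` holds at least
three times as often as `r`. -/
theorem three_mul_cnt_le {q : ℕ → Prop} {r : ℕ → Prop} (g : ℕ)
    (h : ∀ i < g, r i → 3 ≤ cnt (fun j => q (5 * i + j)) 5) : 3 * cnt r g ≤ cnt q (5 * g) := by
  induction g with
  | zero => simp
  | succ g ih =>
    have ih := ih fun i hi => h i (by omega)
    rw [Nat.mul_succ, cnt_add q]
    by_cases hr : r g
    · rw [cnt_succ_of hr]
      have := h g (by omega) hr
      omega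
    · rw [cnt_succ_of_not hr]; omega

theorem cnt_mono_right (p : ℕ → Prop) {m n : ℕ} (h : m ≤ n) : cnt p m ≤ cnt p n := by
  obtain ⟨k, rfl⟩ := Nat.exists_eq_add_of_le h
  rw [cnt_add]; omega

/-- The median of the medians of `2h + 1` groups of five is a good pivot: at least `3(h + 1)`
elements are not smaller and as many are not larger. -/
theorem median_of_medians {y med : ℕ → ℝ} {len h : ℕ} {p : ℝ} (hlen : 10 * h + 5 ≤ len)
    (hmed : ∀ g < 2 * h + 1, IsOrderStat (fun j => y (5 * g + j)) 5 2 (med g))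
    (hp : IsOrderStat med (2 * h + 1) h p) :
    cnt (fun i => y i < p) len + 3 * (h + 1) ≤ len ∧
      cnt (fun i => p < y i) len + 3 * (h + 1) ≤ len := by
  have e1 := cnt_add_cnt_not (fun i => y i < p) len
  have e2 := cnt_add_cnt_not (fun i => p < y i) len
  have e3 := cnt_add_cnt_not (fun g => med g < p) (2 * h + 1)
  have f1 : 3 * cnt (fun g => ¬ med g < p) (2 * h + 1) ≤
      cnt (fun i => ¬ y i < p) (5 * (2 * h + 1)) := by
    refine three_mul_cnt_le _ fun g hg hr => ?_
    have a1 : cnt (fun j => y (5 * g + j) < med g) 5 ≤ 2 := (hmed g hg).1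
    have a2 := cnt_add_cnt_not (fun j => y (5 * g + j) < med g) 5
    have a3 : cnt (fun j => ¬ y (5 * g + j) < med g) 5 ≤ cnt (fun j => ¬ y (5 * g + j) < p) 5 :=
      cnt_mono fun j _ hj => by simp only [not_lt] at *; linarith
    omega
  have f2 : 3 * cnt (fun g => med g ≤ p) (2 * h + 1) ≤
      cnt (fun i => ¬ p < y i) (5 * (2 * h + 1)) := by
    refine three_mul_cnt_le _ fun g hg hr => ?_
    have a1 : 2 < cnt (fun j => y (5 * g + j) ≤ med g) 5 := (hmed g hg).2
    have a3 : cnt (fun j => y (5 * g + j) ≤ med g) 5 ≤ cnt (fun j => ¬ p < y (5 * g + j)) 5 :=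
      cnt_mono fun j _ hj => by simp only [not_lt] at *; linarith
    omega
  have g1 := cnt_mono_right (fun i => ¬ y i < p) (by omega : 5 * (2 * h + 1) ≤ len)
  have g2 := cnt_mono_right (fun i => ¬ p < y i) (by omega : 5 * (2 * h + 1) ≤ len)
  have := hp.1
  have := hp.2
  constructor <;> omega

end ADE

/-! ### Matrix-vector products and norms on the real RAM -/

namespace ADE

/-- Procedure `1`, arguments `d, row, x, out`: store in the real cell `out` the inner product of the
`d` cells from `row` on with the `d` input cells from `x` on. -/
def dotProc : Cmd :=
  .seq (.storeReal (.var 3) (.ofNat (.lit 0)))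
    (forC 4 (.var 0) (.storeReal (.var 3) (.add (.load (.var 3))
      (.mul (.load (.add (.var 1) (.var 4))) (.input (.add (.var 2) (.var 4)))))))

/-- Procedure `2`, arguments `m, d, base, x, out`: multiply the `m × d` matrix stored row by row
from `base` on by the vector in the input cells from `x` on. -/
def matVecProc : Cmd :=
  forC 5 (.var 0) (.call 1 [.var 1, .add (.var 2) (.mul (.var 5) (.var 1)), .var 3,
    .add (.var 4) (.var 5)])

/-- Procedure `3` of a query, arguments `m, u, v, out`: store in the real cell `out` the Euclidean
distance of the vectors of length `m` stored from `u` and from `v` on. -/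
def distProc : Cmd :=
  .seq (.storeReal (.var 3) (.ofNat (.lit 0)))
    (.seq (forC 4 (.var 0) (.storeReal (.var 3) (.add (.load (.var 3))
      (.mul (.sub (.load (.add (.var 1) (.var 4))) (.load (.add (.var 2) (.var 4))))
        (.sub (.load (.add (.var 1) (.var 4))) (.load (.add (.var 2) (.var 4))))))))
    (.storeReal (.var 3) (.sqrt (.load (.var 3)))))

section
variable {P : Program} {inp : ℕ → ℝ} {ω : Tape}

/-- The cell `out`, which serves as the accumulator, has to lie beyond the row that is read. -/
theorem wp_dotProc {s : State} {d row x out : ℕ} (h0 : s.loc 0 = d) (h1 : s.loc 1 = row)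
    (h2 : s.loc 2 = x) (h3 : s.loc 3 = out) (hsep : row + d ≤ out) :
    Wp P inp ω dotProc s fun t s' => t ≤ 21 * d + 9 ∧ s'.gpos = s.gpos ∧ s'.upos = s.upos ∧
      s'.heap = ⟨s.heap.nat, Function.update s.heap.real out
        (∑ b ∈ Finset.range d, s.heap.real (row + b) * inp (x + b))⟩ := by
  refine wp_seq (wp_storeReal ((wp_forC_frame (fun k h g u => g = s.gpos ∧ u = s.upos ∧
    h = ⟨s.heap.nat, Function.update s.heap.real out
        (∑ b ∈ Finset.range k, s.heap.real (row + b) * inp (x + b))⟩) d 14 ?_ ?_ ?_).mono ?_))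
  · intro k h g u
    simp [NExp.eval, h0]
  · simp [NExp.eval, RExp.eval, h3]
  · rintro k h g u hk ⟨rfl, rfl, rfl⟩
    refine wp_storeReal ⟨by simp [NExp.cost, RExp.cost], rfl, rfl, rfl, ?_⟩
    have : row + k ≠ out := by omega
    simp [NExp.eval, RExp.eval, h1, h2, h3, this, Finset.sum_range_succ]
  · rintro t s' ⟨ht, -, hg, hu, hh⟩
    refine ⟨?_, hg, hu, hh⟩
    simp only [NExp.cost, RExp.cost] at ht ⊢
    omega

/-- The product goes to the cells `out, …, out + m - 1`, beyond the matrix; nothing else changes. -/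
theorem wp_matVecProc (hP : P[1]? = some dotProc) {s : State} {m d base x out : ℕ}
    (h0 : s.loc 0 = m) (h1 : s.loc 1 = d) (h2 : s.loc 2 = base) (h3 : s.loc 3 = x)
    (h4 : s.loc 4 = out) (hsep : base + m * d ≤ out) :
    Wp P inp ω matVecProc s fun t s' => t ≤ m * (21 * d + 27) + 5 ∧ s'.gpos = s.gpos ∧
      s'.upos = s.upos ∧ s'.heap.nat = s.heap.nat ∧
      (∀ c, c < out ∨ out + m ≤ c → s'.heap.real c = s.heap.real c) ∧
      ∀ a < m, s'.heap.real (out + a) =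
        ∑ b ∈ Finset.range d, s.heap.real (base + a * d + b) * inp (x + b) := by
  refine (wp_forC_frame (fun k h g u => g = s.gpos ∧ u = s.upos ∧ h.nat = s.heap.nat ∧
      (∀ c, c < out ∨ out + k ≤ c → h.real c = s.heap.real c) ∧
      ∀ a < k, h.real (out + a) =
        ∑ b ∈ Finset.range d, s.heap.real (base + a * d + b) * inp (x + b))
      m (21 * d + 20) ?_ ?_ ?_).mono ?_
  · intro k h g u
    simp [NExp.eval, h0]
  · simp
  · rintro k h g u hk ⟨rfl, rfl, hn, hf, hv⟩
    have hkd : k * d + d ≤ m * d := by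
      rw [← Nat.succ_mul]; exact Nat.mul_le_mul_right _ hk
    refine wp_call hP ((wp_dotProc (d := d) (row := base + k * d) (x := x) (out := out + k)
      ?_ ?_ ?_ ?_ (by omega)).mono ?_)
    · simp [NExp.eval, h1]
    · simp [NExp.eval, h1, h2]
    · simp [NExp.eval, h3]
    · simp [NExp.eval, h4]
    · rintro t s' ⟨ht, hg, hu, hh⟩
      refine ⟨?_, rfl, hg, hu, ?_, ?_, ?_⟩
      · simp [NExp.cost]; omega
      · simp [hh, hn]
      · intro c hc
        have : c ≠ out + k := by omega
        simp only [hh, Function.update_of_ne this]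
        exact hf c (by omega)
      · intro a ha
        rcases Nat.lt_succ_iff_lt_or_eq.1 ha with ha | rfl
        · have : out + a ≠ out + k := by omega
          simp only [hh, Function.update_of_ne this]
          exact hv a ha
        · simp only [hh, Function.update_self]
          refine Finset.sum_congr rfl fun b hb => ?_
          have := Finset.mem_range.1 hb
          rw [hf _ (by omega)]
  · rintro t s' ⟨ht, -, hg, hu, hn, hf, hv⟩
    refine ⟨?_, hg, hu, hn, hf, hv⟩
    simp only [NExp.cost] at ht
    have : 1 + 6 + (21 * d + 20) = 21 * d + 27 := by ring
    rw [this] at ht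
    omega

theorem wp_distProc {s : State} {m u v out : ℕ} (h0 : s.loc 0 = m) (h1 : s.loc 1 = u)
    (h2 : s.loc 2 = v) (h3 : s.loc 3 = out) (hu : u + m ≤ out) (hv : v + m ≤ out) :
    Wp P inp ω distProc s fun t s' => t ≤ 34 * m + 14 ∧ s'.gpos = s.gpos ∧ s'.upos = s.upos ∧
      s'.heap = ⟨s.heap.nat, Function.update s.heap.real out
        (√(∑ a ∈ Finset.range m, (s.heap.real (u + a) - s.heap.real (v + a)) ^ 2))⟩ := by
  refine wp_seq (wp_storeReal (wp_seq ((wp_forC_frame (fun k h g w => g = s.gpos ∧ w = s.upos ∧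
    h = ⟨s.heap.nat, Function.update s.heap.real out
        (∑ a ∈ Finset.range k, (s.heap.real (u + a) - s.heap.real (v + a)) ^ 2)⟩) m 27 ?_ ?_
      ?_).mono ?_)))
  · intro k h g u
    simp [NExp.eval, h0]
  · simp [NExp.eval, RExp.eval, h3]
  · rintro k h g w hk ⟨rfl, rfl, rfl⟩
    refine wp_storeReal ⟨by simp [NExp.cost, RExp.cost], rfl, rfl, rfl, ?_⟩
    have e1 : u + k ≠ out := by omega
    have e2 : v + k ≠ out := by omega
    simp [NExp.eval, RExp.eval, h1, h2, h3, e1, e2, Finset.sum_range_succ, pow_two]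
  · rintro t s' ⟨ht, hl, hg, hu, hh⟩
    refine wp_storeReal ⟨?_, hg, hu, ?_⟩
    · simp only [NExp.cost, RExp.cost] at ht ⊢
      omega
    · simp [hl, hh, h3, NExp.eval, RExp.eval]

end

end ADE

/-! ### Selection in quadratic time, and filtering -/

namespace ADE

/-- Procedure `4` of a query, arguments `a, len, k, f, i`: if the real cell `a + i` has rank `k`
among the `len` cells from `a` on, copy it to the cell `f`. The local variables `5` and `6` count
the cells which are smaller, and which are not larger, than the cell `a + i`. -/
def rankTestProc : Cmd :=
  .seq (.setVar 5 (.lit 0)) (.seq (.setVar 6 (.lit 0)) (.seq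
    (forC 7 (.var 1) (.seq
      (.ite (.realLT (.load (.add (.var 0) (.var 7))) (.load (.add (.var 0) (.var 4))))
        (.setVar 5 (.add (.var 5) (.lit 1))) .skip)
      (.ite (.realLT (.load (.add (.var 0) (.var 4))) (.load (.add (.var 0) (.var 7))))
        .skip (.setVar 6 (.add (.var 6) (.lit 1))))))
    (.ite (.natLT (.var 2) (.var 5)) .skip
      (.ite (.natLT (.var 2) (.var 6)) (.storeReal (.var 3) (.load (.add (.var 0) (.var 4))))
        .skip))))

/-- Procedure `5` of a query, arguments `a, len, k, f`: selection in quadratic time, by testing the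
rank of every cell. -/
def bruteSelectProc : Cmd :=
  forC 4 (.var 1) (.call 4 [.var 0, .var 1, .var 2, .var 3, .var 4])

/-- Copy those of the `v₁` cells from `v₀` on that pass the test, to the cells from `base` on, and
count them in the local variable `i`. The test may refer to the current position `v₅`. -/
def filterC (i : ℕ) (base : NExp) (b : Test) : Cmd :=
  .seq (.setVar i (.lit 0)) (forC 5 (.var 1)
    (.ite b (.seq (.storeReal (.add base (.var i)) (.load (.add (.var 0) (.var 5))))
      (.setVar i (.add (.var i) (.lit 1)))) .skip))

section
variable {P : Program} {inp : ℕ → ℝ} {ω : Tape}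

theorem wp_rankTestProc {s : State} {a len k f i : ℕ} (h0 : s.loc 0 = a) (h1 : s.loc 1 = len)
    (h2 : s.loc 2 = k) (h3 : s.loc 3 = f) (h4 : s.loc 4 = i) :
    Wp P inp ω rankTestProc s fun t s' => t ≤ 33 * len + 21 ∧ s'.gpos = s.gpos ∧
      s'.upos = s.upos ∧ s'.heap.nat = s.heap.nat ∧
      (IsOrderStat (fun j => s.heap.real (a + j)) len k (s.heap.real (a + i)) →
        s'.heap.real = Function.update s.heap.real f (s.heap.real (a + i))) ∧
      (¬ IsOrderStat (fun j => s.heap.real (a + j)) len k (s.heap.real (a + i)) →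
        s'.heap.real = s.heap.real) := by
  refine wp_seq (wp_setVar (wp_seq (wp_setVar (wp_seq ((wp_forC (fun c s' =>
    s'.heap = s.heap ∧ s'.gpos = s.gpos ∧ s'.upos = s.upos ∧ (∀ j < 5, s'.loc j = s.loc j) ∧
    s'.loc 5 = cnt (fun j => s.heap.real (a + j) < s.heap.real (a + i)) c ∧
    s'.loc 6 = cnt (fun j => s.heap.real (a + j) ≤ s.heap.real (a + i)) c) len 26 ?_ ?_
    ?_).mono ?_)))))
  · rintro c s' - ⟨-, -, -, hl, -⟩
    simp [NExp.eval, hl 1, h1]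
  · refine ⟨rfl, rfl, rfl, fun j hj => ?_, ?_, ?_⟩
    · simp [Function.update, show j ≠ 5 by omega, show j ≠ 6 by omega, show j ≠ 7 by omega]
    · simp [NExp.eval, Function.update]
    · simp [NExp.eval, Function.update]
  · rintro c s' hc h7 ⟨hh, hg, hu, hl, h5, h6⟩
    have l0 := (hl 0 (by omega)).trans h0
    have l4 := (hl 4 (by omega)).trans h4
    have ne57 : ∀ j < 5, j ≠ 7 := by omega
    have ne55 : ∀ j < 5, j ≠ 5 := by omega
    have ne56 : ∀ j < 5, j ≠ 6 := by omega
    refine wp_seq (wp_ite ?_ ?_)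
    · intro hb
      simp only [Test.Holds, RExp.eval, NExp.eval, h7, l0, l4, hh] at hb
      refine wp_setVar (wp_ite ?_ ?_)
      · intro hb'
        simp [Test.Holds, RExp.eval, NExp.eval, h7, l0, l4, hh] at hb'
        linarith
      · intro hb'
        refine wp_setVar ⟨?_, ?_, hh, hg, hu, fun j hj => ?_, ?_, ?_⟩
        · simp [Test.cost, RExp.cost, NExp.cost]
        · simp [Function.update, h7]
        · simp +contextual [ne57 j hj, ne55 j hj, ne56 j hj, hl j hj]
        · rw [cnt_succ_of hb]
          simp [Function.update, NExp.eval, h5]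
        · rw [cnt_succ_of hb.le]
          simp [Function.update, NExp.eval, h6]
    · intro hb
      simp only [Test.Holds, RExp.eval, NExp.eval, h7, l0, l4, hh] at hb
      refine wp_skip (wp_ite ?_ ?_)
      · intro hb'
        simp only [Test.Holds, RExp.eval, NExp.eval, h7, l0, l4, hh] at hb'
        refine wp_skip ⟨?_, h7, hh, hg, hu, fun j hj => ?_, ?_, ?_⟩
        · simp [Test.cost, RExp.cost, NExp.cost]
        · simp [ne57 j hj, hl j hj]
        · rw [cnt_succ_of_not hb]
          simp [h5]
        · rw [cnt_succ_of_not (p := fun j => s.heap.real (a + j) ≤ s.heap.real (a + i))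
            (not_le.2 hb')]
          simp [h6]
      · intro hb'
        simp only [Test.Holds, RExp.eval, NExp.eval, h7, l0, l4, hh] at hb'
        refine wp_setVar ⟨?_, ?_, hh, hg, hu, fun j hj => ?_, ?_, ?_⟩
        · simp [Test.cost, RExp.cost, NExp.cost]
        · simp [Function.update, h7]
        · simp [ne57 j hj, ne56 j hj, hl j hj]
        · rw [cnt_succ_of_not hb]
          simp [Function.update, h5]
        · rw [cnt_succ_of (p := fun j => s.heap.real (a + j) ≤ s.heap.real (a + i))
            (not_lt.1 hb')]
          simp [Function.update, NExp.eval, h6]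
  · rintro t s' ⟨ht, hh, hg, hu, hl, h5, h6⟩
    have l0 := (hl 0 (by omega)).trans h0
    have l2 := (hl 2 (by omega)).trans h2
    have l3 := (hl 3 (by omega)).trans h3
    have l4 := (hl 4 (by omega)).trans h4
    simp only [NExp.cost] at ht
    refine wp_ite ?_ ?_
    · intro hb
      simp only [Test.Holds, NExp.eval, l2, h5] at hb
      refine wp_skip ⟨?_, hg, hu, by rw [hh], fun hk => absurd hk.1 (not_le.2 hb), by simp [hh]⟩
      simp only [Test.cost, NExp.cost]; omega
    · intro hb
      simp only [Test.Holds, NExp.eval, l2, h5] at hb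
      refine wp_ite ?_ ?_
      · intro hb'
        simp only [Test.Holds, NExp.eval, l2, h6] at hb'
        refine wp_storeReal ⟨?_, hg, hu, by simp [hh], fun _ => ?_,
          fun hk => absurd ⟨not_lt.1 hb, hb'⟩ hk⟩
        · simp only [Test.cost, NExp.cost, RExp.cost]; omega
        · simp [NExp.eval, RExp.eval, l0, l3, l4, hh]
      · intro hb'
        simp only [Test.Holds, NExp.eval, l2, h6] at hb'
        refine wp_skip ⟨?_, hg, hu, by rw [hh], fun hk => absurd hk.2 hb', by simp [hh]⟩
        simp only [Test.cost, NExp.cost]; omega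

/-- Specification of a selection procedure with arguments `a, len, k, f`, for arrays of
length `len`: it writes the element of rank `k` among the `len` real cells from `a` on to the cell
`f`, within time `T`, and leaves alone the natural-number cells and the real cells below `f`. -/
def Selects (P : Program) (inp : ℕ → ℝ) (ω : Tape) (c : Cmd) (len T : ℕ) : Prop :=
  ∀ (s : State) (a k f : ℕ), s.loc 0 = a → s.loc 1 = len → s.loc 2 = k → s.loc 3 = f →
    k < len → a + len ≤ f →
    Wp P inp ω c s fun t s' => t ≤ T ∧ s'.gpos = s.gpos ∧ s'.upos = s.upos ∧
      s'.heap.nat = s.heap.nat ∧ (∀ c < f, s'.heap.real c = s.heap.real c) ∧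
      IsOrderStat (fun j => s.heap.real (a + j)) len k (s'.heap.real f)

theorem selects_bruteSelectProc (hP : P[4]? = some rankTestProc) (len : ℕ) :
    Selects P inp ω bruteSelectProc len (len * (33 * len + 34) + 5) := by
  intro s a k f h0 h1 h2 h3 hk haf
  refine (wp_forC_frame (fun c h g u => g = s.gpos ∧ u = s.upos ∧ h.nat = s.heap.nat ∧
      (∀ c < f, h.real c = s.heap.real c) ∧
      ∀ i < c, IsOrderStat (fun j => s.heap.real (a + j)) len k (s.heap.real (a + i)) →
        IsOrderStat (fun j => s.heap.real (a + j)) len k (h.real f))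
      len (33 * len + 27) ?_ (by simp) ?_).mono ?_
  · intro c h g u
    simp [NExp.eval, h1]
  · rintro c h g u hc ⟨rfl, rfl, hn, hf, hr⟩
    refine wp_call hP ((wp_rankTestProc (a := a) (len := len) (k := k) (f := f) (i := c)
      ?_ ?_ ?_ ?_ ?_).mono ?_)
    · simp [NExp.eval, h0]
    · simp [NExp.eval, h1]
    · simp [NExp.eval, h2]
    · simp [NExp.eval, h3]
    · simp [NExp.eval]
    · rintro t s' ⟨ht, hg, hu, hn', hy, hno⟩
      have e : ∀ j < len, h.real (a + j) = s.heap.real (a + j) := fun j hj => hf _ (by omega)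
      simp only at hy hno hn' hg hu
      rw [hf (a + c) (by omega)] at hy hno
      refine ⟨?_, rfl, hg, hu, by rw [hn', hn], fun c' hc' => ?_, fun i hi hi' => ?_⟩
      · simp [NExp.cost]; omega
      · by_cases hO : IsOrderStat (fun j => h.real (a + j)) len k (s.heap.real (a + c))
        · rw [hy hO, Function.update_of_ne (by omega)]; exact hf _ hc'
        · rw [hno hO]; exact hf _ hc'
      · by_cases hO : IsOrderStat (fun j => h.real (a + j)) len k (s.heap.real (a + c))
        · rw [hy hO, Function.update_self]; exact hO.congr e
        · rw [hno hO]
          rcases Nat.lt_succ_iff_lt_or_eq.1 hi with hi | rfl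
          · exact hr i hi hi'
          · exact absurd (hi'.congr fun j hj => (e j hj).symm) hO
  · rintro t s' ⟨ht, -, hg, hu, hn, hf, hr⟩
    obtain ⟨i, hi, hi'⟩ := exists_isOrderStat (fun j => s.heap.real (a + j)) hk
    refine ⟨?_, hg, hu, hn, hf, hr i hi hi'⟩
    simp only [NExp.cost] at ht
    have : 1 + 6 + (33 * len + 27) = 33 * len + 34 := by ring
    rw [this] at ht
    omega

/-- If the test decides `p c` at every position `c`, the cells from `o` on receive the `cnt p len`
elements with `p`. That they are the same elements, with multiplicities, is expressed by counting
those with a given property `q` on both sides; this is all that selection depends on. -/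
theorem wp_filterC {s : State} {i : ℕ} {base : NExp} {b : Test} {a len o : ℕ} {p : ℕ → Prop}
    (hi : 5 < i) (h0 : s.loc 0 = a) (h1 : s.loc 1 = len) (hao : a + len ≤ o)
    (hbase : ∀ s' : State, (∀ j, j ≠ 5 → j ≠ i → s'.loc j = s.loc j) → base.eval s' = o)
    (hb : ∀ (s' : State) (c : ℕ), c < len → (∀ j, j ≠ 5 → j ≠ i → s'.loc j = s.loc j) →
      s'.loc 5 = c → (∀ c < o, s'.heap.real c = s.heap.real c) → (b.Holds inp s' ↔ p c)) :
    Wp P inp ω (filterC i base b) s fun t s' =>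
      t ≤ len * (b.cost + base.cost + 19) + 7 ∧ s'.gpos = s.gpos ∧ s'.upos = s.upos ∧
      s'.heap.nat = s.heap.nat ∧
      (∀ c, c < o ∨ o + len ≤ c → s'.heap.real c = s.heap.real c) ∧
      (∀ j, j ≠ 5 → j ≠ i → s'.loc j = s.loc j) ∧ s'.loc i = cnt p len ∧
      ∀ q : ℝ → Prop, cnt (fun j => q (s'.heap.real (o + j))) (s'.loc i) =
        cnt (fun j => p j ∧ q (s.heap.real (a + j))) len := by
  refine wp_seq (wp_setVar ((wp_forC (fun c s' => s'.gpos = s.gpos ∧ s'.upos = s.upos ∧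
      s'.heap.nat = s.heap.nat ∧
      (∀ c', c' < o ∨ o + c ≤ c' → s'.heap.real c' = s.heap.real c') ∧
      (∀ j, j ≠ 5 → j ≠ i → s'.loc j = s.loc j) ∧ s'.loc i = cnt p c ∧
      ∀ q : ℝ → Prop, cnt (fun j => q (s'.heap.real (o + j))) (s'.loc i) =
        cnt (fun j => p j ∧ q (s.heap.real (a + j))) c) len (b.cost + base.cost + 12)
      ?_ ?_ ?_).mono ?_))
  · rintro c s' - ⟨-, -, -, -, hl, -⟩
    simp [NExp.eval, hl 1 (by omega) (by omega), h1]
  · refine ⟨rfl, rfl, rfl, by simp, fun j hj hj' => ?_, ?_, fun q => ?_⟩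
    · simp [hj, hj']
    · simp [NExp.eval, show i ≠ 5 by omega]
    · simp [NExp.eval, show i ≠ 5 by omega]
  · rintro c s' hc h5 ⟨hg, hu, hn, hf, hl, hcnt, hq⟩
    have hb' := hb s' c hc hl h5 fun c hc => hf c (by omega)
    have hle := cnt_le p c
    refine wp_ite ?_ ?_
    · intro h
      have hp := hb'.1 h
      have l0 := (hl 0 (by omega) (by omega)).trans h0
      refine wp_seq (wp_storeReal (wp_setVar ⟨?_, ?_, hg, hu, hn, ?_, ?_, ?_, ?_⟩))
      · simp only [NExp.cost, RExp.cost]; omega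
      · simp [show 5 ≠ i by omega, h5]
      · intro c' hc'
        have : c' ≠ o + s'.loc i := by omega
        simp only [NExp.eval, hbase s' hl, Function.update_of_ne this]
        exact hf c' (by omega)
      · intro j hj hj'
        simp [hj, hj', hl j hj hj']
      · rw [cnt_succ_of hp]
        simp [NExp.eval, show i ≠ 5 by omega, hcnt]
      · intro q
        have e1 : (cnt fun j => q ((Function.update s'.heap.real (o + s'.loc i)
            (s.heap.real (a + c))) (o + j))) (s'.loc i) =
            cnt (fun j => q (s'.heap.real (o + j))) (s'.loc i) :=
          cnt_congr fun j hj => by rw [Function.update_of_ne (by omega)]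
        simp only [NExp.eval, RExp.eval, hbase s' hl, l0, h5, hf (a + c) (by omega),
          Function.update_of_ne (show i ≠ 5 by omega), Function.update_self]
        by_cases hqc : q (s.heap.real (a + c))
        · rw [cnt_succ_of, cnt_succ_of, e1, hq]
          · exact ⟨hp, hqc⟩
          · simpa using hqc
        · rw [cnt_succ_of_not, cnt_succ_of_not, e1, hq]
          · exact fun h => hqc h.2
          · simpa using hqc
    · intro h
      have hp := fun h' => h (hb'.2 h')
      refine wp_skip ⟨by omega, h5, hg, hu, hn, ?_, ?_, ?_, ?_⟩
      · intro c' hc'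
        exact hf c' (by omega)
      · intro j hj hj'
        simp [hj, hl j hj hj']
      · rw [cnt_succ_of_not hp]
        simp [show i ≠ 5 by omega, hcnt]
      · intro q
        rw [cnt_succ_of_not fun h => hp h.1]
        simpa only [Function.update_of_ne (show i ≠ 5 by omega)] using hq q
  · rintro t s' ⟨ht, h⟩
    refine ⟨?_, h⟩
    simp only [NExp.cost] at ht ⊢
    have : 1 + 6 + (b.cost + base.cost + 12) = b.cost + base.cost + 19 := by ring
    rw [this] at ht
    omega

end

end ADE

/-! ### Selection in linear time -/

namespace ADE

/-- Set `v₄` to the largest number with `10 v₄ + 5 ≤ v₁`, so that the array contains `2 v₄ + 1`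
groups of five. -/
def countGroupsC : Cmd :=
  .seq (.setVar 4 (.lit 0)) (.loop (.natLT (.add (.mul (.lit 10) (.var 4)) (.lit 14)) (.var 1))
    (.setVar 4 (.add (.var 4) (.lit 1))))

/-- Write the medians of `2 v₄ + 1` groups of five to the cells from `v₃` on. -/
def groupMediansC : Cmd :=
  forC 5 (.add (.mul (.lit 2) (.var 4)) (.lit 1))
    (.call 5 [.add (.var 0) (.mul (.lit 5) (.var 5)), .lit 5, .lit 2, .add (.var 3) (.var 5)])

/-- Recurse on the side of the pivot (in cell `v₆`) which contains the element of rank `v₂`. -/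
def recurseC : Cmd :=
  .ite (.natLT (.var 2) (.var 7))
    (.call 6 [.add (.var 6) (.lit 1), .var 7, .var 2,
      .add (.add (.var 6) (.lit 1)) (.mul (.lit 2) (.var 1))])
    (.ite (.natLT (.var 2) (.sub (.var 1) (.var 8)))
      (.storeReal (.add (.add (.var 6) (.lit 1)) (.mul (.lit 2) (.var 1))) (.load (.var 6)))
      (.call 6 [.add (.add (.var 6) (.lit 1)) (.var 1), .var 8,
        .sub (.var 2) (.sub (.var 1) (.var 8)),
        .add (.add (.var 6) (.lit 1)) (.mul (.lit 2) (.var 1))]))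

/-- Procedure `6` of a query, arguments `a, len, k, f`: selection in linear time, with the median of
the medians of groups of five as the pivot. The scratch space are the cells from `f` on: first the
medians, then the pivot, the smaller elements, the larger elements, and the scratch space of the
recursive call. -/
def selectProc : Cmd :=
  .ite (.natLT (.var 1) (.lit 25)) (.call 5 [.var 0, .var 1, .var 2, .var 3])
    (.seq countGroupsC (.seq groupMediansC (.seq
      (.setVar 6 (.add (.var 3) (.add (.mul (.lit 2) (.var 4)) (.lit 1)))) (.seq
      (.call 6 [.var 3, .add (.mul (.lit 2) (.var 4)) (.lit 1), .var 4, .var 6]) (.seq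
      (filterC 7 (.add (.var 6) (.lit 1))
        (.realLT (.load (.add (.var 0) (.var 5))) (.load (.var 6)))) (.seq
      (filterC 8 (.add (.add (.var 6) (.lit 1)) (.var 1))
        (.realLT (.load (.var 6)) (.load (.add (.var 0) (.var 5))))) (.seq
      recurseC
      (.storeReal (.var 3) (.load (.add (.add (.var 6) (.lit 1)) (.mul (.lit 2) (.var 1))))))))))))

section
variable {P : Program} {inp : ℕ → ℝ} {ω : Tape}

theorem Selects.call {p : ℕ} {body : Cmd} {len T : ℕ} (h : Selects P inp ω body len T)
    (hP : P[p]? = some body) {s : State} {ea el ek ef : NExp} {a k f : ℕ}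
    (ha : ea.eval s = a) (hl : el.eval s = len) (hk : ek.eval s = k) (hf : ef.eval s = f)
    (hlt : k < len) (haf : a + len ≤ f) :
    Wp P inp ω (.call p [ea, el, ek, ef]) s fun t s' =>
      t ≤ ea.cost + el.cost + ek.cost + ef.cost + 1 + T ∧ s'.loc = s.loc ∧
      s'.gpos = s.gpos ∧ s'.upos = s.upos ∧
      s'.heap.nat = s.heap.nat ∧ (∀ c < f, s'.heap.real c = s.heap.real c) ∧
      IsOrderStat (fun j => s.heap.real (a + j)) len k (s'.heap.real f) := by
  refine wp_call hP ((h _ a k f ?_ ?_ ?_ ?_ hlt haf).mono ?_)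
  · simpa
  · simpa
  · simpa
  · simpa
  · rintro t s' ⟨ht, hg, hu, h⟩
    refine ⟨?_, rfl, hg, hu, h⟩
    simp; omega

theorem wp_countGroupsC {s : State} {len h : ℕ} (h1 : s.loc 1 = len) (hh : 10 * h + 5 ≤ len)
    (hh' : len < 10 * h + 15) :
    Wp P inp ω countGroupsC s fun t s' => t ≤ 12 * h + 9 ∧
      s' = { s with loc := Function.update s.loc 4 h } := by
  refine wp_seq (wp_setVar ((wp_loop (N := h) (T := 4)
    (I := fun c s' => s' = { s with loc := Function.update s.loc 4 c }) ?_ ?_ ?_).mono ?_))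
  · rintro c s' hc rfl
    refine ⟨?_, wp_setVar ⟨by simp [NExp.cost], ?_⟩⟩
    · simp [Test.Holds, NExp.eval, h1]; omega
    · simp [NExp.eval]
  · rintro s' rfl
    simp [Test.Holds, NExp.eval, h1]; omega
  · simp [NExp.eval]
  · rintro t s' ⟨ht, hs⟩
    refine ⟨?_, hs⟩
    simp only [Test.cost, NExp.cost] at ht ⊢
    omega

theorem wp_groupMediansC (hB : Selects P inp ω bruteSelectProc 5 1000)
    (hP : P[5]? = some bruteSelectProc) {s : State} {a len f h : ℕ} (h0 : s.loc 0 = a)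
    (h3 : s.loc 3 = f) (h4 : s.loc 4 = h) (hh : 10 * h + 5 ≤ len) (haf : a + len ≤ f) :
    Wp P inp ω groupMediansC s fun t s' => t ≤ (2 * h + 1) * 1022 + 9 ∧
      s'.loc = Function.update s.loc 5 (2 * h + 1) ∧ s'.gpos = s.gpos ∧ s'.upos = s.upos ∧
      s'.heap.nat = s.heap.nat ∧ (∀ c < f, s'.heap.real c = s.heap.real c) ∧
      ∀ g < 2 * h + 1, IsOrderStat (fun j => s.heap.real (a + (5 * g + j))) 5 2
        (s'.heap.real (f + g)) := by
  refine (wp_forC_frame (fun c h g u => g = s.gpos ∧ u = s.upos ∧ h.nat = s.heap.nat ∧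
      (∀ c < f, h.real c = s.heap.real c) ∧
      ∀ g < c, IsOrderStat (fun j => s.heap.real (a + (5 * g + j))) 5 2 (h.real (f + g)))
      (2 * h + 1) 1011 ?_ (by simp) ?_).mono ?_
  · intro k h g u
    simp [NExp.eval, h4]
  · rintro k hp g u hk ⟨rfl, rfl, hn, hf, hm⟩
    refine (hB.call hP (a := a + 5 * k) (k := 2) (f := f + k) ?_ ?_ ?_ ?_ (by omega)
      (by omega)).mono ?_
    · simp [NExp.eval, h0]
    · simp [NExp.eval]
    · simp [NExp.eval]
    · simp [NExp.eval, h3]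
    · rintro t s' ⟨ht, hl, hg, hu, hn', hf', hm'⟩
      refine ⟨ht, hl, hg, hu, hn'.trans hn, fun c hc => ?_, fun g hg => ?_⟩
      · rw [hf' c (by omega)]; exact hf c hc
      · rcases Nat.lt_succ_iff_lt_or_eq.1 hg with hg | rfl
        · rw [hf' _ (by omega)]; exact hm g hg
        · refine hm'.congr fun j hj => ?_
          show hp.real _ = _
          rw [hf _ (by omega), add_assoc]
  · rintro t s' ⟨ht, h⟩
    refine ⟨?_, h⟩
    simp only [NExp.cost] at ht
    omega

/-- Selection takes linear time: the recursive calls are for `2 h + 1` medians and for at most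
`len - 3 (h + 1)` elements, together `len - (h + 2)`, where `10 h + 15 > len`. The time
`5000 (h + 2)`
left over by the induction hypothesis pays for the work outside the recursive calls. -/
theorem selects_selectProc (hP4 : P[4]? = some rankTestProc) (hP5 : P[5]? = some bruteSelectProc)
    (hP6 : P[6]? = some selectProc) (len : ℕ) :
    Selects P inp ω selectProc len (5000 * len) := by
  induction len using Nat.strong_induction_on with
  | _ len ih =>
  intro s a k f h0 h1 h2 h3 hk haf
  refine wp_ite ?_ ?_
  · intro hb
    simp only [Test.Holds, NExp.eval, h1] at hb
    refine ((selects_bruteSelectProc hP4 len).call hP5 (a := a) (k := k) (f := f)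
      ?_ ?_ ?_ ?_ hk haf).mono ?_
    · simpa [NExp.eval]
    · simpa [NExp.eval]
    · simpa [NExp.eval]
    · simpa [NExp.eval]
    rintro t s' ⟨ht, -, h⟩
    refine ⟨?_, h⟩
    have : len * (33 * len + 34) ≤ len * 826 := Nat.mul_le_mul_left _ (by omega)
    simp only [Test.cost, NExp.cost] at ht ⊢
    omega
  intro hb
  simp only [Test.Holds, NExp.eval, h1] at hb
  -- `2 h + 1` groups of five fit into the array, `2 h + 3` do not
  obtain ⟨h, hh, hh'⟩ : ∃ h, 10 * h + 5 ≤ len ∧ len < 10 * h + 15 :=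
    ⟨(len - 5) / 10, by omega, by omega⟩
  refine wp_seq ((wp_countGroupsC h1 hh hh').mono ?_)
  rintro t₁ s₁ ⟨ht₁, rfl⟩
  refine wp_seq ((wp_groupMediansC ((selects_bruteSelectProc hP4 5)) hP5 (a := a) (f := f) (h := h)
    (by simp [h0]) (by simp [h3]) (by simp) hh haf).mono ?_)
  rintro t₂ ⟨l₂, hp₂, g₂, u₂⟩ ⟨ht₂, hl₂, hg₂, hu₂, hn₂, hf₂, hm₂⟩
  simp only at hl₂ hg₂ hu₂ hn₂ hf₂ hm₂
  subst hl₂ hg₂ hu₂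
  refine wp_seq (wp_setVar (wp_seq ((((ih (2 * h + 1) (by omega)).call hP6 (a := f) (k := h)
    (f := f + (2 * h + 1)) ?_ ?_ ?_ ?_ (by omega) (by omega)).mono ?_))))
  · simp [NExp.eval, h3]
  · simp [NExp.eval]
  · simp [NExp.eval]
  · simp [NExp.eval, h3]
  rintro t₃ ⟨l₃, hp₃, g₃, u₃⟩ ⟨ht₃, hl₃, hg₃, hu₃, hn₃, hf₃, hm₃⟩
  simp only at hl₃ hg₃ hu₃ hn₃ hf₃ hm₃
  subst hl₃ hg₃ hu₃
  set v := f + (2 * h + 1) with hv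
  set p := hp₃.real v with hp
  -- the input array lies below `f` and has not been touched
  have hin : ∀ c < f, hp₃.real c = s.heap.real c := fun c hc => by
    rw [hf₃ c (by omega), hf₂ c hc]
  obtain ⟨hL, hG⟩ := median_of_medians (y := fun j => s.heap.real (a + j)) hh hm₂ hm₃
  refine wp_seq ((wp_filterC (a := a) (len := len) (o := v + 1)
    (p := fun j => s.heap.real (a + j) < p) (by omega) ?_ ?_ (by omega) ?_ ?_).mono ?_)
  · simp [h0]
  · simp [h1]
  · intro s' hl
    simp [NExp.eval, hl 6, h3, hv]
  · intro s' c hc hl h5 hf'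
    have e : hp₃.real (a + c) = s.heap.real (a + c) := hin _ (by omega)
    simp [Test.Holds, RExp.eval, NExp.eval, hl 6, hl 0, h5, h3, h0, ← hv, hf' v (by omega),
      hf' (a + c) (by omega), e, hp]
  rintro t₄ ⟨l₄, hp₄, g₄, u₄⟩ ⟨ht₄, hg₄, hu₄, hn₄, hf₄, hl₄, hc₄, hq₄⟩
  simp only at hg₄ hu₄ hn₄ hf₄ hl₄ hc₄ hq₄
  subst hg₄ hu₄
  have l0 : l₄ 0 = a := by simp [hl₄ 0, h0]
  have l1 : l₄ 1 = len := by simp [hl₄ 1, h1]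
  have l2 : l₄ 2 = k := by simp [hl₄ 2, h2]
  have l3 : l₄ 3 = f := by simp [hl₄ 3, h3]
  have l6 : l₄ 6 = v := by simp [hl₄ 6, h3, NExp.eval, hv]
  refine wp_seq ((wp_filterC (a := a) (len := len) (o := v + 1 + len)
    (p := fun j => p < s.heap.real (a + j)) (by omega) l0 l1 (by omega) ?_ ?_).mono ?_)
  · intro s' hl
    simp [NExp.eval, hl 6, hl 1, l1, l6]
  · intro s' c hc hl h5 hf'
    have e : hp₃.real (a + c) = s.heap.real (a + c) := hin _ (by omega)
    have e2 : hp₄.real v = p := hf₄ v (by omega)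
    have e1 := hf₄ (a + c) (by omega)
    simp [Test.Holds, RExp.eval, NExp.eval, hl 6, hl 0, h5, l6, l0, hf' v (by omega),
      hf' (a + c) (by omega), e, e1, e2]
  rintro t₅ ⟨l₅, hp₅, g₅, u₅⟩ ⟨ht₅, hg₅, hu₅, hn₅, hf₅, hl₅, hc₅, hq₅⟩
  simp only at hg₅ hu₅ hn₅ hf₅ hl₅ hc₅ hq₅
  subst hg₅ hu₅
  have l1' : l₅ 1 = len := by simp [hl₅ 1, l1]
  have l2' : l₅ 2 = k := by simp [hl₅ 2, l2]
  have l3' : l₅ 3 = f := by simp [hl₅ 3, l3]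
  have l6' : l₅ 6 = v := by simp [hl₅ 6, l6]
  have l7' : l₅ 7 = cnt (fun j => s.heap.real (a + j) < p) len := by simp [hl₅ 7, hc₄]
  set cl := cnt (fun j => s.heap.real (a + j) < p) len with hcl
  set cg := cnt (fun j => p < s.heap.real (a + j)) len with hcg
  have hq₄' : ∀ q : ℝ → Prop, cnt (fun j => q (hp₄.real (v + 1 + j))) cl =
      cnt (fun j => s.heap.real (a + j) < p ∧ q (s.heap.real (a + j))) len := fun q => by
    rw [← hc₄, hq₄]
    exact cnt_congr fun j hj => by rw [hin (a + j) (by omega)]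
  have hq₅' : ∀ q : ℝ → Prop, cnt (fun j => q (hp₅.real (v + 1 + len + j))) cg =
      cnt (fun j => p < s.heap.real (a + j) ∧ q (s.heap.real (a + j))) len := fun q => by
    rw [← hc₅, hq₅]
    exact cnt_congr fun j hj => by rw [hf₄ (a + j) (by omega), hin (a + j) (by omega)]
  simp only [NExp.cost, Test.cost, RExp.cost] at ht₁ ht₂ ht₃ ht₄ ht₅
  -- the element of rank `k` is below the pivot, above the pivot, or the pivot itself
  have hrec : Wp P inp ω recurseC ⟨l₅, hp₅, s.gpos, s.upos⟩ fun t s' =>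
      t ≤ 5000 * (len - 3 * (h + 1)) + 40 ∧ s'.loc = l₅ ∧ s'.gpos = s.gpos ∧ s'.upos = s.upos ∧
      s'.heap.nat = hp₅.nat ∧ (∀ c < f, s'.heap.real c = hp₅.real c) ∧
      IsOrderStat (fun j => s.heap.real (a + j)) len k (s'.heap.real (v + 1 + 2 * len)) := by
    refine wp_ite ?_ ?_
    · intro hb₁
      simp only [Test.Holds, NExp.eval, l2', l7'] at hb₁
      refine ((ih cl (by omega)).call hP6 (a := v + 1) (k := k) (f := v + 1 + 2 * len)
        ?_ ?_ ?_ ?_ hb₁ (by omega)).mono ?_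
      · simp [NExp.eval, l6']
      · simp [NExp.eval, l7']
      · simp [NExp.eval, l2']
      · simp [NExp.eval, l6', l1']
      rintro t s' ⟨ht, hl, hg, hu, hn, hf', hO⟩
      refine ⟨?_, hl, hg, hu, hn, fun c hc => hf' c (by omega), ?_⟩
      · simp only [NExp.cost, Test.cost] at ht ⊢
        omega
      · refine IsOrderStat.of_lt (p := p) hq₄' (hO.congr fun j hj => ?_)
        exact hf₅ _ (by omega)
    · intro hb₁
      simp only [Test.Holds, NExp.eval, l2', l7'] at hb₁
      refine wp_ite ?_ ?_
      · intro hb₂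
        simp only [Test.Holds, NExp.eval, l2', l1', hc₅] at hb₂
        refine wp_storeReal ⟨?_, rfl, rfl, rfl, rfl, fun c hc => ?_, ?_⟩
        · simp [NExp.cost, Test.cost, RExp.cost]
        · simp only [NExp.eval, l6', l1']
          rw [Function.update_of_ne (by omega)]
        · simp only [NExp.eval, RExp.eval, l6', l1', Function.update_self]
          rw [hf₅ v (by omega), hf₄ v (by omega)]
          exact isOrderStat_pivot hb₁ hb₂
      · intro hb₂
        simp only [Test.Holds, NExp.eval, l2', l1', hc₅] at hb₂
        refine ((ih cg (by omega)).call hP6 (a := v + 1 + len) (k := k - (len - cg))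
          (f := v + 1 + 2 * len) ?_ ?_ ?_ ?_ (by omega) (by omega)).mono ?_
        · simp [NExp.eval, l6', l1']
        · simp [NExp.eval, hc₅]
        · simp [NExp.eval, l2', l1', hc₅]
        · simp [NExp.eval, l6', l1']
        rintro t s' ⟨ht, hl, hg, hu, hn, hf', hO⟩
        refine ⟨?_, hl, hg, hu, hn, fun c hc => hf' c (by omega), ?_⟩
        · simp only [NExp.cost, Test.cost] at ht ⊢
          omega
        · exact IsOrderStat.of_gt (p := p) hq₅' rfl (by omega) hO
  refine wp_seq (hrec.mono ?_)
  rintro t₆ ⟨l₆, hp₆, g₆, u₆⟩ ⟨ht₆, hl₆, hg₆, hu₆, hn₆, hf₆, hO₆⟩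
  simp only at hl₆ hg₆ hu₆ hn₆ hf₆ hO₆
  subst hl₆ hg₆ hu₆
  refine wp_storeReal ⟨?_, rfl, rfl, ?_, fun c hc => ?_, ?_⟩
  · simp only [NExp.cost, Test.cost, RExp.cost]
    omega
  · simp only [hn₆, hn₅, hn₄, hn₃, hn₂]
  · simp only [NExp.eval, l3']
    rw [Function.update_of_ne (by omega), hf₆ c hc, hf₅ c (by omega), hf₄ c (by omega), hin c hc]
  · simpa only [NExp.eval, RExp.eval, l3', l6', l1', Function.update_self] using hO₆

end

end ADE

/-! ### The query program -/

namespace ADE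

/-- Procedure `7` of a query, arguments `n, d, m, l, S, r, k`: draw an index `j < l` and store the
distances between the sketches of the query point and of the data points under matrix `j`. The
distance to point `i` goes to cell `S + n + m + i r + k`; the cells from `S + n` on hold the sketch
of the query point. -/
def roundProc : Cmd :=
  .seq (.unif 7 (.var 3)) (.seq
    (.call 2 [.var 2, .var 1, .mul (.mul (.var 7) (.var 2)) (.var 1), .lit 0,
      .add (.var 4) (.var 0)])
    (forC 8 (.var 0) (.call 3 [.var 2, .add (.var 4) (.var 0),
      .add (.mul (.mul (.var 3) (.var 2)) (.var 1))
        (.mul (.add (.mul (.var 7) (.var 0)) (.var 8)) (.var 2)),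
      .add (.add (.add (.add (.var 4) (.var 0)) (.var 2)) (.mul (.var 8) (.var 5))) (.var 6)])))

/-- Procedure `8` of a query, arguments `a, r, h, f, out`: store the element of rank `h` among the
`r` cells from `a` on in the cell `out`, using the cells from `f` on as scratch space. -/
def medianProc : Cmd :=
  .seq (.call 6 [.var 0, .var 1, .var 2, .var 3]) (.storeReal (.var 4) (.load (.var 3)))

/-- Procedure `0` of a query: `2 h + 1` rounds of sampling, then `n` medians. The parameters
`n, d, m, l, h` are read from the first natural-number cells. -/
def queryMain : Cmd :=
  .seq (.setVar 0 (.load (.lit 0))) (.seq (.setVar 1 (.load (.lit 1))) (.seq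
    (.setVar 2 (.load (.lit 2))) (.seq (.setVar 3 (.load (.lit 3))) (.seq
    (.setVar 4 (.load (.lit 4))) (.seq
    (.setVar 5 (.mul (.mul (.var 3) (.var 2)) (.add (.var 0) (.var 1)))) (.seq
    (.setVar 7 (.add (.mul (.lit 2) (.var 4)) (.lit 1))) (.seq
    (forC 6 (.var 7) (.call 7 [.var 0, .var 1, .var 2, .var 3, .var 5, .var 7, .var 6]))
    (forC 6 (.var 0) (.call 8 [
      .add (.add (.add (.var 5) (.var 0)) (.var 2)) (.mul (.var 6) (.var 7)), .var 7, .var 4,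
      .add (.add (.add (.var 5) (.var 0)) (.var 2)) (.mul (.var 0) (.var 7)),
      .add (.var 5) (.var 6)])))))))))

/-- The query program. With `S = l m (n + d)` and `r = 2 h + 1`, the real cells below `S` hold the
data structure, followed by `n` cells for the answers, `m` cells for the sketch of the query point,
`n r` cells for the distances, and the scratch space of the selection procedure. -/
def queryProgram : Program :=
  [queryMain, dotProc, matVecProc, distProc, rankTestProc, bruteSelectProc, selectProc, roundProc,
    medianProc]

/-- The distance between the sketch under matrix `j` of the query point `q` and of the data
point `i`, as read from the memory `R` of the data structure. -/
noncomputable def memSketchDist (n d m l : ℕ) (R q : ℕ → ℝ) (j i : ℕ) : ℝ :=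
  √(∑ a ∈ Finset.range m, ((∑ b ∈ Finset.range d, R (j * m * d + a * d + b) * q b) -
    R (l * m * d + (j * n + i) * m + a)) ^ 2)

/-- The sketched distance only depends on the data structure and on the coordinates of the query. -/
theorem memSketchDist_congr {n d m l : ℕ} {R R' q q' : ℕ → ℝ} {j i : ℕ} (hj : j < l) (hi : i < n)
    (hR : ∀ c < l * m * (n + d), R c = R' c) (hq : ∀ b < d, q b = q' b) :
    memSketchDist n d m l R q j i = memSketchDist n d m l R' q' j i := by
  have e1 : j * m * d + m * d ≤ l * m * d := by
    rw [← Nat.add_mul, ← Nat.succ_mul]; gcongr; exact hj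
  have e2 : (j * n + i) * m + m ≤ l * n * m := by
    rw [← Nat.succ_mul]
    have : j * n + n ≤ l * n := by rw [← Nat.succ_mul]; gcongr; exact hj
    gcongr; omega
  have e3 : l * m * (n + d) = l * m * d + l * n * m := by ring
  unfold memSketchDist
  congr 1
  refine Finset.sum_congr rfl fun a ha => ?_
  have ha := Finset.mem_range.1 ha
  rw [hR (l * m * d + (j * n + i) * m + a) (by omega)]
  congr 2
  refine Finset.sum_congr rfl fun b hb => ?_
  have hb := Finset.mem_range.1 hb
  have e4 : a * d + d ≤ m * d := by rw [← Nat.succ_mul]; gcongr; exact ha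
  rw [hR (j * m * d + a * d + b) (by omega), hq b hb]

theorem eq_of_mul_add_eq {r i i' k k' : ℕ} (hk : k < r) (hk' : k' < r)
    (h : i * r + k = i' * r + k') : i = i' ∧ k = k' := by
  have h1 := congrArg (· / r) h
  have h2 := congrArg (· % r) h
  simp only [Nat.mul_add_mod', Nat.mod_eq_of_lt hk, Nat.mod_eq_of_lt hk'] at h2
  refine ⟨?_, h2⟩
  subst h2
  exact Nat.eq_of_mul_eq_mul_right (by omega) (by omega : i * r = i' * r)

section
variable {inp : ℕ → ℝ} {ω : Tape}

theorem wp_roundProc {s : State} {n d m l S r k : ℕ} (h0 : s.loc 0 = n) (h1 : s.loc 1 = d)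
    (h2 : s.loc 2 = m) (h3 : s.loc 3 = l) (h4 : s.loc 4 = S) (h5 : s.loc 5 = r)
    (h6 : s.loc 6 = k) (hl : 0 < l) (hS : S = l * m * (n + d)) (hk : k < r) :
    Wp queryProgram inp ω roundProc s fun t s' => t ≤ m * (21 * d + 27) + n * (34 * m + 50) + 25 ∧
      s'.gpos = s.gpos ∧ s'.upos = s.upos + 1 ∧ s'.heap.nat = s.heap.nat ∧
      (∀ c < S, s'.heap.real c = s.heap.real c) ∧
      (∀ i k', k' < r → k' ≠ k → s'.heap.real (S + n + m + i * r + k') =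
        s.heap.real (S + n + m + i * r + k')) ∧
      ∀ i < n, s'.heap.real (S + n + m + i * r + k) =
        memSketchDist n d m l s.heap.real inp (ω.2 (s.upos, l - 1)) i := by
  set j : ℕ := (ω.2 (s.upos, l - 1) : ℕ) with hj
  have hj' : (ω.2 (s.upos, s.loc 3 - 1) : ℕ) = j := by rw [h3]
  have hjl : j < l := by have := (ω.2 (s.upos, l - 1)).2; omega
  have e1 : j * m * d + m * d ≤ l * m * d := by
    rw [← Nat.add_mul, ← Nat.succ_mul]; gcongr; exact hjl
  have e3 : l * m * (n + d) = l * m * d + l * n * m := by ring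
  refine wp_seq (wp_unif (wp_seq (wp_call (body := matVecProc) rfl ((wp_matVecProc (m := m) (d := d)
    (base := j * m * d) (x := 0) (out := S + n) rfl ?_ ?_ ?_ ?_ ?_ (by omega)).mono ?_))))
  · simp [NExp.eval, h2]
  · simp [NExp.eval, h1]
  · simp [NExp.eval, h1, h2, hj']
  · simp [NExp.eval]
  · simp [NExp.eval, h0, h4]
  rintro t₁ ⟨l₁, hp₁, g₁, u₁⟩ ⟨ht₁, hg₁, hu₁, hn₁, hf₁, hv₁⟩
  simp only at hg₁ hu₁ hn₁ hf₁ hv₁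
  subst hg₁ hu₁
  refine (wp_forC_frame (fun i h g u => g = s.gpos ∧ u = s.upos + 1 ∧ h.nat = s.heap.nat ∧
      (∀ c < S + n + m, h.real c = hp₁.real c) ∧
      (∀ i k', k' < r → k' ≠ k → h.real (S + n + m + i * r + k') =
        s.heap.real (S + n + m + i * r + k')) ∧
      ∀ i' < i, h.real (S + n + m + i' * r + k) =
        memSketchDist n d m l s.heap.real inp j i') n (34 * m + 43) ?_ ?_ ?_).mono ?_
  · intro k h g u
    simp [NExp.eval, h0]
  · refine ⟨rfl, rfl, hn₁, by simp, fun i k' _ _ => hf₁ _ (by omega), by simp⟩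
  · rintro i h g u hi ⟨rfl, rfl, hn, hf, hk', hd⟩
    have e2 : (j * n + i) * m + m ≤ l * n * m := by
      rw [← Nat.succ_mul]
      have : j * n + n ≤ l * n := by rw [← Nat.succ_mul]; gcongr; exact hjl
      gcongr; omega
    refine wp_call (body := distProc) rfl ((wp_distProc (m := m) (u := S + n)
      (v := l * m * d + (j * n + i) * m) (out := S + n + m + i * r + k) ?_ ?_ ?_ ?_
      (by omega) (by omega)).mono ?_)
    · simp [NExp.eval, h2]
    · simp [NExp.eval, h0, h4]
    · simp [NExp.eval, h0, h1, h2, h3, hj']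
    · simp [NExp.eval, h0, h2, h4, h5, h6]
    rintro t s' ⟨ht, hg, hu, hh⟩
    refine ⟨?_, rfl, hg, hu, by simp [hh, hn], fun c hc => ?_, fun i' k' hk1 hk2 => ?_,
      fun i' hi' => ?_⟩
    · simp [NExp.cost]; omega
    · simp only [hh]
      rw [Function.update_of_ne (by omega)]
      exact hf c hc
    · simp only [hh]
      rw [Function.update_of_ne, hk' i' k' hk1 hk2]
      intro he
      exact hk2 (eq_of_mul_add_eq hk1 hk (by omega : i' * r + k' = i * r + k)).2
    · simp only [hh]
      rcases Nat.lt_succ_iff_lt_or_eq.1 hi' with hi' | rfl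
      · rw [Function.update_of_ne, hd i' hi']
        intro he
        have := (eq_of_mul_add_eq hk hk (by omega : i' * r + k = i * r + k)).1
        omega
      · rw [Function.update_self, memSketchDist]
        congr 1
        refine Finset.sum_congr rfl fun a ha => ?_
        have ha := Finset.mem_range.1 ha
        rw [hf (S + n + a) (by omega), hv₁ a ha, hf _ (by omega), hf₁ _ (by omega)]
        simp
  · rintro t s' ⟨ht, -, hg, hu, hn, hf, hk', hd⟩
    refine ⟨?_, hg, hu, hn, fun c hc => ?_, hk', hd⟩
    · simp only [NExp.cost, List.map_cons, List.map_nil, List.sum_cons, List.sum_nil] at ht ht₁ ⊢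
      rw [show 1 + 6 + (34 * m + 43) = 34 * m + 50 by ring] at ht
      omega
    · rw [hf c (by omega)]
      exact hf₁ c (by omega)

theorem wp_medianProc {s : State} {a r h f out : ℕ} (h0 : s.loc 0 = a) (h1 : s.loc 1 = r)
    (h2 : s.loc 2 = h) (h3 : s.loc 3 = f) (h4 : s.loc 4 = out) (hr : h < r) (haf : a + r ≤ f) :
    Wp queryProgram inp ω medianProc s fun t s' => t ≤ 5000 * r + 10 ∧
      s'.gpos = s.gpos ∧ s'.upos = s.upos ∧ s'.heap.nat = s.heap.nat ∧
      (∀ c < f, c ≠ out → s'.heap.real c = s.heap.real c) ∧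
      IsOrderStat (fun j => s.heap.real (a + j)) r h (s'.heap.real out) := by
  refine wp_seq (((selects_selectProc rfl rfl rfl r).call (P := queryProgram) rfl (a := a) (k := h)
    (f := f) ?_ ?_ ?_ ?_ hr haf).mono ?_)
  · simpa [NExp.eval]
  · simpa [NExp.eval]
  · simpa [NExp.eval]
  · simpa [NExp.eval]
  rintro t s' ⟨ht, hl, hg, hu, hn, hf, hO⟩
  refine wp_storeReal ⟨?_, hg, hu, hn, fun c hc hco => ?_, ?_⟩
  · simp only [NExp.cost, RExp.cost] at ht ⊢; omega
  · simp only [NExp.eval, hl, h4]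
    rw [Function.update_of_ne hco]; exact hf c hc
  · simpa [NExp.eval, RExp.eval, hl, h4, h3] using hO

/-- The time of a query is `O(m (n + d) (2 h + 1))`. It stores the elements of rank `h` among
`2 h + 1` sketched distances, for the indices drawn in the first `2 h + 1` random draws. -/
theorem queryProgram_runs {n d m l h : ℕ} (hn : 1 ≤ n) (hd : 1 ≤ d) (hm : 1 ≤ m) (hl : 1 ≤ l)
    {h₀ : Heap} (c0 : h₀.nat 0 = n) (c1 : h₀.nat 1 = d) (c2 : h₀.nat 2 = m) (c3 : h₀.nat 3 = l)
    (c4 : h₀.nat 4 = h) (inp : ℕ → ℝ) (ω : Tape) :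
    ∃ t h', queryProgram.Runs inp ω [] h₀ t h' ∧ t ≤ 6000 * (m * (n + d) * (2 * h + 1)) ∧
      h'.nat = h₀.nat ∧ (∀ c < l * m * (n + d), h'.real c = h₀.real c) ∧
      ∀ i < n, IsOrderStat (fun k => memSketchDist n d m l h₀.real inp (ω.2 (k, l - 1)) i)
        (2 * h + 1) h (h'.real (l * m * (n + d) + i)) := by
  set S := l * m * (n + d) with hS
  set r := 2 * h + 1 with hr
  suffices hw : Wp queryProgram inp ω (.call 0 ([].map NExp.lit)) ⟨fun _ => 0, h₀, 0, 0⟩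
      fun t s' => t ≤ r * (m * (21 * d + 27) + n * (34 * m + 50) + 40) + n * (5000 * r + 43) + 54 ∧
        s'.heap.nat = h₀.nat ∧ (∀ c < S, s'.heap.real c = h₀.real c) ∧
        ∀ i < n, IsOrderStat (fun k => memSketchDist n d m l h₀.real inp (ω.2 (k, l - 1)) i)
          r h (s'.heap.real (S + i)) by
    obtain ⟨t, s', he, ht, h⟩ := hw
    refine ⟨t, s'.heap, ⟨s', rfl, he⟩, ht.trans ?_, h⟩
    have hr1 : 1 ≤ r := by omega
    -- as all parameters are at least `1`, the terms of lower order are absorbed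
    have e1 : 1 * 1 * 1 ≤ m * d * r := by gcongr
    have e2 : n * 1 * 1 ≤ n * m * r := by gcongr
    have e3 : 1 * 1 * r ≤ m * d * r := by gcongr
    have e4 : n * 1 * r ≤ n * m * r := by gcongr
    have e5 : m * 1 * r ≤ m * d * r := by gcongr
    calc _ = 21 * (m * d * r) + 27 * (m * 1 * r) + 34 * (n * m * r) + 5050 * (n * 1 * r) +
          40 * (1 * 1 * r) + 43 * (n * 1 * 1) + 54 * (1 * 1 * 1) := by ring
      _ ≤ 6000 * (m * d * r) + 6000 * (n * m * r) := by omega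
      _ = _ := by ring
  refine wp_call (body := queryMain) rfl (wp_seq (wp_setVar (wp_seq (wp_setVar (wp_seq (wp_setVar
    (wp_seq (wp_setVar (wp_seq (wp_setVar (wp_seq (wp_setVar (wp_seq (wp_setVar (wp_seq ?_)))))))))
    ))))))
  -- evaluate the local variables set so far
  simp only [NExp.eval, Function.update_apply, c0, c1, c2, c3, c4, NExp.cost]
  simp (decide := true) only [if_true, if_false]
  rw [← hr, ← hS]
  refine (wp_forC_frame (fun k hp g u => u = k ∧ hp.nat = h₀.nat ∧
      (∀ c < S, hp.real c = h₀.real c) ∧ ∀ i < n, ∀ k' < k, hp.real (S + n + m + i * r + k') =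
        memSketchDist n d m l h₀.real inp (ω.2 (k', l - 1)) i) r
      (m * (21 * d + 27) + n * (34 * m + 50) + 33) ?_ ?_ ?_).mono ?_
  · intro k hp g u
    simp [NExp.eval]
  · simp
  · rintro k hp g u hk ⟨rfl, hn, hf, hv⟩
    refine wp_call (body := roundProc) rfl ((wp_roundProc (n := n) (d := d) (m := m) (l := l)
      (S := S) (r := r) (k := u) ?_ ?_ ?_ ?_ ?_ ?_ ?_ hl hS hk).mono ?_)
    iterate 7 · simp [NExp.eval]
    rintro t s' ⟨ht, hg, hu, hn', hf', hk', hd'⟩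
    refine ⟨?_, rfl, hu, hn'.trans hn, fun c hc => (hf' c hc).trans (hf c hc),
      fun i hi k' hk1 => ?_⟩
    · simp [NExp.cost]; omega
    · rcases Nat.lt_succ_iff_lt_or_eq.1 hk1 with hlt | rfl
      · exact (hk' i k' (by omega) (by omega)).trans (hv i hi k' hlt)
      · refine (hd' i hi).trans ?_
        refine memSketchDist_congr ?_ hi hf fun _ _ => rfl
        have := (ω.2 (k', l - 1)).2
        omega
  rintro t₁ ⟨l₁, hp₁, g₁, u₁⟩ ⟨ht₁, hl₁, -, hn₁, hf₁, hv₁⟩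
  simp only at hl₁ hn₁ hf₁ hv₁
  subst hl₁
  refine (wp_forC_frame (fun i hp _ _ => hp.nat = h₀.nat ∧
      (∀ c < S, hp.real c = h₀.real c) ∧
      (∀ c < n * r, hp.real (S + n + m + c) = hp₁.real (S + n + m + c)) ∧
      ∀ i' < i, IsOrderStat (fun k => memSketchDist n d m l h₀.real inp (ω.2 (k, l - 1)) i')
          r h (hp.real (S + i'))) n (5000 * r + 36) ?_ ?_ ?_).mono ?_
  · intro k hp g u
    simp [NExp.eval]
  · exact ⟨hn₁, hf₁, fun _ _ => rfl, by simp⟩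
  · rintro i hp g u hi ⟨hn, hf, hv, hO⟩
    have hir : i * r + r ≤ n * r := by rw [← Nat.succ_mul]; gcongr; exact hi
    refine wp_call (body := medianProc) rfl ((wp_medianProc (a := S + n + m + i * r) (r := r)
      (h := h) (f := S + n + m + n * r) (out := S + i) ?_ ?_ ?_ ?_ ?_ (by omega)
      (by omega)).mono ?_)
    iterate 5 · simp [NExp.eval]
    rintro t s' ⟨ht, hg, hu, hn', hf', hO'⟩
    simp only at hn' hf' hO'
    refine ⟨?_, rfl, hn'.trans hn, fun c hc => ?_, fun c hc => ?_, fun i' hi' => ?_⟩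
    · simp [NExp.cost]; omega
    · exact (hf' c (by omega) (by omega)).trans (hf c hc)
    · exact (hf' _ (by omega) (by omega)).trans (hv c hc)
    · rcases Nat.lt_succ_iff_lt_or_eq.1 hi' with hlt | rfl
      · rw [hf' (S + i') (by omega) (by omega)]
        exact hO i' hlt
      · refine hO'.congr fun k hk => ?_
        rw [add_assoc, hv _ (by omega), ← add_assoc]
        exact hv₁ i' hi k hk
  · rintro t s' ⟨ht, -, hn, hf, -, hO⟩
    refine ⟨?_, hn, hf, hO⟩
    simp only [NExp.cost, List.map_nil, List.sum_nil] at ht ht₁ ⊢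
    rw [show 1 + 6 + (5000 * r + 36) = 5000 * r + 43 by ring] at ht
    rw [show 1 + 6 + (m * (21 * d + 27) + n * (34 * m + 50) + 33) =
      m * (21 * d + 27) + n * (34 * m + 50) + 40 by ring] at ht₁
    omega

end

end ADE

/-! ### The preprocessing program -/

namespace ADE

/-- The number of rows of a sketching matrix is the least `m` with `sketchConst ≤ m ε²`. The
constant makes the bound `3 · 2⁴ / (m (ε / 2)²)`, for the probability that one matrix distorts the
square of a length at most `2` by `ε / 2`, at most `2⁻¹⁵⁰`; the probability that this happens for a
thirtieth of the `l` matrices is then small compared to `2⁻²ˡ`. -/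
def sketchConst : ℕ := 192 * 2 ^ 150

/-- Procedure `3` of the preprocessing, arguments `n, d, m, l, j`: store the sketches of all points
under matrix `j`. The sketch of point `i` starts at cell `l m d + (j n + i) m`. -/
def sketchPointsProc : Cmd :=
  forC 5 (.var 0) (.call 2 [.var 2, .var 1, .mul (.mul (.var 4) (.var 2)) (.var 1),
    .add (.lit 2) (.mul (.var 5) (.var 1)),
    .add (.mul (.mul (.var 3) (.var 2)) (.var 1))
      (.mul (.add (.mul (.var 4) (.var 0)) (.var 5)) (.var 2))])

/-- Set `v₂` to the least `m` with `sketchConst ≤ m ε²`. -/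
def findRowsC : Cmd :=
  .seq (.setVar 2 (.lit 0)) (.loop (.realLT (.mul (.mul (.ofNat (.var 2)) (.input (.lit 0)))
    (.input (.lit 0))) (.ofNat (.lit sketchConst))) (.setVar 2 (.add (.var 2) (.lit 1))))

/-- Add to `vᵢ` the least `k` with `e ≤ 2 ^ k δ`, by repeated doubling. This replaces a logarithm,
which the machine does not have. -/
def addLogC (i : ℕ) (e : NExp) : Cmd :=
  .seq (.setVar 5 (.lit 1)) (.loop (.realLT (.mul (.ofNat (.var 5)) (.input (.lit 1))) (.ofNat e))
    (.seq (.setVar 5 (.mul (.lit 2) (.var 5))) (.setVar i (.add (.var i) (.lit 1)))))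

/-- Sample the entries of all matrices: standard Gaussians, divided by `√m`. -/
def sampleC : Cmd :=
  forC 5 (.mul (.mul (.var 3) (.var 2)) (.var 1)) (.seq (.gauss (.var 5))
    (.storeReal (.var 5) (.div (.load (.var 5)) (.sqrt (.ofNat (.var 2))))))

/-- Procedure `0` of the preprocessing. The arguments are `n` and `d`; the parameters `m`, `l`, `h`
are computed in the local variables `2`, `3`, `4` and stored with `n` and `d` in the first
natural-number cells. -/
def preMain : Cmd :=
  .seq findRowsC (.seq (.setVar 3 (.var 1)) (.seq (addLogC 3 (.lit 1)) (.seq (.setVar 4 (.lit 1))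
    (.seq (addLogC 4 (.var 0)) (.seq (.storeNat (.lit 0) (.var 0)) (.seq
    (.storeNat (.lit 1) (.var 1)) (.seq (.storeNat (.lit 2) (.var 2)) (.seq
    (.storeNat (.lit 3) (.var 3)) (.seq (.storeNat (.lit 4) (.var 4)) (.seq sampleC
    (forC 5 (.var 3) (.call 3 [.var 0, .var 1, .var 2, .var 3, .var 5]))))))))))))

/-- The preprocessing program. The entries of the `l` matrices are in the first `l m d` real cells,
followed by the sketches. -/
def preProgram : Program := [preMain, dotProc, matVecProc, sketchPointsProc]

/-- The natural-number cells of the data structure. -/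
def paramCells (n d m l h : ℕ) : ℕ → ℕ := fun c => [n, d, m, l, h].getD c 0

section
variable {inp : ℕ → ℝ} {ω : Tape}

theorem wp_sketchPointsProc {s : State} {n d m l j : ℕ} (h0 : s.loc 0 = n) (h1 : s.loc 1 = d)
    (h2 : s.loc 2 = m) (h3 : s.loc 3 = l) (h4 : s.loc 4 = j) (hjl : j < l) :
    Wp preProgram inp ω sketchPointsProc s fun t s' => t ≤ n * (m * (21 * d + 27) + 38) + 5 ∧
      s'.gpos = s.gpos ∧ s'.upos = s.upos ∧ s'.heap.nat = s.heap.nat ∧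
      (∀ c < l * m * d + j * n * m, s'.heap.real c = s.heap.real c) ∧
      ∀ i < n, ∀ a < m, s'.heap.real (l * m * d + (j * n + i) * m + a) =
        ∑ b ∈ Finset.range d, s.heap.real (j * m * d + a * d + b) * inp (2 + i * d + b) := by
  have e1 : j * m * d + m * d ≤ l * m * d := by
    rw [← Nat.add_mul, ← Nat.succ_mul]; gcongr; exact hjl
  refine (wp_forC_frame (fun i h g u => g = s.gpos ∧ u = s.upos ∧ h.nat = s.heap.nat ∧
      (∀ c < l * m * d + j * n * m, h.real c = s.heap.real c) ∧
      ∀ i' < i, ∀ a < m, h.real (l * m * d + (j * n + i') * m + a) =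
        ∑ b ∈ Finset.range d, s.heap.real (j * m * d + a * d + b) * inp (2 + i' * d + b))
      n (m * (21 * d + 27) + 31) ?_ (by simp) ?_).mono ?_
  · intro k h g u
    simp [NExp.eval, h0]
  · rintro i h g u hi ⟨rfl, rfl, hn, hf, hv⟩
    refine wp_call (body := matVecProc) rfl ((wp_matVecProc (m := m) (d := d) (base := j * m * d)
      (x := 2 + i * d) (out := l * m * d + (j * n + i) * m) rfl ?_ ?_ ?_ ?_ ?_ (by omega)).mono ?_)
    · simp [NExp.eval, h2]
    · simp [NExp.eval, h1]
    · simp [NExp.eval, h1, h2, h4]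
    · simp [NExp.eval, h1]
    · simp [NExp.eval, h0, h1, h2, h3, h4]
    rintro t s' ⟨ht, hg, hu, hn', hf', hv'⟩
    simp only at hn' hf' hv'
    refine ⟨?_, rfl, hg, hu, hn'.trans hn, fun c hc => ?_, fun i' hi' a ha => ?_⟩
    · simp [NExp.cost]; omega
    · rw [Nat.add_mul] at hf'
      exact (hf' c (by omega)).trans (hf c hc)
    · rcases Nat.lt_succ_iff_lt_or_eq.1 hi' with hlt | rfl
      · have : (j * n + i') * m + m ≤ (j * n + i) * m := by
          rw [← Nat.succ_mul]; gcongr; omega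
        exact (hf' _ (by omega)).trans (hv i' hlt a ha)
      · refine (hv' a ha).trans (Finset.sum_congr rfl fun b hb => ?_)
        have hb := Finset.mem_range.1 hb
        have : a * d + d ≤ m * d := by rw [← Nat.succ_mul]; gcongr; exact ha
        rw [hf _ (by omega)]
  · rintro t s' ⟨ht, -, h⟩
    refine ⟨?_, h⟩
    simp only [NExp.cost] at ht
    rw [show 1 + 6 + (m * (21 * d + 27) + 31) = m * (21 * d + 27) + 38 by ring] at ht
    omega

theorem wp_findRowsC {s : State} {ε : ℝ} {m : ℕ} (hε : inp 0 = ε)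
    (hm : (sketchConst : ℝ) ≤ m * ε ^ 2) (hm' : ∀ m' < m, (m' : ℝ) * ε ^ 2 < sketchConst) :
    Wp preProgram inp ω findRowsC s fun t s' => t ≤ 15 * m + 13 ∧
      s' = { s with loc := Function.update s.loc 2 m } := by
  refine wp_seq (wp_setVar ((wp_loop (N := m) (T := 4)
    (I := fun c s' => s' = { s with loc := Function.update s.loc 2 c }) ?_ ?_ ?_).mono ?_))
  · rintro c s' hc rfl
    refine ⟨?_, wp_setVar ⟨by simp [NExp.cost], ?_⟩⟩
    · have := hm' c hc
      simp only [Test.Holds, NExp.eval, RExp.eval, hε, Function.update_self]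
      linarith
    · simp [NExp.eval]
  · rintro s' rfl
    simp only [Test.Holds, NExp.eval, RExp.eval, hε, Function.update_self]
    linarith
  · simp [NExp.eval]
  · rintro t s' ⟨ht, hs⟩
    refine ⟨?_, hs⟩
    simp only [Test.cost, NExp.cost, RExp.cost] at ht ⊢
    omega

theorem wp_addLogC {s : State} {i : ℕ} {e : NExp} {δ : ℝ} {N k : ℕ} (hi : i ≠ 5)
    (hδ : inp 1 = δ) (he : ∀ s' : State, (∀ j, j ≠ 5 → j ≠ i → s'.loc j = s.loc j) → e.eval s' = N)
    (hk : (N : ℝ) ≤ 2 ^ k * δ) (hk' : ∀ k' < k, 2 ^ k' * δ < (N : ℝ)) :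
    Wp preProgram inp ω (addLogC i e) s fun t s' => t ≤ k * (e.cost + 15) + e.cost + 9 ∧
      s'.loc i = s.loc i + k ∧ (∀ j, j ≠ 5 → j ≠ i → s'.loc j = s.loc j) ∧
      s'.heap = s.heap ∧ s'.gpos = s.gpos ∧ s'.upos = s.upos := by
  refine wp_seq (wp_setVar ((wp_loop (N := k) (T := 8)
    (I := fun c s' => s'.loc 5 = 2 ^ c ∧ s'.loc i = s.loc i + c ∧
      (∀ j, j ≠ 5 → j ≠ i → s'.loc j = s.loc j) ∧
      s'.heap = s.heap ∧ s'.gpos = s.gpos ∧ s'.upos = s.upos) ?_ ?_ ?_).mono ?_))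
  · rintro c s' hc ⟨h5, hi', hl, hh, hg, hu⟩
    refine ⟨?_, wp_seq (wp_setVar (wp_setVar ⟨by simp [NExp.cost], ?_, ?_, ?_, hh, hg, hu⟩))⟩
    · simpa [Test.Holds, NExp.eval, RExp.eval, hδ, h5, he s' hl] using hk' c hc
    · simp [NExp.eval, hi.symm, h5, pow_succ']
    · simp [NExp.eval, hi, hi', add_assoc]
    · intro j h1 h2
      simp [h1, h2, hl j h1 h2]
  · rintro s' ⟨h5, hi', hl, hh, hg, hu⟩
    simpa [Test.Holds, NExp.eval, RExp.eval, hδ, h5, he s' hl] using hk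
  · simp +contextual [NExp.eval, hi]
  · rintro t s' ⟨ht, -, h⟩
    refine ⟨?_, h⟩
    simp only [Test.cost, NExp.cost, RExp.cost] at ht ⊢
    rw [show 1 + 1 + (1 + 1) + 1 + (e.cost + 1) + 1 + 8 = e.cost + 15 by ring] at ht
    omega

theorem wp_sampleC {s : State} {d m l : ℕ} (h1 : s.loc 1 = d) (h2 : s.loc 2 = m)
    (h3 : s.loc 3 = l) (hg : s.gpos = 0) :
    Wp preProgram inp ω sampleC s fun t s' => t ≤ l * m * d * 21 + 9 ∧
      s'.loc = Function.update s.loc 5 (l * m * d) ∧ s'.heap.nat = s.heap.nat ∧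
      ∀ c < l * m * d, s'.heap.real c = ω.1 c / √m := by
  refine (wp_forC_frame (fun k h g _ => g = k ∧ h.nat = s.heap.nat ∧
      ∀ c < k, h.real c = ω.1 c / √m) (l * m * d) 10 ?_ (by simp [hg]) ?_).mono ?_
  · intro k h g u
    simp [NExp.eval, h1, h2, h3]
  · rintro k h g u hk ⟨rfl, hn, hv⟩
    refine wp_seq (wp_gauss (wp_storeReal ⟨?_, rfl, rfl, hn, fun c hc => ?_⟩))
    · simp [NExp.cost, RExp.cost]
    · simp only [NExp.eval, RExp.eval, Function.update_self,
        Function.update_of_ne (show 2 ≠ 5 by decide), h2]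
      rcases Nat.lt_succ_iff_lt_or_eq.1 hc with hlt | rfl
      · rw [Function.update_of_ne hlt.ne, Function.update_of_ne hlt.ne]; exact hv c hlt
      · simp
  · rintro t s' ⟨ht, hl, -, h⟩
    refine ⟨?_, hl, h⟩
    simp only [NExp.cost] at ht
    omega

/-- The preprocessing stores the parameters `l = d + k₁` and `h = k₂ + 1`, where `k₁` and `k₂` are
the logarithms to base two of `1 / δ` and `n / δ`, rounded up; then the matrices, and the sketches
of all points. -/
theorem preProgram_runs {n d m k₁ k₂ : ℕ} {ε δ : ℝ} (hn : 1 ≤ n) (hd : 1 ≤ d) (hm0 : 1 ≤ m)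
    (hε : inp 0 = ε) (hδ : inp 1 = δ)
    (hm : (sketchConst : ℝ) ≤ m * ε ^ 2) (hm' : ∀ m' < m, (m' : ℝ) * ε ^ 2 < sketchConst)
    (hk₁ : (1 : ℝ) ≤ 2 ^ k₁ * δ) (hk₁' : ∀ k' < k₁, 2 ^ k' * δ < (1 : ℝ))
    (hk₂ : (n : ℝ) ≤ 2 ^ k₂ * δ) (hk₂' : ∀ k' < k₂, 2 ^ k' * δ < (n : ℝ)) (ω : Tape) :
    ∃ t h, preProgram.Runs inp ω [n, d] Heap.zero t h ∧
      t ≤ 300 * ((d + k₁) * m * n * d + k₂) ∧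
      h.nat = paramCells n d m (d + k₁) (k₂ + 1) ∧
      (∀ c < (d + k₁) * m * d, h.real c = ω.1 c / √m) ∧
      ∀ j < d + k₁, ∀ i < n, ∀ a < m, h.real ((d + k₁) * m * d + (j * n + i) * m + a) =
        ∑ b ∈ Finset.range d, ω.1 (j * m * d + a * d + b) / √m * inp (2 + i * d + b) := by
  set l := d + k₁ with hl
  suffices hw : Wp preProgram inp ω (.call 0 ([n, d].map NExp.lit)) ⟨fun _ => 0, Heap.zero, 0, 0⟩
      fun t s' => t ≤ 15 * m + k₁ * 16 + k₂ * 16 + l * m * d * 21 +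
          l * (n * (m * (21 * d + 27) + 38) + 18) + 100 ∧
        s'.heap.nat = paramCells n d m l (k₂ + 1) ∧
        (∀ c < l * m * d, s'.heap.real c = ω.1 c / √m) ∧
        ∀ j < l, ∀ i < n, ∀ a < m, s'.heap.real (l * m * d + (j * n + i) * m + a) =
          ∑ b ∈ Finset.range d, ω.1 (j * m * d + a * d + b) / √m * inp (2 + i * d + b) by
    obtain ⟨t, s', he, ht, h⟩ := hw
    refine ⟨t, s'.heap, ⟨s', rfl, he⟩, ht.trans ?_, h⟩
    have hl1 : 1 ≤ l := by omega
    -- as all parameters are at least `1`, the terms of lower order are absorbed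
    have e1 : 1 * m * 1 * 1 ≤ l * m * n * d := by gcongr
    have e2 : l * 1 * 1 * 1 ≤ l * m * n * d := by gcongr
    have e3 : l * m * 1 * d ≤ l * m * n * d := by gcongr
    have e4 : l * m * n * 1 ≤ l * m * n * d := by gcongr
    have e5 : l * 1 * n * 1 ≤ l * m * n * d := by gcongr
    have e6 : 1 * 1 * 1 * 1 ≤ l * m * n * d := by gcongr
    calc _ = 15 * (1 * m * 1 * 1) + k₁ * 16 + k₂ * 16 + 21 * (l * m * 1 * d) +
          21 * (l * m * n * d) + 27 * (l * m * n * 1) + 38 * (l * 1 * n * 1) +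
          18 * (l * 1 * 1 * 1) + 100 * (1 * 1 * 1 * 1) := by ring
      _ ≤ _ := by omega
  refine wp_call (body := preMain) rfl (wp_seq ((wp_findRowsC hε hm hm').mono ?_))
  rintro t₁ s₁ ⟨ht₁, rfl⟩
  refine wp_seq (wp_setVar (wp_seq ((wp_addLogC (N := 1) (by decide) hδ ?_ (by simpa using hk₁)
    (by simpa using hk₁')).mono ?_)))
  · intro s' _
    simp [NExp.eval]
  rintro t₂ ⟨l₂, hp₂, g₂, u₂⟩ ⟨ht₂, hl₂, hl₂', hh₂, hg₂, hu₂⟩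
  simp only at hl₂ hl₂' hh₂ hg₂ hu₂
  subst hh₂ hg₂ hu₂
  have l0 : l₂ 0 = n := by simp [hl₂' 0, NExp.eval]
  have l1 : l₂ 1 = d := by simp [hl₂' 1, NExp.eval]
  have l2 : l₂ 2 = m := by simp [hl₂' 2]
  have l3 : l₂ 3 = l := by rw [hl₂]; simp [NExp.eval, hl]
  refine wp_seq (wp_setVar (wp_seq ((wp_addLogC (N := n) (k := k₂) (by decide) hδ ?_ hk₂
    hk₂').mono ?_)))
  · intro s' h
    simp [NExp.eval, h 0, l0]
  rintro t₃ ⟨l₃, hp₃, g₃, u₃⟩ ⟨ht₃, hl₃, hl₃', hh₃, hg₃, hu₃⟩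
  simp only at hl₃ hl₃' hh₃ hg₃ hu₃
  subst hh₃ hg₃ hu₃
  have l0 : l₃ 0 = n := by simp [hl₃' 0, l0]
  have l1 : l₃ 1 = d := by simp [hl₃' 1, l1]
  have l2 : l₃ 2 = m := by simp [hl₃' 2, l2]
  have l3 : l₃ 3 = l := by simp [hl₃' 3, l3]
  have l4 : l₃ 4 = k₂ + 1 := by rw [hl₃]; simp [NExp.eval, add_comm]
  refine wp_seq (wp_storeNat (wp_seq (wp_storeNat (wp_seq (wp_storeNat (wp_seq (wp_storeNat
    (wp_seq (wp_storeNat (wp_seq ((wp_sampleC (d := d) (m := m) (l := l) l1 l2 l3 rfl).mono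
      ?_)))))))))))
  rintro t₄ ⟨l₄, hp₄, g₄, u₄⟩ ⟨ht₄, hl₄, hn₄, hv₄⟩
  simp only at hl₄ hn₄ hv₄
  subst hl₄
  have hn₄ : hp₄.nat = paramCells n d m l (k₂ + 1) := by
    rw [hn₄]
    funext c
    simp only [NExp.eval, l0, l1, l2, l3, l4, paramCells, Heap.zero, Function.update_apply]
    match c with
    | 0 | 1 | 2 | 3 | 4 => rfl
    | c + 5 => simp
  refine (wp_forC_frame (fun j h _ _ => h.nat = paramCells n d m l (k₂ + 1) ∧
      (∀ c < l * m * d, h.real c = ω.1 c / √m) ∧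
      ∀ j' < j, ∀ i < n, ∀ a < m, h.real (l * m * d + (j' * n + i) * m + a) =
        ∑ b ∈ Finset.range d, ω.1 (j' * m * d + a * d + b) / √m * inp (2 + i * d + b))
      l (n * (m * (21 * d + 27) + 38) + 11) ?_ ⟨hn₄, hv₄, by simp⟩ ?_).mono ?_
  · intro k h g u
    simp [NExp.eval, l3]
  · rintro j h g u hj ⟨hn, hv, hs⟩
    refine wp_call (body := sketchPointsProc) rfl ((wp_sketchPointsProc (n := n) (d := d) (m := m)
      (l := l) (j := j) ?_ ?_ ?_ ?_ ?_ hj).mono ?_)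
    · simp [NExp.eval, l0]
    · simp [NExp.eval, l1]
    · simp [NExp.eval, l2]
    · simp [NExp.eval, l3]
    · simp [NExp.eval]
    rintro t s' ⟨ht, -, -, hn', hf', hv'⟩
    simp only at hn' hf' hv'
    refine ⟨?_, rfl, hn'.trans hn, fun c hc => (hf' c (by omega)).trans (hv c hc),
      fun j' hj' i hi a ha => ?_⟩
    · simp [NExp.cost]; omega
    · rcases Nat.lt_succ_iff_lt_or_eq.1 hj' with hlt | rfl
      · have e1 : j' * n + n ≤ j * n := by rw [← Nat.succ_mul]; gcongr; exact hlt
        have e2 : (j' * n + i) * m + m ≤ j * n * m := by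
          rw [← Nat.succ_mul]; gcongr; omega
        exact (hf' _ (by omega)).trans (hs j' hlt i hi a ha)
      · refine (hv' i hi a ha).trans (Finset.sum_congr rfl fun b hb => ?_)
        have hb := Finset.mem_range.1 hb
        have e1 : j' * m * d + m * d ≤ l * m * d := by
          rw [← Nat.add_mul, ← Nat.succ_mul]; gcongr; exact hj
        have e2 : a * d + d ≤ m * d := by rw [← Nat.succ_mul]; gcongr; exact ha
        rw [hv _ (by omega)]
  · rintro t s' ⟨ht, -, h⟩
    refine ⟨?_, h⟩
    simp only [NExp.cost, List.map_cons, List.map_nil, List.sum_cons, List.sum_nil] at *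
    rw [show 1 + 6 + (n * (m * (21 * d + 27) + 38) + 11) = n * (m * (21 * d + 27) + 38) + 18 by
      ring] at ht
    omega

end

end ADE

/-! ### Tail bounds for independent trials and Gaussian sketches -/

namespace ADE

/-- The probability that at least `s` of finitely many independent trials fall into `B`, by the
union bound over the sets of `s` trials. -/
theorem pi_card_mem_ge_le {ι α : Type*} [Fintype ι] [MeasurableSpace α] (μ : Measure α)
    [IsProbabilityMeasure μ] (B : Set α) [DecidablePred fun a => a ∈ B] (s : ℕ) :
    Measure.pi (fun _ : ι => μ) {f | s ≤ (Finset.univ.filter fun i => f i ∈ B).card} ≤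
      2 ^ Fintype.card ι * μ B ^ s := by
  classical
  have hsub : {f : ι → α | s ≤ (Finset.univ.filter fun i => f i ∈ B).card} ⊆
      ⋃ A ∈ Finset.powersetCard s (Finset.univ : Finset ι),
        Set.univ.pi fun i => if i ∈ A then B else Set.univ := by
    intro f hf
    obtain ⟨A, hA, hs⟩ := Finset.exists_subset_card_eq hf
    simp only [Set.mem_iUnion, Finset.mem_powersetCard_univ]
    refine ⟨A, hs, fun i _ => ?_⟩
    by_cases hi : i ∈ A
    · simpa [hi] using (Finset.mem_filter.1 (hA hi)).2
    · simp [hi]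
  calc _ ≤ _ := measure_mono hsub
    _ ≤ ∑ A ∈ Finset.powersetCard s (Finset.univ : Finset ι),
        Measure.pi (fun _ : ι => μ) (Set.univ.pi fun i => if i ∈ A then B else Set.univ) :=
      measure_biUnion_finset_le _ _
    _ = ∑ A ∈ Finset.powersetCard s (Finset.univ : Finset ι), μ B ^ s := by
      refine Finset.sum_congr rfl fun A hA => ?_
      rw [Measure.pi_pi, ← (Finset.mem_powersetCard.1 hA).2, ← Finset.prod_const]
      have : ∀ i, μ (if i ∈ A then B else Set.univ) = if i ∈ A then μ B else 1 := fun i => by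
        split_ifs <;> simp
      simp [this, Finset.prod_ite_mem]
    _ = ((Fintype.card ι).choose s : ℕ) * μ B ^ s := by
      simp [Finset.card_powersetCard]
    _ ≤ _ := by
      gcongr
      exact_mod_cast Nat.choose_le_two_pow _ _

theorem integral_sq_gaussianReal (v : ℝ≥0) : ∫ x, x ^ 2 ∂gaussianReal 0 v = v := by
  have h := variance_fun_id_gaussianReal (μ := 0) (v := v)
  rw [variance_eq_integral (by fun_prop)] at h
  simpa [integral_id_gaussianReal] using h

/-- The fourth moment, as the fourth derivative of the moment generating function at `0`. -/
theorem integral_pow_four_gaussianReal (v : ℝ≥0) :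
    ∫ x, x ^ 4 ∂gaussianReal 0 v = 3 * (v : ℝ) ^ 2 := by
  have h := iteratedDeriv_mgf_zero (X := fun x : ℝ => x) (μ := gaussianReal 0 v)
    (by simp [integrableExpSet_fun_id_gaussianReal]) 4
  have hE : ∀ t : ℝ, HasDerivAt (fun t => Real.exp (v * t ^ 2 / 2))
      (v * t * Real.exp (v * t ^ 2 / 2)) t := fun t => by
    have := ((((hasDerivAt_id t).pow 2).const_mul (v : ℝ)).div_const 2).exp
    simp only [id, Nat.cast_ofNat, Nat.add_one_sub_one, pow_one, mul_one, Pi.pow_apply] at this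
    convert this using 1
    ring
  -- the derivatives of `exp (v t² / 2)` are polynomials times `exp (v t² / 2)`
  have hP : ∀ a b c e f t : ℝ, deriv (fun t => (a + b * t + c * t ^ 2 + e * t ^ 3 + f * t ^ 4) *
      Real.exp (v * t ^ 2 / 2)) t = ((b + 2 * c * t + 3 * e * t ^ 2 + 4 * f * t ^ 3) +
        (a + b * t + c * t ^ 2 + e * t ^ 3 + f * t ^ 4) * (v * t)) *
          Real.exp (v * t ^ 2 / 2) := fun a b c e f t => by
    have h1 : HasDerivAt (fun t : ℝ => a + b * t + c * t ^ 2 + e * t ^ 3 + f * t ^ 4)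
        (b + 2 * c * t + 3 * e * t ^ 2 + 4 * f * t ^ 3) t := by
      have h : HasDerivAt (fun t : ℝ => a + b * t + c * t ^ 2 + e * t ^ 3 + f * t ^ 4) _ t :=
        (((((hasDerivAt_id t).const_mul b).const_add a).add
          ((hasDerivAt_pow 2 t).const_mul c)).add ((hasDerivAt_pow 3 t).const_mul e)).add
          ((hasDerivAt_pow 4 t).const_mul f)
      refine h.congr_deriv ?_
      push_cast
      ring
    rw [(h1.fun_mul (hE t)).deriv]
    ring
  have d0 : mgf (fun x : ℝ => x) (gaussianReal 0 v) = fun t => (1 + 0 * t + 0 * t ^ 2 +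
      0 * t ^ 3 + 0 * t ^ 4) * Real.exp (v * t ^ 2 / 2) := by
    rw [mgf_fun_id_gaussianReal]
    funext t
    simp
  have d1 : deriv (mgf (fun x : ℝ => x) (gaussianReal 0 v)) = fun t => (0 + (v : ℝ) * t +
      0 * t ^ 2 + 0 * t ^ 3 + 0 * t ^ 4) * Real.exp (v * t ^ 2 / 2) := by
    rw [d0]; funext t; rw [hP]; ring
  have d2 : deriv (fun t => (0 + (v : ℝ) * t + 0 * t ^ 2 + 0 * t ^ 3 + 0 * t ^ 4) *
      Real.exp (v * t ^ 2 / 2)) = fun t => ((v : ℝ) + 0 * t + v ^ 2 * t ^ 2 + 0 * t ^ 3 +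
        0 * t ^ 4) * Real.exp (v * t ^ 2 / 2) := by
    funext t; rw [hP]; ring
  have d3 : deriv (fun t => ((v : ℝ) + 0 * t + v ^ 2 * t ^ 2 + 0 * t ^ 3 + 0 * t ^ 4) *
      Real.exp (v * t ^ 2 / 2)) = fun t => (0 + 3 * (v : ℝ) ^ 2 * t + 0 * t ^ 2 + v ^ 3 * t ^ 3 +
        0 * t ^ 4) * Real.exp (v * t ^ 2 / 2) := by
    funext t; rw [hP]; ring
  rw [iteratedDeriv_succ', iteratedDeriv_succ', iteratedDeriv_succ', iteratedDeriv_succ',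
    iteratedDeriv_zero, d1, d2, d3, hP] at h
  simpa using h.symm

/-- A linear combination of independent centered Gaussians is Gaussian. -/
theorem map_sum_mul_pi_gaussianReal {d : ℕ} (v : ℝ≥0) (θ : Fin d → ℝ) :
    (Measure.pi fun _ : Fin d => gaussianReal 0 v).map (fun g => ∑ b, g b * θ b) =
      gaussianReal 0 (∑ b, Real.toNNReal (θ b ^ 2) * v) := by
  have hind : iIndepFun (fun (b : Fin d) (g : Fin d → ℝ) => g b * θ b)
      (Measure.pi fun _ : Fin d => gaussianReal 0 v) :=
    iIndepFun_pi (X := fun b (x : ℝ) => x * θ b) (fun b => by fun_prop)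
  have hlaw : ∀ b, (Measure.pi fun _ : Fin d => gaussianReal 0 v).map (fun g => g b * θ b) =
      gaussianReal 0 (Real.toNNReal (θ b ^ 2) * v) := by
    intro b
    have h1 := (measurePreserving_eval (fun _ : Fin d => gaussianReal 0 v) b).map_eq
    have h2 := gaussianReal_map_mul_const (μ := 0) (v := v) (θ b)
    nth_rewrite 1 [← h1] at h2
    rw [Measure.map_map (by fun_prop) (by fun_prop), mul_zero] at h2
    exact h2.trans (by rw [Real.toNNReal_of_nonneg (sq_nonneg _)])
  suffices h : ∀ s : Finset (Fin d),
      (Measure.pi fun _ : Fin d => gaussianReal 0 v).map (∑ b ∈ s, fun g => g b * θ b) =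
        gaussianReal 0 (∑ b ∈ s, Real.toNNReal (θ b ^ 2) * v) by
    have := h Finset.univ
    convert this using 2
    ext g
    simp
  intro s
  induction s using Finset.induction_on with
  | empty =>
    rw [Finset.sum_empty, Finset.sum_empty, gaussianReal_zero_var]
    change Measure.map (fun _ => 0) _ = _
    simp
  | insert b s hb ih =>
    rw [Finset.sum_insert hb, Finset.sum_insert hb]
    have := gaussianReal_add_gaussianReal_of_indepFun
      (hind.indepFun_finsetSum_of_notMem (fun i => by fun_prop) hb).symm (hlaw b) ih
    simpa using this

theorem sketchNorm_sq {m d : ℕ} (M : Matrix (Fin m) (Fin d) ℝ) (v : EuclideanSpace ℝ (Fin d)) :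
    sketchNorm M v ^ 2 = ∑ a, (∑ b, M a b * v b) ^ 2 := by
  rw [sketchNorm, EuclideanSpace.norm_sq_eq]
  simp [Matrix.mulVec, dotProduct]

/-- The law of one sketching matrix. -/
noncomputable def sketchLaw (m d : ℕ) : Measure (Fin m → Fin d → ℝ) :=
  Measure.pi fun _ => Measure.pi fun _ => gaussianReal 0 (1 / (m : ℝ≥0))

instance (m d : ℕ) : IsProbabilityMeasure (sketchLaw m d) := by
  unfold sketchLaw; infer_instance

theorem measurable_sum_mul {d : ℕ} (θ : EuclideanSpace ℝ (Fin d)) :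
    Measurable fun g : Fin d → ℝ => ∑ b, g b * θ b :=
  Finset.measurable_sum _ fun b _ => (measurable_pi_apply b).mul_const _

/-- The coordinates of a sketch are Gaussian. -/
theorem measurePreserving_row {m d : ℕ} (a : Fin m) (θ : EuclideanSpace ℝ (Fin d)) :
    MeasurePreserving (fun g : Fin m → Fin d → ℝ => ∑ b, g a b * θ b) (sketchLaw m d)
      (gaussianReal 0 (∑ b, Real.toNNReal (θ b ^ 2) * (1 / (m : ℝ≥0)))) := by
  have h : MeasurePreserving (fun g : Fin d → ℝ => ∑ b, g b * θ b)
      (Measure.pi fun _ : Fin d => gaussianReal 0 (1 / (m : ℝ≥0)))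
      (gaussianReal 0 (∑ b, Real.toNNReal (θ b ^ 2) * (1 / (m : ℝ≥0)))) :=
    ⟨measurable_sum_mul θ, map_sum_mul_pi_gaussianReal _ θ⟩
  exact h.comp (measurePreserving_eval (fun _ : Fin m =>
      Measure.pi fun _ : Fin d => gaussianReal 0 (1 / (m : ℝ≥0))) a)

theorem integral_comp_row {m d : ℕ} (a : Fin m) (θ : EuclideanSpace ℝ (Fin d)) {f : ℝ → ℝ}
    (hf : Measurable f) :
    ∫ g, f (∑ b, g a b * θ b) ∂sketchLaw m d =
      ∫ x, f x ∂gaussianReal 0 (∑ b, Real.toNNReal (θ b ^ 2) * (1 / (m : ℝ≥0))) := by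
  have h := measurePreserving_row (m := m) a θ
  rw [← h.map_eq, integral_map h.measurable.aemeasurable hf.aestronglyMeasurable]

/-- The variance of a coordinate of the sketch of `θ`. -/
theorem coe_rowVar {m d : ℕ} (θ : EuclideanSpace ℝ (Fin d)) :
    ((∑ b, Real.toNNReal (θ b ^ 2) * (1 / (m : ℝ≥0)) : ℝ≥0) : ℝ) = ‖θ‖ ^ 2 / m := by
  rw [EuclideanSpace.norm_sq_eq, Finset.sum_div, NNReal.coe_sum]
  refine Finset.sum_congr rfl fun b _ => ?_
  simp [div_eq_mul_inv, Real.coe_toNNReal _ (sq_nonneg _)]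

theorem memLp_row_sq {m d : ℕ} (a : Fin m) (θ : EuclideanSpace ℝ (Fin d)) :
    MemLp (fun g : Fin m → Fin d → ℝ => (∑ b, g a b * θ b) ^ 2) 2 (sketchLaw m d) := by
  refine MemLp.comp_measurePreserving (g := fun x : ℝ => x ^ 2) ?_ (measurePreserving_row a θ)
  rw [memLp_two_iff_integrable_sq (by fun_prop)]
  have := (memLp_id_gaussianReal' (μ := 0) (v := ∑ b, Real.toNNReal (θ b ^ 2) * (1 / (m : ℝ≥0)))
    (4 : ℕ) (by simp)).integrable_norm_pow (by norm_num)
  refine this.congr (.of_forall fun x => ?_)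
  simp only [id, Real.norm_eq_abs]
  rw [← pow_mul, Even.pow_abs (by decide)]

/-- The squared length of a sketch deviates by at least `c` with probability `O(‖θ‖⁴ / (m c²))`.
This is Chebyshev's inequality: the squared length is a sum of `m` independent squares of Gaussians
of variance `‖θ‖² / m`. -/
theorem sketchLaw_deviation_le {m d : ℕ} (hm : 1 ≤ m) (θ : EuclideanSpace ℝ (Fin d)) {c : ℝ}
    (hc : 0 < c) :
    sketchLaw m d {g | c ≤ |sketchNorm (Matrix.of g) θ ^ 2 - ‖θ‖ ^ 2|} ≤
      ENNReal.ofReal (3 * ‖θ‖ ^ 4 / (m * c ^ 2)) := by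
  have hm' : (m : ℝ) ≠ 0 := by positivity
  have hY := fun a => memLp_row_sq (m := m) a θ
  have hmean : ∫ g, ∑ a, (∑ b, g a b * θ b) ^ 2 ∂sketchLaw m d = ‖θ‖ ^ 2 := by
    rw [integral_finsetSum _ fun a _ => (hY a).integrable (by norm_num)]
    simp_rw [integral_comp_row (f := fun x => x ^ 2) _ θ (by fun_prop), integral_sq_gaussianReal,
      coe_rowVar]
    simp
    field_simp
  have hvar1 : ∀ a, variance (fun g : Fin m → Fin d → ℝ => (∑ b, g a b * θ b) ^ 2)
      (sketchLaw m d) ≤ 3 * (‖θ‖ ^ 2 / m) ^ 2 := by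
    intro a
    refine (variance_le_expectation_sq (hY a).1).trans (le_of_eq ?_)
    have := integral_comp_row (m := m) (f := fun x => x ^ 4) a θ (by fun_prop)
    rw [integral_pow_four_gaussianReal, coe_rowVar] at this
    rw [← this]
    refine integral_congr_ae (.of_forall fun g => ?_)
    simp
    ring
  have hind : iIndepFun (fun (a : Fin m) (g : Fin m → Fin d → ℝ) => (∑ b, g a b * θ b) ^ 2)
      (sketchLaw m d) :=
    iIndepFun_pi (X := fun _ (x : Fin d → ℝ) => (∑ b, x b * θ b) ^ 2)
      (fun b => ((measurable_sum_mul θ).pow_const 2).aemeasurable)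
  have hvar : variance (fun g : Fin m → Fin d → ℝ => ∑ a, (∑ b, g a b * θ b) ^ 2)
      (sketchLaw m d) ≤ 3 * ‖θ‖ ^ 4 / m := by
    have := IndepFun.variance_sum (s := Finset.univ) (fun a _ => hY a)
      (fun a _ b _ hab => hind.indepFun hab)
    have e : (∑ a : Fin m, fun g : Fin m → Fin d → ℝ => (∑ b, g a b * θ b) ^ 2) =
      fun g => ∑ a, (∑ b, g a b * θ b) ^ 2 := by ext g; simp
    rw [← e, this]
    refine (Finset.sum_le_sum fun a _ => hvar1 a).trans (le_of_eq ?_)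
    simp
    field_simp
  have := meas_ge_le_variance_div_sq (memLp_finsetSum Finset.univ fun a _ => hY a) hc
  rw [hmean] at this
  simp_rw [sketchNorm_sq, Matrix.of_apply]
  refine this.trans (ENNReal.ofReal_le_ofReal ?_)
  rw [← div_div]
  gcongr

end ADE

/-! ### Representativeness -/

namespace ADE

open Classical in
/-- The number of matrices which distort the squared length of `θ` by at least `c`. -/
noncomputable def distortCount {l m d : ℕ} (c : ℝ) (g : Fin l → Fin m → Fin d → ℝ)
    (θ : EuclideanSpace ℝ (Fin d)) : ℕ :=
  (Finset.univ.filter fun j => c ≤ |sketchNorm (Matrix.of (g j)) θ ^ 2 - ‖θ‖ ^ 2|).card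

/-- The vectors of length at most `2` which more than one in thirty of the matrices distort. The
ball of radius `2` contains `v + w`, `v - w` and `w` for every unit vector `v` and every `w` in the
unit ball. -/
def distortSet {l m d : ℕ} (c : ℝ) (g : Fin l → Fin m → Fin d → ℝ) :
    Set (EuclideanSpace ℝ (Fin d)) :=
  {θ | θ ∈ Metric.closedBall 0 2 ∧ l < 30 * distortCount c g θ}

theorem measurable_distortCount (l m d : ℕ) (c : ℝ) :
    Measurable fun p : (Fin l → Fin m → Fin d → ℝ) × EuclideanSpace ℝ (Fin d) =>
      distortCount c p.1 p.2 := by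
  simp only [distortCount, Finset.card_filter]
  refine Finset.measurable_sum _ fun j _ => ?_
  refine Measurable.ite ?_ measurable_const measurable_const
  refine measurableSet_le measurable_const ?_
  simp_rw [sketchNorm_sq, Matrix.of_apply]
  refine (Measurable.sub ?_ (by fun_prop)).abs
  refine Finset.measurable_sum _ fun a _ => (Finset.measurable_sum _ fun b _ => ?_).pow_const 2
  fun_prop

theorem measurableSet_distortSet (l m d : ℕ) (c : ℝ) :
    MeasurableSet {p : (Fin l → Fin m → Fin d → ℝ) × EuclideanSpace ℝ (Fin d) |
      p.2 ∈ distortSet c p.1} := by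
  refine MeasurableSet.inter (measurable_snd Metric.isClosed_closedBall.measurableSet) ?_
  exact measurableSet_lt measurable_const ((measurable_distortCount l m d c).const_mul 30)

/-- The parallelogram law, for the quadratic form `w ↦ ‖M w‖² - ‖w‖²`. -/
theorem sketchNorm_parallelogram {m d : ℕ} (M : Matrix (Fin m) (Fin d) ℝ)
    (v w : EuclideanSpace ℝ (Fin d)) :
    2 * (sketchNorm M v ^ 2 - ‖v‖ ^ 2) = (sketchNorm M (v + w) ^ 2 - ‖v + w‖ ^ 2) +
      (sketchNorm M (v - w) ^ 2 - ‖v - w‖ ^ 2) - 2 * (sketchNorm M w ^ 2 - ‖w‖ ^ 2) := by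
  have h1 := parallelogram_law_with_norm ℝ v w
  have h2 := parallelogram_law_with_norm ℝ (WithLp.toLp 2 (M *ᵥ v.ofLp))
    (WithLp.toLp 2 (M *ᵥ w.ofLp))
  rw [← WithLp.toLp_add, ← WithLp.toLp_sub, ← Matrix.mulVec_add, ← Matrix.mulVec_sub] at h2
  simp only [sketchNorm, WithLp.ofLp_add, WithLp.ofLp_sub]
  linarith

/-- If the set of distorted vectors is small, then around every unit vector `v` there are
`v + w`, `v - w` and `w` outside this set, and `v` is well represented by the parallelogram law. -/
theorem isRepresentative_of_volume_lt {l m d : ℕ} {ε : ℝ} (hε : 0 < ε) (hε1 : ε < 1)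
    {g : Fin l → Fin m → Fin d → ℝ}
    (hv : 3 * volume (distortSet (ε / 2) g) <
      volume (Metric.ball (0 : EuclideanSpace ℝ (Fin d)) 1)) :
    IsRepresentative ε fun j => Matrix.of (g j) := by
  classical
  intro v hv1
  set T := distortSet (ε / 2) g with hT
  have hTm : MeasurableSet T := measurable_prodMk_left (measurableSet_distortSet l m d (ε / 2))
  obtain ⟨w, hw, h1, h2, h3⟩ : ∃ w ∈ Metric.ball (0 : EuclideanSpace ℝ (Fin d)) 1,
      v + w ∉ T ∧ v - w ∉ T ∧ w ∉ T := by
    by_contra! hcon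
    -- otherwise three isometric images of `T` cover the unit ball
    have hsub : Metric.ball (0 : EuclideanSpace ℝ (Fin d)) 1 ⊆
        ((v + ·) ⁻¹' T ∪ (v - ·) ⁻¹' T) ∪ T := by
      intro w hw
      by_cases h1 : v + w ∈ T
      · exact .inl (.inl h1)
      · by_cases h2 : v - w ∈ T
        · exact .inl (.inr h2)
        · exact .inr (hcon w hw h1 h2)
    have e1 : volume ((v + ·) ⁻¹' T) = volume T := measure_preimage_add _ _ _
    have e2 : volume ((v - ·) ⁻¹' T) = volume T :=
      (Measure.measurePreserving_sub_left volume v).measure_preimage hTm.nullMeasurableSet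
    refine absurd hv (not_lt.2 ((measure_mono hsub).trans ?_))
    refine (measure_union_le _ _).trans ((add_le_add_left (measure_union_le _ _) _).trans ?_)
    rw [e1, e2]
    apply le_of_eq; ring
  rw [mem_ball_zero_iff] at hw
  have hN : ∀ u : EuclideanSpace ℝ (Fin d), ‖u‖ ≤ 2 → u ∉ T →
      30 * distortCount (ε / 2) g u ≤ l := by
    intro u hu huT
    by_contra! hlt
    exact huT ⟨by simpa using hu, hlt⟩
  have n1 := hN _ ((norm_add_le v w).trans (by linarith)) h1
  have n2 := hN _ ((norm_sub_le v w).trans (by linarith)) h2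
  have n3 := hN _ (by linarith) h3
  set G := Finset.univ.filter fun j : Fin l => 1 - ε ≤ sketchNorm (Matrix.of (g j)) v ∧
    sketchNorm (Matrix.of (g j)) v ≤ 1 + ε with hG
  -- a matrix which distorts none of `v + w`, `v - w` and `w` is good for `v`
  have hcard : l ≤ G.card + (distortCount (ε / 2) g (v + w) + distortCount (ε / 2) g (v - w) +
      distortCount (ε / 2) g w) := by
    have hcov : (Finset.univ : Finset (Fin l)) ⊆ G ∪
        (((Finset.univ.filter fun j =>
          ε / 2 ≤ |sketchNorm (Matrix.of (g j)) (v + w) ^ 2 - ‖v + w‖ ^ 2|) ∪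
        (Finset.univ.filter fun j =>
          ε / 2 ≤ |sketchNorm (Matrix.of (g j)) (v - w) ^ 2 - ‖v - w‖ ^ 2|)) ∪
        (Finset.univ.filter fun j =>
          ε / 2 ≤ |sketchNorm (Matrix.of (g j)) w ^ 2 - ‖w‖ ^ 2|)) := by
      intro j _
      by_contra hj
      simp only [Finset.mem_union, Finset.mem_filter, Finset.mem_univ, true_and, not_or, not_le,
        hG, abs_lt] at hj
      obtain ⟨hj0, ⟨⟨a1, a2⟩, b1, b2⟩, c1, c2⟩ := hj
      have hp := sketchNorm_parallelogram (Matrix.of (g j)) v w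
      rw [hv1] at hp
      -- `|2 (‖M v‖² - 1)| < ε / 2 + ε / 2 + 2 (ε / 2)`, that is, `|‖M v‖² - 1| < ε`
      have hs : 0 ≤ sketchNorm (Matrix.of (g j)) v := norm_nonneg _
      exact hj0 ⟨by nlinarith, by nlinarith⟩
    have h := Finset.card_le_card hcov
    rw [Finset.card_univ, Fintype.card_fin] at h
    refine h.trans ((Finset.card_union_le _ _).trans ?_)
    gcongr
    exact (Finset.card_union_le _ _).trans (add_le_add (Finset.card_union_le _ _) le_rfl)
  have : 9 * l ≤ 10 * G.card := by omega
  have : (9 : ℝ) * l ≤ 10 * G.card := by exact_mod_cast this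
  show (9 / 10 : ℝ) * l ≤ (G.card : ℝ)
  linarith

theorem gaussianSketchLaw_eq (l m d : ℕ) :
    gaussianSketchLaw l m d = Measure.pi fun _ => sketchLaw m d := rfl

instance (l m d : ℕ) : IsProbabilityMeasure (gaussianSketchLaw l m d) := by
  unfold gaussianSketchLaw; infer_instance

/-- A fixed vector is distorted by more than `l / 30` of the matrices with exponentially small
probability. -/
theorem gaussianSketchLaw_mem_distortSet_le {l m d : ℕ} {ε : ℝ} (hε : 0 < ε)
    (hm : (sketchConst : ℝ) ≤ m * ε ^ 2) (θ : EuclideanSpace ℝ (Fin d)) :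
    gaussianSketchLaw l m d {g | θ ∈ distortSet (ε / 2) g} ≤
      2 ^ l * ((2 ^ 150 : ℝ≥0∞)⁻¹) ^ (l / 30 + 1) := by
  classical
  by_cases hθ : θ ∈ Metric.closedBall (0 : EuclideanSpace ℝ (Fin d)) 2
  swap
  · have : {g : Fin l → Fin m → Fin d → ℝ | θ ∈ distortSet (ε / 2) g} = ∅ := by
      ext g; simp only [distortSet, Set.mem_ofPred_eq, hθ, false_and, Set.mem_empty_iff_false]
    rw [this]; simp
  have hm0 : m ≠ 0 := by
    rintro rfl
    norm_num [sketchConst] at hm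
  have hθ' : ‖θ‖ ≤ 2 := by simpa using hθ
  have hp : sketchLaw m d {g | ε / 2 ≤ |sketchNorm (Matrix.of g) θ ^ 2 - ‖θ‖ ^ 2|} ≤
      (2 ^ 150 : ℝ≥0∞)⁻¹ := by
    refine (sketchLaw_deviation_le (by omega) θ (by positivity)).trans ?_
    have e : (2 ^ 150 : ℝ≥0∞)⁻¹ = ENNReal.ofReal ((2 ^ 150 : ℝ)⁻¹) := by
      rw [ENNReal.ofReal_inv_of_pos (by positivity), ENNReal.ofReal_pow (by norm_num)]
      norm_num
    rw [e]
    refine ENNReal.ofReal_le_ofReal ?_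
    have h4 : ‖θ‖ ^ 4 ≤ 2 ^ 4 := by gcongr
    have hmε : 0 < (m : ℝ) * ε ^ 2 := by positivity
    rw [sketchConst] at hm
    push_cast at hm
    rw [inv_eq_one_div, div_le_div_iff₀ (by positivity) (by positivity)]
    nlinarith
  calc _ ≤ gaussianSketchLaw l m d {g | l / 30 + 1 ≤ (Finset.univ.filter fun j =>
        g j ∈ {g | ε / 2 ≤ |sketchNorm (Matrix.of g) θ ^ 2 - ‖θ‖ ^ 2|}).card} := by
        refine measure_mono ?_
        rintro g ⟨-, h⟩
        have h : l < 30 * (Finset.univ.filter fun j =>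
          g j ∈ {g | ε / 2 ≤ |sketchNorm (Matrix.of g) θ ^ 2 - ‖θ‖ ^ 2|}).card := h
        rw [Set.mem_ofPred_eq]
        omega
    _ ≤ _ := by
        rw [gaussianSketchLaw_eq]
        refine (pi_card_mem_ge_le _
          {g | ε / 2 ≤ |sketchNorm (Matrix.of g) θ ^ 2 - ‖θ‖ ^ 2|} _).trans ?_
        rw [Fintype.card_fin]
        gcongr

/-- By Fubini's theorem, the expected volume of the set of distorted vectors is exponentially small,
and Markov's inequality bounds the probability that it is too large for
`isRepresentative_of_volume_lt`. The ball of radius `2` is `2 ^ d` times as large as the unit ball;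
as `d ≤ l`, this factor does no harm. -/
theorem gaussianSketchLaw_not_isRepresentative_le {l m d k : ℕ} {ε δ : ℝ} (hε : 0 < ε) (hε1 : ε < 1)
    (hm : (sketchConst : ℝ) ≤ m * ε ^ 2) (hl : l = d + k) (hk : (1 : ℝ) ≤ 2 ^ k * δ) :
    gaussianSketchLaw l m d {g | ¬ IsRepresentative ε fun j => Matrix.of (g j)} ≤
      ENNReal.ofReal (δ / 2) := by
  set B := volume (Metric.ball (0 : EuclideanSpace ℝ (Fin d)) 1) with hB
  have hB0 : B ≠ 0 := (Metric.measure_ball_pos volume _ one_pos).ne'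
  have hBt : B ≠ ⊤ := measure_ball_lt_top.ne
  have hU := measurableSet_distortSet l m d (ε / 2)
  set q : ℝ≥0∞ := 2 ^ l * ((2 ^ 150 : ℝ≥0∞)⁻¹) ^ (l / 30 + 1) with hq
  have hvol : volume (Metric.closedBall (0 : EuclideanSpace ℝ (Fin d)) 2) = 2 ^ d * B := by
    rw [Measure.addHaar_closedBall _ _ (by norm_num)]
    simp [ENNReal.ofReal_pow]
    rfl
  have hint : ∫⁻ g, volume (distortSet (ε / 2) g) ∂gaussianSketchLaw l m d ≤ 2 ^ d * B * q := by
    calc _ = ((gaussianSketchLaw l m d).prod volume)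
          {p : (Fin l → Fin m → Fin d → ℝ) × EuclideanSpace ℝ (Fin d) |
            p.2 ∈ distortSet (ε / 2) p.1} := (Measure.prod_apply hU).symm
      _ = ∫⁻ θ, gaussianSketchLaw l m d {g | θ ∈ distortSet (ε / 2) g} :=
          Measure.prod_apply_symm hU
      _ = ∫⁻ θ in Metric.closedBall 0 2,
            gaussianSketchLaw l m d {g | θ ∈ distortSet (ε / 2) g} := by
          rw [setLIntegral_eq_of_support_subset]
          intro θ hθ
          by_contra hc
          refine hθ ?_
          have : {g : Fin l → Fin m → Fin d → ℝ | θ ∈ distortSet (ε / 2) g} = ∅ := by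
            ext g; simp only [distortSet, Set.mem_ofPred_eq, hc, false_and, Set.mem_empty_iff_false]
          simp [this]
      _ ≤ ∫⁻ θ in Metric.closedBall (0 : EuclideanSpace ℝ (Fin d)) 2, q :=
          lintegral_mono fun θ => gaussianSketchLaw_mem_distortSet_le hε hm θ
      _ = _ := by rw [setLIntegral_const, hvol, mul_comm]
  have hmeas' : Measurable fun g : Fin l → Fin m → Fin d → ℝ => volume (distortSet (ε / 2) g) :=
    measurable_measure_prodMk_left hU
  have hmarkov := mul_meas_ge_le_lintegral (μ := gaussianSketchLaw l m d) (hmeas'.const_mul 3) B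
  rw [lintegral_const_mul _ hmeas'] at hmarkov
  calc _ ≤ gaussianSketchLaw l m d {g | B ≤ 3 * volume (distortSet (ε / 2) g)} := by
        refine measure_mono fun g hg => ?_
        by_contra hlt
        exact hg (isRepresentative_of_volume_lt hε hε1 (not_le.1 hlt))
    _ ≤ 3 * (2 ^ d * q) := by
        rw [← ENNReal.mul_le_mul_iff_right hB0 hBt]
        refine hmarkov.trans ?_
        calc _ ≤ 3 * (2 ^ d * B * q) := by gcongr
          _ = _ := by ring
    _ ≤ ENNReal.ofReal ((2 ^ (k + 1) : ℝ)⁻¹) := by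
        rw [ENNReal.ofReal_inv_of_pos (by positivity), ENNReal.ofReal_pow (by norm_num),
          ENNReal.ofReal_ofNat, ENNReal.le_inv_iff_mul_le, hq, ← ENNReal.inv_pow, ← pow_mul]
        have h1 : (2 ^ (150 * (l / 30 + 1)) : ℝ≥0∞)⁻¹ ≤ (2 ^ (2 * l + 3))⁻¹ := by
          rw [ENNReal.inv_le_inv]
          exact pow_le_pow_right₀ (by norm_num) (by omega)
        calc _ ≤ 3 * (2 ^ d * (2 ^ l * (2 ^ (2 * l + 3) : ℝ≥0∞)⁻¹)) * 2 ^ (k + 1) := by gcongr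
          _ = (6 * 2 ^ (2 * l)) * (2 ^ (2 * l + 3) : ℝ≥0∞)⁻¹ := by rw [hl]; ring
          _ ≤ 2 ^ (2 * l + 3) * (2 ^ (2 * l + 3) : ℝ≥0∞)⁻¹ := by
            gcongr
            rw [pow_add, mul_comm]
            gcongr
            norm_num
          _ ≤ 1 := ENNReal.mul_inv_le_one _
    _ ≤ _ := by
        refine ENNReal.ofReal_le_ofReal ?_
        rw [inv_le_iff_one_le_mul₀ (by positivity), pow_succ]
        linarith

end ADE

/-! ### The laws of the matrices and of the sampled indices -/

namespace ADE

instance : IsProbabilityMeasure tapeMeasure := by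
  unfold tapeMeasure
  infer_instance

/-- The sketching matrices read off from a tape. The division by `√m` scales the variance to
`1 / m`. -/
noncomputable def tapeMatrix (l m d : ℕ) (ω : Tape) (j : Fin l) : Matrix (Fin m) (Fin d) ℝ :=
  Matrix.of fun a b => ω.1 (j * m * d + a * d + b) / √m

/-- The index sampled in round `k`. A draw below `l` is the entry `(k, l - 1)` of the tape. -/
def tapeIndex {l : ℕ} (hl : 0 < l) (ω : Tape) (k : ℕ) : Fin l :=
  ⟨ω.2 (k, l - 1), by have := (ω.2 (k, l - 1)).2; omega⟩

theorem hasLaw_tapeMatrix {l m d : ℕ} :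
    HasLaw (fun ω j a b => tapeMatrix l m d ω j a b) (gaussianSketchLaw l m d) tapeMeasure := by
  have s1 : MeasurePreserving (Prod.fst : Tape → ℕ → ℝ) tapeMeasure
      (Measure.infinitePi fun _ : ℕ => gaussianReal 0 1) := measurePreserving_fst
  -- different entries come from different draws
  have hf : Function.Injective fun p : Fin l × Fin m × Fin d =>
      (p.1 * m * d + p.2.1 * d + p.2.2 : ℕ) := by
    rintro ⟨j, a, b⟩ ⟨j', a', b'⟩ h
    simp only [← Nat.add_mul] at h
    obtain ⟨h1, h2⟩ := eq_of_mul_add_eq b.2 b'.2 h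
    obtain ⟨h3, h4⟩ := eq_of_mul_add_eq a.2 a'.2 h1
    simp [Fin.ext_iff, h2, h3, h4]
  have s2 : MeasurePreserving (fun (w : ℕ → ℝ) (p : Fin l × Fin m × Fin d) =>
      w (p.1 * m * d + p.2.1 * d + p.2.2)) (Measure.infinitePi fun _ : ℕ => gaussianReal 0 1)
      (Measure.infinitePi fun _ : Fin l × Fin m × Fin d => gaussianReal 0 1) :=
    ⟨by fun_prop, Measure.map_infinitePi_infinitePi_of_inj
      (P := fun _ : ℕ => gaussianReal 0 1) hf⟩
  have hdiv : (gaussianReal 0 1).map (fun x => x / √m) = gaussianReal 0 (1 / (m : ℝ≥0)) := by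
    rw [gaussianReal_map_div_const]
    congr 1
    · simp
    · ext
      simp
  have s3 : MeasurePreserving (fun (w : Fin l × Fin m × Fin d → ℝ) p => w p / √m)
      (Measure.infinitePi fun _ : Fin l × Fin m × Fin d => gaussianReal 0 1)
      (Measure.infinitePi fun _ : Fin l × Fin m × Fin d => gaussianReal 0 (1 / (m : ℝ≥0))) := by
    refine ⟨by fun_prop, ?_⟩
    have := Measure.infinitePi_map_pi (fun _ : Fin l × Fin m × Fin d => gaussianReal 0 1)
      (f := fun _ x => x / √m) (fun _ => by fun_prop)
    rw [this]
    simp_rw [hdiv]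
  have s4 : MeasurePreserving (MeasurableEquiv.curry (Fin l) (Fin m × Fin d) ℝ)
      (Measure.infinitePi fun _ : Fin l × Fin m × Fin d => gaussianReal 0 (1 / (m : ℝ≥0)))
      (Measure.infinitePi fun _ : Fin l => Measure.infinitePi fun _ : Fin m × Fin d =>
        gaussianReal 0 (1 / (m : ℝ≥0))) :=
    ⟨by fun_prop, Measure.infinitePi_map_curry
      (fun (_ : Fin l) (_ : Fin m × Fin d) => gaussianReal 0 (1 / (m : ℝ≥0)))⟩
  have s5 : MeasurePreserving (fun (w : Fin l → Fin m × Fin d → ℝ) j =>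
        MeasurableEquiv.curry (Fin m) (Fin d) ℝ (w j))
      (Measure.infinitePi fun _ : Fin l => Measure.infinitePi fun _ : Fin m × Fin d =>
        gaussianReal 0 (1 / (m : ℝ≥0))) (gaussianSketchLaw l m d) := by
    refine ⟨by fun_prop, ?_⟩
    have := Measure.infinitePi_map_pi (fun _ : Fin l => Measure.infinitePi fun _ : Fin m × Fin d =>
      gaussianReal 0 (1 / (m : ℝ≥0)))
      (f := fun _ => MeasurableEquiv.curry (Fin m) (Fin d) ℝ) (fun _ => by fun_prop)
    rw [this]
    simp_rw [Measure.infinitePi_map_curry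
      (fun (_ : Fin m) (_ : Fin d) => gaussianReal 0 (1 / (m : ℝ≥0))), Measure.infinitePi_eq_pi]
    rfl
  have h := s5.comp (s4.comp (s3.comp (s2.comp s1)))
  exact ⟨h.measurable.aemeasurable, h.map_eq⟩

theorem hasLaw_tapeIndex {l : ℕ} (hl : 0 < l) (r : ℕ) :
    HasLaw (fun ω (k : Fin r) => tapeIndex hl ω k) (sampleLaw l r) tapeMeasure := by
  obtain ⟨l, rfl⟩ := Nat.exists_eq_add_of_le' hl
  have s1 : MeasurePreserving (Prod.snd : Tape → (p : ℕ × ℕ) → Fin (p.2 + 1)) tapeMeasure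
      (Measure.infinitePi fun p : ℕ × ℕ => uniformOn (Set.univ : Set (Fin (p.2 + 1)))) :=
    measurePreserving_snd
  have hf : Function.Injective fun k : Fin r => ((k : ℕ), l) := by
    intro k k' h
    simpa [Fin.ext_iff] using h
  have s2 : MeasurePreserving (fun (w : (p : ℕ × ℕ) → Fin (p.2 + 1)) (k : Fin r) => w (k, l))
      (Measure.infinitePi fun p : ℕ × ℕ => uniformOn (Set.univ : Set (Fin (p.2 + 1))))
      (sampleLaw (l + 1) r) := by
    refine ⟨by fun_prop, ?_⟩
    have := Measure.map_infinitePi_infinitePi_of_inj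
      (P := fun p : ℕ × ℕ => uniformOn (Set.univ : Set (Fin (p.2 + 1)))) hf
    rw [sampleLaw, ← Measure.infinitePi_eq_pi]
    exact this
  have h := s2.comp s1
  exact ⟨h.measurable.aemeasurable, h.map_eq⟩

/-! ### Medians of sampled sketches -/

/-- The element of rank `k` among `y 0, …, y (len - 1)`; zero if there is none. -/
noncomputable def orderStat (y : ℕ → ℝ) (len k : ℕ) : ℝ :=
  if h : k < len then y (exists_isOrderStat y h).choose else 0

theorem isOrderStat_orderStat (y : ℕ → ℝ) {len k : ℕ} (h : k < len) :
    IsOrderStat y len k (orderStat y len k) := by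
  rw [orderStat, dif_pos h]
  exact (exists_isOrderStat y h).choose_spec.2

theorem IsOrderStat.isMedian {y : ℕ → ℝ} {h : ℕ} {z : ℝ} (hz : IsOrderStat y (2 * h + 1) h z) :
    IsMedian (fun k : Fin (2 * h + 1) => y k) z := by
  classical
  have e := cnt_add_cnt_not (fun i => y i < z) (2 * h + 1)
  have h1 := hz.1
  have h2 := hz.2
  simp only [not_lt] at e
  constructor
  · rw [← cnt_eq_card_fin (fun i => y i ≤ z)]; omega
  · rw [← cnt_eq_card_fin (fun i => z ≤ y i)]; omega

/-- The answer to a query: medians of the sketched distances under the sampled matrices. -/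
noncomputable def medianAnswer {l m n d : ℕ} (h : ℕ) (x : Fin n → EuclideanSpace ℝ (Fin d))
    (M : Fin l → Matrix (Fin m) (Fin d) ℝ) (j : ℕ → Fin l) (q : EuclideanSpace ℝ (Fin d))
    (i : Fin n) : ℝ :=
  orderStat (fun k => sketchNorm (M (j k)) (q - x i)) (2 * h + 1) h

theorem sketchNorm_smul {m d : ℕ} (M : Matrix (Fin m) (Fin d) ℝ) (c : ℝ)
    (v : EuclideanSpace ℝ (Fin d)) : sketchNorm M (c • v) = |c| * sketchNorm M v := by
  rw [sketchNorm, sketchNorm, WithLp.ofLp_smul, Matrix.mulVec_smul, WithLp.toLp_smul, norm_smul,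
    Real.norm_eq_abs]

open Classical in
/-- By homogeneity, representative matrices are good for all vectors, not only for unit vectors. -/
theorem IsRepresentative.card_bad_le {l m d : ℕ} {ε : ℝ} {M : Fin l → Matrix (Fin m) (Fin d) ℝ}
    (hM : IsRepresentative ε M) (u : EuclideanSpace ℝ (Fin d)) :
    10 * (Finset.univ.filter fun j => ¬ ((1 - ε) * ‖u‖ ≤ sketchNorm (M j) u ∧
      sketchNorm (M j) u ≤ (1 + ε) * ‖u‖)).card ≤ l := by
  by_cases hu : u = 0
  · subst hu
    have : ∀ j, sketchNorm (M j) 0 = 0 := fun j => by simp [sketchNorm]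
    simp [this]
  have hu' : 0 < ‖u‖ := norm_pos_iff.2 hu
  have h := hM (‖u‖⁻¹ • u) (by rw [norm_smul, norm_inv, norm_norm, inv_mul_cancel₀ hu'.ne'])
  have e : ∀ j, (1 - ε ≤ sketchNorm (M j) (‖u‖⁻¹ • u) ∧ sketchNorm (M j) (‖u‖⁻¹ • u) ≤ 1 + ε) ↔
      ((1 - ε) * ‖u‖ ≤ sketchNorm (M j) u ∧ sketchNorm (M j) u ≤ (1 + ε) * ‖u‖) := by
    intro j
    rw [sketchNorm_smul, abs_of_pos (by positivity), inv_mul_eq_div, le_div_iff₀ hu',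
      div_le_iff₀ hu']
  simp_rw [e] at h
  have h2 := Finset.card_filter_add_card_filter_not (s := (Finset.univ : Finset (Fin l)))
    (fun j => (1 - ε) * ‖u‖ ≤ sketchNorm (M j) u ∧ sketchNorm (M j) u ≤ (1 + ε) * ‖u‖)
  rw [Finset.card_univ, Fintype.card_fin] at h2
  have h3 : 9 * l ≤ 10 * (Finset.univ.filter fun j => (1 - ε) * ‖u‖ ≤ sketchNorm (M j) u ∧
      sketchNorm (M j) u ≤ (1 + ε) * ‖u‖).card := by
    have : (9 : ℝ) * l ≤ 10 * (Finset.univ.filter fun j => (1 - ε) * ‖u‖ ≤ sketchNorm (M j) u ∧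
      sketchNorm (M j) u ≤ (1 + ε) * ‖u‖).card := by linarith
    exact_mod_cast this
  omega

/-- At most a tenth of the matrices are bad for `q - x i`, and the median is wrong only if more than
half of the sampled matrices are bad. -/
theorem sampleLaw_not_isAccurate_le {l m n d k h : ℕ} {ε δ : ℝ} (hl : 0 < l)
    {M : Fin l → Matrix (Fin m) (Fin d) ℝ} (hM : IsRepresentative ε M) (hh : h = k + 1)
    (hk : (n : ℝ) ≤ 2 ^ k * δ)
    (x : Fin n → EuclideanSpace ℝ (Fin d)) (q : EuclideanSpace ℝ (Fin d)) :
    tapeMeasure {ω | ¬ IsAccurate ε x q (medianAnswer h x M (tapeIndex hl ω) q)} ≤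
      ENNReal.ofReal (δ / 2) := by
  classical
  set bad : Fin n → Set (Fin l) := fun i => {j | ¬ ((1 - ε) * ‖q - x i‖ ≤
    sketchNorm (M j) (q - x i) ∧ sketchNorm (M j) (q - x i) ≤ (1 + ε) * ‖q - x i‖)} with hbad
  have : Nonempty (Fin l) := ⟨⟨0, hl⟩⟩
  have hμ : ∀ i, uniformOn (Set.univ : Set (Fin l)) (bad i) ≤ 10⁻¹ := by
    intro i
    have h := hM.card_bad_le (q - x i)
    rw [uniformOn_univ, Measure.count_apply (Set.toFinite _).measurableSet,
      Set.encard_eq_coe_toFinset_card, Fintype.card_fin]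
    have e : (bad i).toFinset = Finset.univ.filter fun j => ¬ ((1 - ε) * ‖q - x i‖ ≤
        sketchNorm (M j) (q - x i) ∧ sketchNorm (M j) (q - x i) ≤ (1 + ε) * ‖q - x i‖) := by
      ext j; simp [hbad]
    rw [e]
    refine ENNReal.div_le_of_le_mul ?_
    set N := (Finset.univ.filter fun j => ¬ ((1 - ε) * ‖q - x i‖ ≤
        sketchNorm (M j) (q - x i) ∧ sketchNorm (M j) (q - x i) ≤ (1 + ε) * ‖q - x i‖)).card
    have hN : (10 : ℝ≥0∞) * N ≤ l := by exact_mod_cast h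
    calc (N : ℝ≥0∞) = 10⁻¹ * (10 * N) := by
          rw [← mul_assoc, ENNReal.inv_mul_cancel (by simp) (by simp), one_mul]
      _ ≤ 10⁻¹ * l := by gcongr
  have hsub : {ω : Tape | ¬ IsAccurate ε x q (medianAnswer h x M (tapeIndex hl ω) q)} ⊆
      ⋃ i, (fun ω (k : Fin (2 * h + 1)) => tapeIndex hl ω k) ⁻¹'
        {f | h + 1 ≤ (Finset.univ.filter fun k => f k ∈ bad i).card} := by
    intro ω hω
    simp only [IsAccurate, not_forall, Set.mem_ofPred_eq] at hω
    obtain ⟨i, hi⟩ := hω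
    refine Set.mem_iUnion.2 ⟨i, ?_⟩
    rw [Set.mem_preimage, Set.mem_ofPred_eq, ← cnt_eq_card_fin (fun k => tapeIndex hl ω k ∈ bad i)]
    set y : ℕ → ℝ := fun k => sketchNorm (M (tapeIndex hl ω k)) (q - x i) with hy
    have hO : IsOrderStat y (2 * h + 1) h (medianAnswer h x M (tapeIndex hl ω) q i) :=
      isOrderStat_orderStat _ (by omega)
    set z := medianAnswer h x M (tapeIndex hl ω) q i
    have e := cnt_add_cnt_not (fun i => y i < z) (2 * h + 1)
    have h1 := hO.1
    have h2 := hO.2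
    -- a median which is too large has `h + 1` samples not below it, one which is too small has
    -- `h + 1` samples not above it
    by_cases hz : (1 - ε) * ‖q - x i‖ ≤ z
    · have hz' : (1 + ε) * ‖q - x i‖ < z := not_le.1 fun hc => hi ⟨hz, hc⟩
      have : cnt (fun k => ¬ y k < z) (2 * h + 1) ≤
          cnt (fun k => tapeIndex hl ω k ∈ bad i) (2 * h + 1) :=
        cnt_mono fun k _ hk hb => not_lt.2 hb.2 (hz'.trans_le (not_lt.1 hk))
      omega
    · have : cnt (fun k => y k ≤ z) (2 * h + 1) ≤
          cnt (fun k => tapeIndex hl ω k ∈ bad i) (2 * h + 1) :=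
        cnt_mono fun k _ hk hb => hz (hb.1.trans hk)
      omega
  have hJ := hasLaw_tapeIndex hl (2 * h + 1)
  calc _ ≤ _ := measure_mono hsub
    _ ≤ ∑ i : Fin n, tapeMeasure ((fun ω (k : Fin (2 * h + 1)) => tapeIndex hl ω k) ⁻¹'
        {f | h + 1 ≤ (Finset.univ.filter fun k => f k ∈ bad i).card}) :=
      measure_iUnion_fintype_le _ _
    _ ≤ ∑ i : Fin n, 2 ^ (2 * h + 1) * (10⁻¹ : ℝ≥0∞) ^ (h + 1) := by
      refine Finset.sum_le_sum fun i _ => ?_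
      rw [← Measure.map_apply_of_aemeasurable hJ.aemeasurable (Set.toFinite _).measurableSet,
        hJ.map_eq, sampleLaw]
      refine (pi_card_mem_ge_le _ (bad i) _).trans ?_
      rw [Fintype.card_fin]
      gcongr
      exact hμ i
    _ = ENNReal.ofReal (n * (2 ^ (2 * h + 1) * (10⁻¹) ^ (h + 1))) := by
      rw [ENNReal.ofReal_mul (by positivity), ENNReal.ofReal_mul (by positivity),
        ENNReal.ofReal_pow (by norm_num), ENNReal.ofReal_pow (by norm_num),
        ENNReal.ofReal_inv_of_pos (by norm_num)]
      simp
    _ ≤ _ := by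
      refine ENNReal.ofReal_le_ofReal ?_
      have e1 : (2 : ℝ) ^ (2 * h + 1) * (10⁻¹) ^ (h + 1) = (2 / 25) * (2 / 5) ^ k := by
        have : (2 / 5 : ℝ) = 2 ^ 2 * 10⁻¹ := by norm_num
        rw [this, mul_pow, ← pow_mul, hh]
        ring
      -- each of the `n` points fails with probability at most `(2 / 25) (2 / 5) ^ k`, and
      -- `2 ^ (-k)` is at most `δ / n`
      have e2 : (2 / 5 : ℝ) ^ k ≤ (2⁻¹) ^ k := by gcongr; norm_num
      have e3 : (2 : ℝ) ^ k * (2⁻¹) ^ k = 1 := by rw [← mul_pow]; norm_num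
      rw [e1]
      have hδ : 0 ≤ δ := by
        have : (0 : ℝ) ≤ 2 ^ k * δ := le_trans (by positivity) hk
        exact nonneg_of_mul_nonneg_right this (by positivity)
      calc (n : ℝ) * (2 / 25 * (2 / 5) ^ k) ≤ 2 ^ k * δ * (2 / 25 * 2⁻¹ ^ k) := by gcongr
        _ = 2 / 25 * δ * (2 ^ k * 2⁻¹ ^ k) := by ring
        _ ≤ δ / 2 := by rw [e3]; linarith

end ADE

/-! ### Adaptive queries -/

namespace ADE

theorem measurable_cnt {α : Type*} [MeasurableSpace α] {p : ℕ → α → Prop}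
    (hp : ∀ k, MeasurableSet {a | p k a}) (n : ℕ) : Measurable fun a => cnt (fun k => p k a) n := by
  classical
  induction n with
  | zero => simp
  | succ n ih =>
    have e : (fun a => cnt (fun k => p k a) (n + 1)) =
        fun a => cnt (fun k => p k a) n + if p n a then 1 else 0 := by
      funext a
      by_cases h : p n a
      · rw [cnt_succ_of h, if_pos h]
      · rw [cnt_succ_of_not h, if_neg h, add_zero]
    rw [e]
    exact ih.add (Measurable.ite (hp n) measurable_const measurable_const)

theorem measurable_orderStat {α : Type*} [MeasurableSpace α] {y : ℕ → α → ℝ}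
    (hy : ∀ k, Measurable (y k)) {len k : ℕ} (hk : k < len) :
    Measurable fun a => orderStat (fun i => y i a) len k := by
  refine measurable_of_Iic fun c => ?_
  have e : (fun a => orderStat (fun i => y i a) len k) ⁻¹' Set.Iic c =
      {a | k < cnt (fun i => y i a ≤ c) len} := by
    ext a
    exact (isOrderStat_orderStat _ hk).le_iff c
  rw [e]
  exact measurableSet_lt measurable_const
    (measurable_cnt (fun i => measurableSet_le (hy i) measurable_const) len)

theorem measurable_tapeIndex {l : ℕ} (hl : 0 < l) (k : ℕ) :
    Measurable fun ω => tapeIndex hl ω k := by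
  have h : Measurable fun ω : Tape => ω.2 (k, l - 1) :=
    (measurable_pi_apply (k, l - 1)).comp measurable_snd
  exact (measurable_from_top (f := fun b : Fin (l - 1 + 1) => (⟨b, by omega⟩ : Fin l))).comp h

/-- Joint measurability in both tapes and the query. -/
theorem measurable_medianAnswer {l m n d : ℕ} (hl : 0 < l) (h : ℕ)
    (x : Fin n → EuclideanSpace ℝ (Fin d)) :
    Measurable fun p : Tape × Tape × EuclideanSpace ℝ (Fin d) =>
      medianAnswer h x (tapeMatrix l m d p.1) (tapeIndex hl p.2.1) p.2.2 := by
  refine measurable_pi_lambda _ fun i => measurable_orderStat (fun k => ?_) (by omega)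
  have hj : ∀ j : Fin l, Measurable fun p : Tape × Tape × EuclideanSpace ℝ (Fin d) =>
      sketchNorm (tapeMatrix l m d p.1 j) (p.2.2 - x i) := by
    intro j
    have e : (fun p : Tape × Tape × EuclideanSpace ℝ (Fin d) =>
        sketchNorm (tapeMatrix l m d p.1 j) (p.2.2 - x i)) = fun p =>
        √(∑ a : Fin m, (∑ b : Fin d, (p.1.1 (j * m * d + a * d + b) / √m) *
          (p.2.2 b - x i b)) ^ 2) := by
      funext p
      have h0 : 0 ≤ sketchNorm (tapeMatrix l m d p.1 j) (p.2.2 - x i) := norm_nonneg _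
      rw [← Real.sqrt_sq h0, sketchNorm_sq]
      rfl
    rw [e]
    refine (Finset.measurable_sum _ fun a _ =>
      (Finset.measurable_sum _ fun b _ => ?_).pow_const 2).sqrt
    have : Measurable fun p : Tape × Tape × EuclideanSpace ℝ (Fin d) =>
        p.1.1 (j * m * d + a * d + b) :=
      (measurable_pi_apply _).comp (measurable_fst.comp measurable_fst)
    exact (this.div_const _).mul (by fun_prop)
  refine measurable_of_Iic fun c => ?_
  have e : (fun p : Tape × Tape × EuclideanSpace ℝ (Fin d) =>
      sketchNorm (tapeMatrix l m d p.1 (tapeIndex hl p.2.1 k)) (p.2.2 - x i)) ⁻¹' Set.Iic c =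
      ⋃ j : Fin l, {p | tapeIndex hl p.2.1 k = j} ∩
        {p | sketchNorm (tapeMatrix l m d p.1 j) (p.2.2 - x i) ≤ c} := by
    ext p
    simp
  rw [e]
  refine MeasurableSet.iUnion fun j => MeasurableSet.inter ?_ (measurableSet_le (hj j)
    measurable_const)
  exact ((measurable_tapeIndex hl k).comp (measurable_fst.comp measurable_snd))
    (measurableSet_singleton j)

theorem measurableSet_isAccurate {n d : ℕ} (ε : ℝ) (x : Fin n → EuclideanSpace ℝ (Fin d)) :
    MeasurableSet {p : EuclideanSpace ℝ (Fin d) × (Fin n → ℝ) | IsAccurate ε x p.1 p.2} := by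
  simp only [IsAccurate]
  measurability

theorem adaptiveAnswer_eq {Q A : Type*} (respond : ℕ → Q → A) (adv : (t : ℕ) → (Fin t → A) → Q)
    (t : ℕ) : adaptiveAnswer respond adv t = respond t (adaptiveQuery respond adv t) := by
  rw [adaptiveAnswer, adaptiveQuery]

/-- The query of round `t` only depends on the responses of the earlier rounds. -/
theorem adaptiveQuery_congr {Q A : Type*} {respond respond' : ℕ → Q → A}
    (adv : (t : ℕ) → (Fin t → A) → Q) (t : ℕ) (h : ∀ s < t, respond s = respond' s) :
    adaptiveQuery respond adv t = adaptiveQuery respond' adv t := by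
  induction t using Nat.strong_induction_on with
  | _ t ih =>
    rw [adaptiveQuery, adaptiveQuery]
    congr 1
    funext s
    rw [adaptiveAnswer_eq, adaptiveAnswer_eq, ih s s.2 fun s' hs' => h s' (hs'.trans s.2), h s s.2]

theorem measurable_adaptiveQuery {Ω Q A : Type*} [MeasurableSpace Ω] [MeasurableSpace Q]
    [MeasurableSpace A] {respond : Ω → ℕ → Q → A} {adv : Ω → (t : ℕ) → (Fin t → A) → Q}
    (hr : ∀ t, Measurable fun p : Ω × Q => respond p.1 t p.2)
    (ha : ∀ t, Measurable fun p : Ω × (Fin t → A) => adv p.1 t p.2) (t : ℕ) :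
    Measurable fun z => adaptiveQuery (respond z) (adv z) t := by
  induction t using Nat.strong_induction_on with
  | _ t ih =>
    simp only [adaptiveQuery]
    refine (ha t).comp (measurable_id.prodMk (measurable_pi_lambda _ fun s => ?_))
    simp only [adaptiveAnswer_eq]
    exact (hr s).comp (measurable_id.prodMk (ih s s.2))

/-- Resampling one coordinate does not change an infinite product measure. -/
theorem measurePreserving_update {α : Type*} [MeasurableSpace α] (μ : Measure α)
    [IsProbabilityMeasure μ] (t : ℕ) :
    MeasurePreserving (fun p : (ℕ → α) × α => Function.update p.1 t p.2)
      ((Measure.infinitePi fun _ : ℕ => μ).prod μ) (Measure.infinitePi fun _ : ℕ => μ) := by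
  have hm : Measurable fun p : (ℕ → α) × α => Function.update p.1 t p.2 := by
    refine measurable_pi_lambda _ fun s => ?_
    by_cases hs : s = t
    · subst hs; simpa using measurable_snd
    · simp only [Function.update_of_ne hs]
      exact (measurable_pi_apply s).comp measurable_fst
  refine ⟨hm, Measure.eq_infinitePi _ fun s T hT => ?_⟩
  classical
  rw [Measure.map_apply hm (.pi s.countable_toSet fun i _ => hT i)]
  have e : (fun p : (ℕ → α) × α => Function.update p.1 t p.2) ⁻¹' (s : Set ℕ).pi T =
      ((s.erase t : Finset ℕ) : Set ℕ).pi T ×ˢ (if t ∈ s then T t else Set.univ) := by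
    ext ⟨w, u⟩
    simp only [Set.mem_preimage, Set.mem_pi, Finset.mem_coe, Set.mem_prod, Finset.mem_erase]
    constructor
    · intro h
      refine ⟨fun i hi => by simpa [hi.1] using h i hi.2, ?_⟩
      split_ifs with hts
      · simpa using h t hts
      · trivial
    · rintro ⟨h1, h2⟩ i hi
      by_cases hit : i = t
      · subst hit; simpa [hi] using h2
      · simpa [hit] using h1 i ⟨hit, hi⟩
  rw [e, Measure.prod_prod, Measure.infinitePi_pi _ fun i _ => hT i]
  split_ifs with hts
  · exact Finset.prod_erase_mul s (fun i => μ (T i)) hts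
  · rw [Finset.erase_eq_of_notMem hts, measure_univ, mul_one]

/-- If for all `ω` outside a set of small probability every fixed query is answered correctly
with high probability, then so is every adaptively chosen query, since the query of round `t`
is independent of the randomness used to answer it. -/
theorem adaptive_failure_le {n d : ℕ} {ε δ : ℝ} (hδ : 0 ≤ δ) (x : Fin n → EuclideanSpace ℝ (Fin d))
    {ans : Tape → Tape → EuclideanSpace ℝ (Fin d) → Fin n → ℝ}
    (hans : Measurable fun p : Tape × Tape × EuclideanSpace ℝ (Fin d) => ans p.1 p.2.1 p.2.2)
    {good : Tape → Prop} (hgood : tapeMeasure {ω | ¬ good ω} ≤ ENNReal.ofReal (δ / 2))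
    (hacc : ∀ ω, good ω → ∀ q, tapeMeasure {ω' | ¬ IsAccurate ε x q (ans ω ω' q)} ≤
      ENNReal.ofReal (δ / 2))
    {Θ : Type*} [MeasurableSpace Θ] (ρ : Measure Θ) [IsProbabilityMeasure ρ]
    (adv : Θ → (t : ℕ) → (Fin t → Fin n → ℝ) → EuclideanSpace ℝ (Fin d))
    (hadv : ∀ t, Measurable fun p : Θ × (Fin t → Fin n → ℝ) => adv p.1 t p.2) (t : ℕ) :
    (tapeMeasure.prod ((Measure.infinitePi fun _ : ℕ => tapeMeasure).prod ρ))
      {z | ¬ IsAccurate ε x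
          (adaptiveQuery (fun s => ans z.1 (z.2.1 s)) (adv z.2.2) t)
          (adaptiveAnswer (fun s => ans z.1 (z.2.1 s)) (adv z.2.2) t)} ≤ ENNReal.ofReal δ := by
  have hq : Measurable fun z : Tape × (ℕ → Tape) × Θ =>
      adaptiveQuery (fun s => ans z.1 (z.2.1 s)) (adv z.2.2) t := by
    refine measurable_adaptiveQuery (respond := fun (z : Tape × (ℕ → Tape) × Θ) s =>
      ans z.1 (z.2.1 s)) (adv := fun z => adv z.2.2) (fun s => ?_) (fun s => ?_) t
    · have : Measurable fun p : (Tape × (ℕ → Tape) × Θ) × EuclideanSpace ℝ (Fin d) =>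
          (p.1.1, p.1.2.1 s, p.2) := by
        refine (measurable_fst.comp measurable_fst).prodMk (Measurable.prodMk ?_ measurable_snd)
        exact (measurable_pi_apply s).comp
          (measurable_fst.comp (measurable_snd.comp measurable_fst))
      exact hans.comp this
    · exact (hadv s).comp ((measurable_snd.comp (measurable_snd.comp measurable_fst)).prodMk
        measurable_snd)
  have ha : Measurable fun z : Tape × (ℕ → Tape) × Θ =>
      adaptiveAnswer (fun s => ans z.1 (z.2.1 s)) (adv z.2.2) t := by
    simp only [adaptiveAnswer_eq]
    have h2 : Measurable fun z : Tape × (ℕ → Tape) × Θ => z.2.1 t :=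
      (measurable_pi_apply t).comp (measurable_fst.comp measurable_snd)
    exact hans.comp (measurable_fst.prodMk (h2.prodMk hq))
  set bad := {z : Tape × (ℕ → Tape) × Θ | ¬ IsAccurate ε x
    (adaptiveQuery (fun s => ans z.1 (z.2.1 s)) (adv z.2.2) t)
    (adaptiveAnswer (fun s => ans z.1 (z.2.1 s)) (adv z.2.2) t)} with hbad
  have hbm : MeasurableSet bad := ((hq.prodMk ha) (measurableSet_isAccurate ε x)).compl
  -- the failure probability for a fixed outcome `ω` of the preprocessing
  have hfix : ∀ ω, good ω → ((Measure.infinitePi fun _ : ℕ => tapeMeasure).prod ρ)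
      (Prod.mk ω ⁻¹' bad) ≤ ENNReal.ofReal (δ / 2) := by
    intro ω hω
    rw [Measure.prod_apply_symm (measurable_prodMk_left hbm)]
    refine (lintegral_mono (g := fun _ => ENNReal.ofReal (δ / 2)) fun θ => ?_).trans (by simp)
    have hm : MeasurableSet ((fun w : ℕ → Tape => (w, θ)) ⁻¹' (Prod.mk ω ⁻¹' bad)) :=
      measurable_prodMk_right (measurable_prodMk_left hbm)
    -- independence of the tapes: the tape of round `t` may be resampled
    rw [← (measurePreserving_update tapeMeasure t).measure_preimage hm.nullMeasurableSet,
      Measure.prod_apply ((measurePreserving_update tapeMeasure t).measurable hm)]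
    refine (lintegral_mono (g := fun _ => ENNReal.ofReal (δ / 2)) fun w => ?_).trans (by simp)
    -- the query of round `t` does not change when the tape of round `t` is resampled
    refine (measure_mono ?_).trans
      (hacc ω hω (adaptiveQuery (fun s => ans ω (w s)) (adv θ) t))
    intro u hu
    have hqu : adaptiveQuery (fun s => ans ω (Function.update w t u s)) (adv θ) t =
        adaptiveQuery (fun s => ans ω (w s)) (adv θ) t :=
      adaptiveQuery_congr _ _ fun s hs => by rw [Function.update_of_ne hs.ne]
    simp only [hbad, Set.mem_preimage, Set.mem_ofPred_eq, adaptiveAnswer_eq, hqu,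
      Function.update_self] at hu
    exact hu
  rw [Measure.prod_apply hbm]
  -- `good` is not assumed to be measurable
  set N := toMeasurable tapeMeasure {ω | ¬ good ω} with hN
  calc _ ≤ ∫⁻ ω, (ENNReal.ofReal (δ / 2) + N.indicator 1 ω) ∂tapeMeasure := by
        refine lintegral_mono fun ω => ?_
        by_cases hω : ω ∈ N
        · rw [Set.indicator_of_mem hω]
          exact prob_le_one.trans le_add_self
        · have : good ω := by
            by_contra hg
            exact hω (subset_toMeasurable _ _ hg)
          exact (hfix ω this).trans le_self_add
    _ = ENNReal.ofReal (δ / 2) + tapeMeasure {ω | ¬ good ω} := by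
        rw [lintegral_add_left measurable_const,
          lintegral_indicator_one (measurableSet_toMeasurable _ _), measure_toMeasurable]
        simp
    _ ≤ ENNReal.ofReal (δ / 2) + ENNReal.ofReal (δ / 2) := by gcongr
    _ = ENNReal.ofReal δ := by
        rw [← ENNReal.ofReal_add (by positivity) (by positivity), add_halves]

end ADE

/-! ### The content of the data structure -/

namespace ADE

/-- The data structure: the parameters, the matrices, and from cell `l m d` on the sketches, where
the coordinate `a` of the sketch of point `i` under matrix `j` is in cell `l m d + (j n + i) m + a`;
the quotients and remainders recover `j`, `i` and `a` from the address. -/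
noncomputable def dataHeap {n d : ℕ} (hn : 0 < n) (m l h : ℕ)
    (x : Fin n → EuclideanSpace ℝ (Fin d)) (ω : Tape) : Heap where
  nat := paramCells n d m l h
  real c := if c < l * m * d then ω.1 c / √m else
    ∑ b : Fin d, ω.1 ((c - l * m * d) / m / n * m * d + (c - l * m * d) % m * d + b) / √m *
      x ⟨(c - l * m * d) / m % n, Nat.mod_lt _ hn⟩ b

theorem dataHeap_real_matrix {n d m l h : ℕ} (hn : 0 < n) (x : Fin n → EuclideanSpace ℝ (Fin d))
    (ω : Tape) (j : Fin l) (a : Fin m) (b : Fin d) :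
    j * m * d + a * d + b < l * m * d ∧
      (dataHeap hn m l h x ω).real (j * m * d + a * d + b) = tapeMatrix l m d ω j a b := by
  have e1 : j * m * d + m * d ≤ l * m * d := by
    rw [← Nat.add_mul, ← Nat.succ_mul]; gcongr; exact j.2
  have e2 : a * d + d ≤ m * d := by rw [← Nat.succ_mul]; gcongr; exact a.2
  have hlt : j * m * d + a * d + b < l * m * d := by omega
  exact ⟨hlt, if_pos hlt⟩

theorem dataHeap_real_sketch {n d m l h : ℕ} (hn : 0 < n) (x : Fin n → EuclideanSpace ℝ (Fin d))
    (ω : Tape) (j : Fin l) (i : Fin n) (a : Fin m) :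
    l * m * d + (j * n + i) * m + a < l * m * (n + d) ∧
      (dataHeap hn m l h x ω).real (l * m * d + (j * n + i) * m + a) =
        (tapeMatrix l m d ω j *ᵥ (x i).ofLp) a := by
  have e2 : (j * n + i) * m + m ≤ l * n * m := by
    rw [← Nat.succ_mul]
    have : j * n + n ≤ l * n := by rw [← Nat.succ_mul]; gcongr; exact j.2
    gcongr; omega
  have e3 : l * m * (n + d) = l * m * d + l * n * m := by ring
  refine ⟨by omega, ?_⟩
  have hsub : l * m * d + (j * n + i) * m + a - l * m * d = (j * n + i) * m + a := by omega
  have h1 : ((j * n + i) * m + a : ℕ) / m = j * n + i := by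
    rw [mul_comm, Nat.mul_add_div a.pos, Nat.div_eq_of_lt a.2, add_zero]
  have h2 : ((j * n + i) * m + a : ℕ) % m = a := by
    rw [Nat.mul_add_mod', Nat.mod_eq_of_lt a.2]
  have h3 : (j * n + i : ℕ) / n = j := by
    rw [mul_comm, Nat.mul_add_div hn, Nat.div_eq_of_lt i.2, add_zero]
  have h4 : (j * n + i : ℕ) % n = i := by
    rw [Nat.mul_add_mod', Nat.mod_eq_of_lt i.2]
  simp only [dataHeap]
  rw [if_neg (by omega)]
  simp only [hsub, h1, h2, h3, h4]
  rfl

theorem memSketchDist_dataHeap {n d m l h : ℕ} (hn : 0 < n) (x : Fin n → EuclideanSpace ℝ (Fin d))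
    (ω : Tape) {q : EuclideanSpace ℝ (Fin d)} {inp : ℕ → ℝ} (hq : IsQueryInput q inp) (j : Fin l)
    (i : Fin n) : memSketchDist n d m l (dataHeap hn m l h x ω).real inp j i =
      sketchNorm (tapeMatrix l m d ω j) (q - x i) := by
  have h0 : 0 ≤ sketchNorm (tapeMatrix l m d ω j) (q - x i) := norm_nonneg _
  rw [← Real.sqrt_sq h0, sketchNorm_sq, memSketchDist, Finset.sum_range]
  congr 1
  refine Finset.sum_congr rfl fun a _ => ?_
  rw [(dataHeap_real_sketch hn x ω j i a).2, Finset.sum_range, Matrix.mulVec, dotProduct,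
    ← Finset.sum_sub_distrib]
  congr 1
  refine Finset.sum_congr rfl fun b _ => ?_
  rw [(dataHeap_real_matrix hn x ω j a b).2, hq b, ← mul_sub]
  rfl

theorem preProgram_runs_dataHeap {n d m k₁ k₂ : ℕ} {ε δ : ℝ} (hn : 1 ≤ n) (hd : 1 ≤ d)
    (hm0 : 1 ≤ m) (hm : (sketchConst : ℝ) ≤ m * ε ^ 2)
    (hm' : ∀ m' < m, (m' : ℝ) * ε ^ 2 < sketchConst)
    (hk₁ : (1 : ℝ) ≤ 2 ^ k₁ * δ) (hk₁' : ∀ k' < k₁, 2 ^ k' * δ < (1 : ℝ))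
    (hk₂ : (n : ℝ) ≤ 2 ^ k₂ * δ) (hk₂' : ∀ k' < k₂, 2 ^ k' * δ < (n : ℝ))
    (x : Fin n → EuclideanSpace ℝ (Fin d)) (ω : Tape) {inp : ℕ → ℝ} (hinp : IsDataInput ε δ x inp) :
    ∃ t h, preProgram.Runs inp ω [n, d] Heap.zero t h ∧
      t ≤ 300 * ((d + k₁) * m * n * d + k₂) ∧
      Heap.AgreeBelow ((d + k₁) * m * (n + d)) (dataHeap hn m (d + k₁) (k₂ + 1) x ω) h := by
  obtain ⟨h0, h1, h2⟩ := hinp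
  obtain ⟨t, h, hr, ht, hnat, hM, hY⟩ :=
    preProgram_runs hn hd hm0 h0 h1 hm hm' hk₁ hk₁' hk₂ hk₂' ω
  refine ⟨t, h, hr, ht, fun c hc => ⟨by rw [hnat]; rfl, ?_⟩⟩
  set l := d + k₁ with hl
  by_cases hc' : c < l * m * d
  · rw [hM c hc']
    exact if_pos hc'
  obtain ⟨e, rfl⟩ := Nat.exists_eq_add_of_le (not_lt.1 hc')
  have e3 : l * m * (n + d) = l * m * d + m * (n * l) := by ring
  have hj : e / m / n < l := by
    rw [Nat.div_div_eq_div_mul]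
    refine Nat.div_lt_of_lt_mul ?_
    rw [mul_assoc]; omega
  have hi : e / m % n < n := Nat.mod_lt _ hn
  have ha : e % m < m := Nat.mod_lt _ hm0
  have he : l * m * d + e = l * m * d + (e / m / n * n + e / m % n) * m + e % m := by
    rw [Nat.div_add_mod', add_assoc, Nat.div_add_mod']
  rw [he, hY _ hj _ hi _ ha]
  refine ((dataHeap_real_sketch hn x ω ⟨_, hj⟩ ⟨_, hi⟩ ⟨_, ha⟩).2).trans ?_
  rw [Finset.sum_range, Matrix.mulVec, dotProduct]
  refine Finset.sum_congr rfl fun b _ => ?_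
  rw [h2 ⟨_, hi⟩ b]
  rfl

/-- The memory beyond the data structure may hold anything when the query starts. -/
theorem queryProgram_runs_dataHeap {n d m l h : ℕ} (hn : 1 ≤ n) (hd : 1 ≤ d) (hm : 3 ≤ m)
    (hl : 1 ≤ l) (x : Fin n → EuclideanSpace ℝ (Fin d)) (ω ω' : Tape)
    {q : EuclideanSpace ℝ (Fin d)} {inp : ℕ → ℝ} (hq : IsQueryInput q inp) {h₀ : Heap}
    (hD : Heap.AgreeBelow (l * m * (n + d)) (dataHeap hn m l h x ω) h₀) :
    ∃ t h', queryProgram.Runs inp ω' [] h₀ t h' ∧ t ≤ 6000 * (m * (n + d) * (2 * h + 1)) ∧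
      Heap.AgreeBelow (l * m * (n + d)) (dataHeap hn m l h x ω) h' ∧
      ∀ i : Fin n, h'.real (l * m * (n + d) + i) =
        medianAnswer h x (tapeMatrix l m d ω) (tapeIndex hl ω') q i := by
  -- the five parameters are among the cells of the data structure
  have hS : 1 * 3 * (1 + 1) ≤ l * m * (n + d) := by gcongr
  have hc : ∀ c < 5, h₀.nat c = paramCells n d m l h c := fun c hc => (hD c (by omega)).1.symm
  obtain ⟨t, h', hr, ht, hnat, hreal, hO⟩ := queryProgram_runs (n := n) (d := d) (m := m)
    (l := l) (h := h) hn hd (by omega) hl (hc 0 (by norm_num)) (hc 1 (by norm_num))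
    (hc 2 (by norm_num)) (hc 3 (by norm_num)) (hc 4 (by norm_num)) inp ω'
  refine ⟨t, h', hr, ht, fun c hc => ?_, fun i => ?_⟩
  · rw [hnat, hreal c hc]
    exact hD c hc
  · refine (hO i i.2).unique (IsOrderStat.congr
      (isOrderStat_orderStat _ (by omega : h < 2 * h + 1)) fun k _ => ?_)
    have hj : (ω'.2 (k, l - 1) : ℕ) < l := (tapeIndex hl ω' k).2
    rw [← memSketchDist_dataHeap (h := h) hn x ω hq]
    exact memSketchDist_congr hj i.2 (fun c hc => (hD c hc).2) fun _ _ => rfl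

/-! ### The parameters -/

theorem exists_least_pow_mul {N δ : ℝ} (hδ : 0 < δ) :
    ∃ k : ℕ, N ≤ 2 ^ k * δ ∧ ∀ k' < k, 2 ^ k' * δ < N := by
  classical
  have hex : ∃ k : ℕ, N ≤ 2 ^ k * δ := by
    obtain ⟨k, hk⟩ := pow_unbounded_of_one_lt (N / δ) (one_lt_two : (1 : ℝ) < 2)
    exact ⟨k, ((div_lt_iff₀ hδ).1 hk).le⟩
  exact ⟨Nat.find hex, Nat.find_spec hex, fun k' hk' => not_le.1 (Nat.find_min hex hk')⟩

theorem exists_least_mul_sq {K ε : ℝ} (hε : 0 < ε) :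
    ∃ m : ℕ, K ≤ m * ε ^ 2 ∧ ∀ m' < m, (m' : ℝ) * ε ^ 2 < K := by
  classical
  have hex : ∃ m : ℕ, K ≤ m * ε ^ 2 := by
    obtain ⟨m, hm⟩ := exists_nat_ge (K / ε ^ 2)
    exact ⟨m, (div_le_iff₀ (by positivity)).1 hm⟩
  exact ⟨Nat.find hex, Nat.find_spec hex, fun k' hk' => not_le.1 (Nat.find_min hex hk')⟩

/-- The least `k` with `N ≤ 2 ^ k δ` is `log (N / δ)`, up to constants. -/
theorem log_bounds_of_least {N δ : ℝ} {k : ℕ} (hδ : 0 < δ) (hN : δ ≤ N)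
    (hk : N ≤ 2 ^ k * δ) (hk' : ∀ k' < k, 2 ^ k' * δ < N) :
    0 ≤ Real.log (N / δ) ∧ Real.log (N / δ) ≤ k ∧ (k : ℝ) ≤ 1 + 2 * Real.log (N / δ) := by
  have h2 := Real.log_two_gt_d9
  have h2' := Real.log_two_lt_d9
  have hN0 : 0 < N / δ := by have := hδ.trans_le hN; positivity
  have h0 : 0 ≤ Real.log (N / δ) := Real.log_nonneg ((one_le_div hδ).2 hN)
  refine ⟨h0, ?_, ?_⟩
  · have := Real.log_le_log hN0 ((div_le_iff₀ hδ).2 hk)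
    rw [Real.log_pow] at this
    have hk0 : (0 : ℝ) ≤ k := by positivity
    nlinarith
  · rcases k with _ | k
    · simp; linarith
    · have := Real.log_le_log (by positivity) ((lt_div_iff₀ hδ).2 (hk' k (by omega))).le
      rw [Real.log_pow] at this
      push_cast
      have hk0 : (0 : ℝ) ≤ k := by positivity
      nlinarith

end ADE

theorem mainTheorem2 :
    ∃ (pre query : ADE.Program) (c C : ℝ), 0 < c ∧ 0 < C ∧
    ∀ (ε δ : ℝ), 0 < ε → ε < 1 → 0 < δ → δ < 1 →
    ∀ (n d : ℕ), 1 ≤ n → 1 ≤ d →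
    -- the parameters and the size of the data structure
    ∃ (m l r S : ℕ),
      (c / ε ^ 2 ≤ m ∧ m ≤ C / ε ^ 2) ∧
      (c * (d + Real.log (1 / δ)) ≤ l ∧ l ≤ C * (d + Real.log (1 / δ))) ∧
      (c * (1 + Real.log (n / δ)) ≤ r ∧ r ≤ C * (1 + Real.log (n / δ))) ∧
      (S : ℝ) ≤ C * (ε ^ 2)⁻¹ * (n + d) * (d + Real.log (1 / δ)) ∧
    -- the sketching matrices, the sampled indices and the places where sketches are stored
    ∃ (M : ADE.Tape → Fin l → Matrix (Fin m) (Fin d) ℝ) (J : ADE.Tape → Fin r → Fin l)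
      (addrM : Fin l → Fin m → Fin d → ℕ) (addrY : Fin l → Fin n → Fin m → ℕ),
      HasLaw (fun ω j a b => M ω j a b) (ADE.gaussianSketchLaw l m d) ADE.tapeMeasure ∧
      HasLaw J (ADE.sampleLaw l r) ADE.tapeMeasure ∧
      -- with high probability the matrices are representative
      ADE.tapeMeasure {ω | ¬ ADE.IsRepresentative ε (M ω)} ≤ ENNReal.ofReal (δ / 2) ∧
    ∀ x : Fin n → EuclideanSpace ℝ (Fin d),
    ∃ (D : ADE.Tape → ADE.Heap)
      (ans : ADE.Tape → ADE.Tape → EuclideanSpace ℝ (Fin d) → Fin n → ℝ),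
      -- preprocessing: running time, and content of the data structure
      (∀ (ω : ADE.Tape) (inp : ℕ → ℝ), ADE.IsDataInput ε δ x inp →
        ∃ (t : ℕ) (h : ADE.Heap), pre.Runs inp ω [n, d] ADE.Heap.zero t h ∧
          (t : ℝ) ≤ C * (ε ^ 2)⁻¹ * n * d * (d + Real.log (1 / δ)) ∧
          ADE.Heap.AgreeBelow S (D ω) h) ∧
      (∀ (ω : ADE.Tape) (j : Fin l) (a : Fin m),
        (∀ b : Fin d, addrM j a b < S ∧ (D ω).real (addrM j a b) = M ω j a b) ∧
        (∀ i : Fin n, addrY j i a < S ∧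
          (D ω).real (addrY j i a) = (M ω j *ᵥ (x i).ofLp) a)) ∧
      -- a query: running time and output; the memory outside the data structure is arbitrary,
      -- and the data structure is left intact
      (∀ (ω ω' : ADE.Tape) (q : EuclideanSpace ℝ (Fin d)) (inp : ℕ → ℝ) (h₀ : ADE.Heap),
        ADE.IsQueryInput q inp → ADE.Heap.AgreeBelow S (D ω) h₀ →
        ∃ (t : ℕ) (h : ADE.Heap), query.Runs inp ω' [] h₀ t h ∧
          (t : ℝ) ≤ C * (ε ^ 2)⁻¹ * (n + d) * (1 + Real.log (n / δ)) ∧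
          ADE.Heap.AgreeBelow S (D ω) h ∧
          ∀ i : Fin n, h.real (S + i) = ans ω ω' q i) ∧
      -- the answer is a median over the sampled sketches
      (∀ (ω ω' : ADE.Tape) (q : EuclideanSpace ℝ (Fin d)) (i : Fin n),
        ADE.IsMedian (fun k : Fin r => ADE.sketchNorm (M ω (J ω' k)) (q - x i))
          (ans ω ω' q i)) ∧
      -- once the matrices are representative, every query succeeds with high probability
      (∀ ω : ADE.Tape, ADE.IsRepresentative ε (M ω) → ∀ q : EuclideanSpace ℝ (Fin d),
        ADE.tapeMeasure {ω' | ¬ ADE.IsAccurate ε x q (ans ω ω' q)} ≤ ENNReal.ofReal (δ / 2)) ∧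
      -- every query of every adaptive (possibly randomized) adversary succeeds
      (∀ (Θ : Type*) [MeasurableSpace Θ] (ρ : Measure Θ) [IsProbabilityMeasure ρ]
        (adv : Θ → (t : ℕ) → (Fin t → Fin n → ℝ) → EuclideanSpace ℝ (Fin d)),
        (∀ t, Measurable fun p : Θ × (Fin t → Fin n → ℝ) => adv p.1 t p.2) →
        ∀ t : ℕ,
          (ADE.tapeMeasure.prod
            ((Measure.infinitePi fun _ : ℕ => ADE.tapeMeasure).prod ρ))
            {z | ¬ ADE.IsAccurate ε x
                (ADE.adaptiveQuery (fun s => ans z.1 (z.2.1 s)) (adv z.2.2) t)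
                (ADE.adaptiveAnswer (fun s => ans z.1 (z.2.1 s)) (adv z.2.2) t)}
            ≤ ENNReal.ofReal δ) := by
  refine ⟨ADE.preProgram, ADE.queryProgram, 1, 30000 * (ADE.sketchConst + 1), one_pos,
    by positivity, ?_⟩
  intro ε δ hε hε1 hδ hδ1 n d hn hd
  obtain ⟨m, hm, hm'⟩ := ADE.exists_least_mul_sq (K := ADE.sketchConst) hε
  obtain ⟨k₁, hk₁, hk₁'⟩ := ADE.exists_least_pow_mul (N := 1) hδ
  obtain ⟨k₂, hk₂, hk₂'⟩ := ADE.exists_least_pow_mul (N := n) hδ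
  have hn' : (1 : ℝ) ≤ n := by exact_mod_cast hn
  have hd' : (1 : ℝ) ≤ d := by exact_mod_cast hd
  obtain ⟨hL0, hL1, hL2⟩ := ADE.log_bounds_of_least hδ hδ1.le hk₁ hk₁'
  obtain ⟨hR0, hR1, hR2⟩ := ADE.log_bounds_of_least hδ (hδ1.le.trans hn') hk₂ hk₂'
  have hε2 : 0 < ε ^ 2 := by positivity
  have hε2' : ε ^ 2 ≤ 1 := pow_le_one₀ hε.le hε1.le
  set K : ℝ := (ADE.sketchConst : ℝ) with hK
  have hK3 : (3 : ℝ) ≤ K := by rw [hK, ADE.sketchConst]; norm_num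
  have hmK : K ≤ m := hm.trans (mul_le_of_le_one_right (by positivity) hε2')
  have hm3 : 3 ≤ m := by exact_mod_cast hK3.trans hmK
  have hmu : (m : ℝ) ≤ (K + 1) * (ε ^ 2)⁻¹ := by
    have h := hm' (m - 1) (by omega)
    rw [Nat.cast_sub (by omega), Nat.cast_one, sub_mul] at h
    rw [← div_eq_mul_inv, le_div_iff₀ hε2]
    linarith
  set L := Real.log (1 / δ) with hL
  set R := Real.log (n / δ) with hR
  have hlu : ((d + k₁ : ℕ) : ℝ) ≤ 2 * (d + L) := by push_cast; linarith
  have hru : ((2 * (k₂ + 1) + 1 : ℕ) : ℝ) ≤ 5 * (1 + R) := by push_cast; linarith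
  have hl0 : 0 < d + k₁ := by omega
  have hKpos : 0 < K + 1 := by linarith
  have hεi : 0 < (ε ^ 2)⁻¹ := by positivity
  have hdL : 0 < d + L := by linarith
  -- only the law of the matrices matters
  have hrep : ADE.tapeMeasure {ω | ¬ ADE.IsRepresentative ε (ADE.tapeMatrix (d + k₁) m d ω)} ≤
      ENNReal.ofReal (δ / 2) := by
    have h := ADE.gaussianSketchLaw_not_isRepresentative_le (l := d + k₁) (m := m) (d := d) hε hε1
      hm rfl hk₁
    have hM := ADE.hasLaw_tapeMatrix (l := d + k₁) (m := m) (d := d)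
    rw [← hM.map_eq] at h
    exact (MeasureTheory.Measure.le_map_apply hM.aemeasurable _).trans h
  -- `l = d + k₁` is `Θ(d + log (1 / δ))`, and `r = 2 (k₂ + 1) + 1` is `Θ(1 + log (n / δ))`
  refine ⟨m, d + k₁, 2 * (k₂ + 1) + 1, (d + k₁) * m * (n + d), ⟨?_, ?_⟩, ⟨?_, ?_⟩, ⟨?_, ?_⟩, ?_,
    ADE.tapeMatrix (d + k₁) m d, fun ω k => ADE.tapeIndex hl0 ω k,
    fun j a b => j * m * d + a * d + b, fun j i a => (d + k₁) * m * d + (j * n + i) * m + a,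
    ADE.hasLaw_tapeMatrix, ADE.hasLaw_tapeIndex hl0 _, hrep, fun x => ?_⟩
  · rw [div_le_iff₀ hε2]; linarith
  · rw [div_eq_mul_inv]
    refine hmu.trans ?_
    gcongr
    linarith
  · push_cast; linarith
  · refine hlu.trans ?_
    gcongr
    linarith
  · push_cast; linarith
  · refine hru.trans ?_
    gcongr
    linarith
  · push_cast at hlu ⊢
    calc ((d : ℝ) + k₁) * m * (n + d) ≤ (2 * (d + L)) * ((K + 1) * (ε ^ 2)⁻¹) * (n + d) := by gcongr
      _ = 2 * ((K + 1) * (ε ^ 2)⁻¹ * (n + d) * (d + L)) := by ring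
      _ ≤ 30000 * ((K + 1) * (ε ^ 2)⁻¹ * (n + d) * (d + L)) := by gcongr; norm_num
      _ = _ := by ring
  have hacc : ∀ ω, ADE.IsRepresentative ε (ADE.tapeMatrix (d + k₁) m d ω) →
      ∀ q, ADE.tapeMeasure {ω' | ¬ ADE.IsAccurate ε x q (ADE.medianAnswer (k₂ + 1) x
        (ADE.tapeMatrix (d + k₁) m d ω) (ADE.tapeIndex hl0 ω') q)} ≤ ENNReal.ofReal (δ / 2) :=
    fun ω hω q => ADE.sampleLaw_not_isAccurate_le hl0 hω rfl hk₂ x q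
  refine ⟨ADE.dataHeap hn m (d + k₁) (k₂ + 1) x, fun ω ω' q => ADE.medianAnswer (k₂ + 1) x
    (ADE.tapeMatrix (d + k₁) m d ω) (ADE.tapeIndex hl0 ω') q, ?_, ?_, ?_, ?_, hacc, ?_⟩
  · intro ω inp hinp
    obtain ⟨t, h, hr, ht, hD⟩ := ADE.preProgram_runs_dataHeap hn hd (by omega) hm hm'
      (by simpa using hk₁) (by simpa using hk₁') hk₂ hk₂' x ω hinp
    refine ⟨t, h, hr, ?_, hD⟩
    -- `log (n / δ)` is at most `n + log (1 / δ)`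
    have hk : k₂ ≤ n + k₁ := by
      by_contra! hlt
      have h1 := hk₂' _ hlt
      have h2 : (n : ℝ) ≤ 2 ^ n := by exact_mod_cast Nat.lt_two_pow_self.le
      rw [pow_add, mul_assoc] at h1
      have h3 : (2 : ℝ) ^ n * 1 ≤ 2 ^ n * (2 ^ k₁ * δ) := by gcongr
      linarith
    have e1 : 1 * 1 * n * 1 ≤ (d + k₁) * m * n * d := by gcongr <;> omega
    have e2 : (d + k₁) * 1 * 1 * 1 ≤ (d + k₁) * m * n * d := by gcongr; omega
    have ht' : t ≤ 900 * ((d + k₁) * m * n * d) := by omega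
    have ht'' : (t : ℝ) ≤ 900 * (((d + k₁ : ℕ) : ℝ) * m * n * d) := by exact_mod_cast ht'
    calc (t : ℝ) ≤ _ := ht''
      _ ≤ 900 * ((2 * (d + L)) * ((K + 1) * (ε ^ 2)⁻¹) * n * d) := by gcongr
      _ = 1800 * ((K + 1) * (ε ^ 2)⁻¹ * n * d * (d + L)) := by ring
      _ ≤ 30000 * ((K + 1) * (ε ^ 2)⁻¹ * n * d * (d + L)) := by gcongr; norm_num
      _ = _ := by ring
  · intro ω j a
    refine ⟨fun b => ?_, fun i => ADE.dataHeap_real_sketch hn x ω j i a⟩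
    obtain ⟨h1, h2⟩ := ADE.dataHeap_real_matrix (h := k₂ + 1) hn x ω j a b
    refine ⟨h1.trans_le ?_, h2⟩
    gcongr
    omega
  · intro ω ω' q inp h₀ hq hD
    obtain ⟨t, h, hr, ht, hD', hans⟩ := ADE.queryProgram_runs_dataHeap hn hd hm3 hl0 x ω ω' hq hD
    refine ⟨t, h, hr, ?_, hD', hans⟩
    have ht' : (t : ℝ) ≤ 6000 * (m * (n + d) * ((2 * (k₂ + 1) + 1 : ℕ) : ℝ)) := by exact_mod_cast ht
    calc (t : ℝ) ≤ _ := ht'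
      _ ≤ 6000 * (((K + 1) * (ε ^ 2)⁻¹) * (n + d) * (5 * (1 + R))) := by gcongr
      _ = _ := by ring
  · intro ω ω' q i
    exact ADE.IsOrderStat.isMedian (h := k₂ + 1)
      (y := fun k => ADE.sketchNorm
        (ADE.tapeMatrix (d + k₁) m d ω (ADE.tapeIndex hl0 ω' k)) (q - x i))
      (ADE.isOrderStat_orderStat _ (by omega))
  · intro Θ _ ρ _ adv hadv t
    exact ADE.adaptive_failure_le hδ.le x (ADE.measurable_medianAnswer hl0 _ x) hrep hacc ρ adv
      hadv t
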